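/- **Setting.** Let $k\subset\mathbb R$ be a unital subring and $L=k[x]/(x^2-c_1x+c_2)$ a free quadratic $k$-algebra with $c_1^2-4c_2\in k^\times$; let $\tau$ be the class of $x$ and $\sigma=c_1-\tau$. Let $\mathcal U=L^n$, let $U$ be $\mathcal U$ regarded as a free $k$-module of rank $2n$, with the dot product $(-,-)$ in the $\{1,\tau\}$-basis, and let $T:U\to U$ be multiplication by $\tau$. A nonzero $u\in U$ is $\tau$-rational if its $L$-valued square $u\cdot u$ lies in $k$. Let $\Phi\subset\Lambda$ be a finite, nonempty, reduced root datum with simple system $\Delta$, and let $\Lambda\otimes_{\mathbb Z}k\subset U$ be a *folded representation* of it, that is: $\alpha^\vee(x)=2(\alpha,x)/(\alpha,\alpha)$ for $\alpha\in\Phi$, $x\in\Lambda$, and $u\mapsto 2(\alpha,u)/(\alpha,\alpha)$ is a $k$-valued functional on $U$, so that the reflections $s_\alpha$ act on $U$; the coefficient of $1$ of the $L$-valued dot product $u\cdot v$ is $(u,v)$ for all $u,v\in U$; $T(\Lambda)=\Lambda$ and $T(\mathbb Z\Phi)=\mathbb Z\Phi$; and $\Delta=\Delta^T\sqcup\Delta_{rat}\sqcup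 T(\Delta_{rat})$, where $\Delta^T=\{\alpha\in\Delta: T\alpha=\alpha\}$ and $\Delta_{rat}$ consists of $\tau$-rational simple roots. If $c_1=0$ (the split case, where $\Delta_{rat}$ is a matter of choice), assume that $(\alpha,T\beta)=0$ for all $\alpha,\beta\in\Delta_{rat}$ of equal length. Let $W=\langle s_\alpha:\alpha\in\Phi\rangle\le GL_k(U)$. Let $U_\tau$ be the $\tau$-eigenspace of $T\otimes 1$ on $U\otimes_kL$, and $\pi_\tau:U\to U_\tau$, $\pi_\tau(u)=(\tau-\sigma)^{-1}(T-\sigma)(u)$. For $\alpha\in\Delta^T$ (resp. $\alpha\in\Delta_{rat}$) let $r_\alpha\in\mathrm{Aut}_L(U_\tau)$ be the restriction to $U_\tau$ of the extension of $s_\alpha$ (resp. $s_\alpha s_{T\alpha}$). Let $W_\tau=\langle r_\alpha:\alpha\in\Delta^T\sqcup\Delta_{rat}\rangle$, and let $\iota:W_\tau\hookrightarrow W$ be the embedding with $r_\alpha\mapsto s_\alpha$ (resp. $r_\alpha\mapsto s_\alpha s_{T\alpha}$). Lengths $\ell$, $\ell_\tau$ and Bruhat orders on $W$, $W_\tau$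 are taken with respect to the generators $s_\alpha$ ($\alpha\in\Delta$), respectively $r_\alpha$ ($\alpha\in\Delta^T\sqcup\Delta_{rat}$). Let $\Delta_P\subset\Delta$ satisfy $T(\mathrm{span}_k\Delta_P)=\mathrm{span}_k\Delta_P$, and let $$W^P=\{w:\ell(ws_\alpha)>\ell(w)\ \forall\alpha\in\Delta_P\},\qquad W_\tau^P=\{u:\ell_\tau(ur_\alpha)>\ell_\tau(u)\ \forall\alpha\in\Delta_P\cap(\Delta^T\sqcup\Delta_{rat})\}.$$ Let $U_\Lambda=\Lambda\otimes k$, $S=\mathrm{Sym}_k(U_\Lambda)$, $S_\tau=\mathrm{Sym}_L(\pi_\tau(U_\Lambda))$, and let $\pi_\tau:S\to S_\tau$ also denote the induced ring homomorphism. The combinatorial Schubert class $\sigma_w$ of $w\in W$ is the function $W\to S$ given by $\sigma_w(x)=0$ if $w\not\le x$, and, if $w\le x=s_1\cdots s_r$ is an expression in simple reflections with simple roots $\alpha_1,\dots,\alpha_r$, by $$\sigma_w(x)=\sum_{i_1<\cdots<i_\ell,\ s_{i_1}\cdots s_{i_\ell}=w}\ \prod_{p=1}^{\ell}s_1s_2\cdots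 s_{i_p-1}(\alpha_{i_p}),\qquad \ell=\ell(w).$$ The Schubert class $\sigma_u:W_\tau\to S_\tau$ of $u\in W_\tau$ is defined in the same way from the generators $r_\alpha$ and the vectors $\pi_\tau(\alpha)$, $\alpha\in\Delta^T\sqcup\Delta_{rat}$. For $w\in W^P$ and $u\in W_\tau^P$ these functions are regarded as functions on $W^P$ and $W_\tau^P$, and the folding map is $\varphi^*(\xi)(v)=\pi_\tau\big(\xi(\iota(v))\big)$, $v\in W_\tau^P$. **Proposition.** Let $u\in W_\tau^P$ and $w\in W^P$, and put $\ell:=\ell_\tau(u)$. Then $\varphi^*(\sigma_w)=c\cdot\sigma_u$ on $W_\tau^P$ for some nonzero $c\in L$ if and only if all of the following hold: * (C1) $\ell(w)=\ell$; * (C2) $w\le\iota(u)$; * (C3) $w\not\le\iota(u')$ for every $u'\in W_\tau^P$ with $u\not\le u'$. -/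

import Mathlib

open scoped TensorProduct

noncomputable section

namespace Folding

/-! ### Words, length and Bruhat order in a group with a family of generators -/

section Words

variable {B G : Type*} [Group G] (s : B → G)

/-- The element represented by the expression `x = s_1 s_2 ⋯ s_r`. -/
def wordProd (x : List B) : G := (x.map s).prod

/-- The length of `g` with respect to the generators `s`. -/
def length (g : G) : ℕ := sInf {r | ∃ x : List B, x.length = r ∧ wordProd s x = g}

/-- The reflections are the conjugates of the generators. -/
def IsReflection (t : G) : Prop := ∃ g i, t = g * s i * g⁻¹

/-- The Bruhat order: the reflexive transitive closure of `x → t x`, where `t` is a reflection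
and the length goes up. -/
def BruhatLE : G → G → Prop :=
  Relation.ReflTransGen fun x y => ∃ t, IsReflection s t ∧ y = t * x ∧ length s x < length s y

/-- The set `{w | ℓ(w s_i) > ℓ(w) for all i ∈ P}` of minimal length representatives. -/
def minReps (P : Set B) : Set G := {w | ∀ i ∈ P, length s w < length s (w * s i)}

end Words

/-! ### Combinatorial Schubert classes -/

section Schubert

variable {R V B : Type*} [CommRing R] [AddCommMonoid V] [Module R V]
  {N : Submodule R V} {G : Subgroup (V ≃ₗ[R] V)} (hN : ∀ g ∈ G, ∀ v ∈ N, g v ∈ N)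
  (s : B → G) (a : B → N)

/-- For an expression `x = s_1 s_2 ⋯ s_r`, with simple roots `α_1, …, α_r`, this is the sum of the
products `∏_p s_1 s_2 ⋯ s_{i_p - 1} (α_{i_p})` over all `i_1 < ⋯ < i_ℓ` with
`s_{i_1} ⋯ s_{i_ℓ} = w` and `ℓ = ℓ(w)`. It lies in the symmetric algebra of `N`. -/
def schubertSum (w : G) (x : List B) : SymmetricAlgebra R N := by
  classical
  exact
    ∑ I : Finset (Fin x.length) with
        I.card = length s w ∧ wordProd s ((I.sort (· ≤ ·)).map x.get) = w,
      ∏ p ∈ I, SymmetricAlgebra.ι R N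
        ⟨(wordProd s (x.take p)).1 (a (x.get p)), hN _ (SetLike.coe_mem _) _ (a (x.get p)).2⟩

/-- The combinatorial Schubert class of `w`, as a function on the group. Its value at `g` is
computed from some expression of `g`. -/
def schubert (w g : G) : SymmetricAlgebra R N := by
  classical
  exact if BruhatLE s w g then
    schubertSum hN s a w (Classical.epsilon fun x : List B => wordProd s x = g) else 0

end Schubert

/-! ### Extension of scalars and restriction to an eigenspace -/

section Eigenspace

variable {k L U : Type*} [CommRing k] [CommRing L] [Algebra k L] [AddCommGroup U] [Module k U]
  (T : Module.End k U) (τ σ : L)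

/-- The `τ`-eigenspace of the extension of `T` to `L ⊗ U`. -/
def eigen : Submodule L (L ⊗[k] U) := Module.End.eigenspace (T.baseChange L) τ

variable {c₁ c₂ : k}

theorem one_tmul_sub_mem (hT : ∀ u, T (T u) = c₁ • T u - c₂ • u)
    (hσ : σ = c₁ • 1 - τ) (hτσ : τ * σ = c₂ • 1) (u : U) :
    (1 : L) ⊗ₜ[k] T u - σ ⊗ₜ[k] u ∈ eigen T τ := by
  rw [eigen, Module.End.mem_eigenspace_iff]
  simp only [map_sub, LinearMap.baseChange_tmul, hT, smul_sub, TensorProduct.smul_tmul',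
    smul_eq_mul, mul_one, TensorProduct.tmul_sub, TensorProduct.tmul_smul]
  rw [hτσ, hσ, TensorProduct.sub_tmul, ← TensorProduct.smul_tmul', ← TensorProduct.smul_tmul']
  abel

/-- The map `u ↦ (τ - σ)⁻¹ (T - σ) u` from `U` to the `τ`-eigenspace of the extension of `T`,
where `σ` is the other root of the characteristic equation. -/
def eigenProj (hT : ∀ u, T (T u) = c₁ • T u - c₂ • u)
    (hσ : σ = c₁ • 1 - τ) (hτσ : τ * σ = c₂ • 1) :
    U →ₗ[k] eigen T τ where
  toFun u := Ring.inverse (τ - σ) •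
    ⟨(1 : L) ⊗ₜ[k] T u - σ ⊗ₜ[k] u, one_tmul_sub_mem T τ σ hT hσ hτσ u⟩
  map_add' u v := by
    rw [← smul_add]
    congr 1
    ext1
    simp only [map_add, TensorProduct.tmul_add, Submodule.coe_add]
    abel
  map_smul' r u := by
    rw [RingHom.id_apply, smul_comm]
    congr 1
    ext1
    rw [Submodule.coe_smul_of_tower]
    simp only [map_smul, TensorProduct.tmul_smul, smul_sub]

/-- The group of automorphisms of `U` that commute with `T`. -/
def commuting : Subgroup (U ≃ₗ[k] U) where
  carrier := {g | ∀ u, g (T u) = T (g u)}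
  mul_mem' {g h} hg hh u := by
    rw [LinearEquiv.mul_apply, LinearEquiv.mul_apply, hh, hg]
  one_mem' _ := rfl
  inv_mem' {g} hg u := by
    apply g.injective
    rw [hg]
    change g (g.symm _) = T (g (g.symm u))
    simp

theorem baseChange_mem (g : U →ₗ[k] U) (hg : ∀ u, g (T u) = T (g u)) (x : L ⊗[k] U)
    (hx : x ∈ eigen T τ) : g.baseChange L x ∈ eigen T τ := by
  rw [eigen, Module.End.mem_eigenspace_iff] at hx ⊢
  rw [← map_smul, ← hx]
  simp only [← LinearMap.comp_apply, ← LinearMap.baseChange_comp]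
  congr 2
  exact LinearMap.ext fun u => (hg u).symm

/-- An automorphism of `U` commuting with `T`, extended to `L ⊗ U` and then restricted to
the `τ`-eigenspace. -/
def restrict : commuting T →* (eigen T τ ≃ₗ[L] eigen T τ) where
  toFun g := LinearEquiv.ofLinearMap
    ((LinearMap.baseChange L (g.1 : U ≃ₗ[k] U).toLinearMap).restrict
      (baseChange_mem T τ g.1.toLinearMap g.2))
    ((LinearMap.baseChange L ((g⁻¹).1 : U ≃ₗ[k] U).toLinearMap).restrict
      (baseChange_mem T τ (g⁻¹).1.toLinearMap (g⁻¹).2))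
    (by
      ext1 x
      ext1
      simp only [LinearMap.comp_apply, LinearMap.coe_restrict_apply, LinearMap.id_apply]
      rw [← LinearMap.comp_apply, ← LinearMap.baseChange_comp]
      have : g.1.toLinearMap ∘ₗ (g⁻¹).1.toLinearMap = LinearMap.id :=
        LinearMap.ext fun u => g.1.apply_symm_apply u
      rw [this, LinearMap.baseChange_id, LinearMap.id_apply])
    (by
      ext1 x
      ext1
      simp only [LinearMap.comp_apply, LinearMap.coe_restrict_apply, LinearMap.id_apply]
      rw [← LinearMap.comp_apply, ← LinearMap.baseChange_comp]
      have : (g⁻¹).1.toLinearMap ∘ₗ g.1.toLinearMap = LinearMap.id :=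
        LinearMap.ext fun u => g.1.symm_apply_apply u
      rw [this, LinearMap.baseChange_id, LinearMap.id_apply])
  map_one' := by
    ext1 x
    ext1
    change LinearMap.baseChange L LinearMap.id _ = _
    rw [LinearMap.baseChange_id]
    rfl
  map_mul' g h := by
    ext1 x
    ext1
    change LinearMap.baseChange L (g.1.toLinearMap ∘ₗ h.1.toLinearMap) x.1 = _
    rw [LinearMap.baseChange_comp]
    rfl

theorem restrict_eigenProj (hT : ∀ u, T (T u) = c₁ • T u - c₂ • u)
    (hσ : σ = c₁ • 1 - τ) (hτσ : τ * σ = c₂ • 1)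
    (g : commuting T) (u : U) :
    restrict T τ g (eigenProj T τ σ hT hσ hτσ u) = eigenProj T τ σ hT hσ hτσ (g.1 u) := by
  simp only [eigenProj, LinearMap.coe_mk, AddHom.coe_mk, map_smul]
  congr 1
  ext1
  change LinearMap.baseChange L g.1.toLinearMap ((1 : L) ⊗ₜ[k] T u - σ ⊗ₜ[k] u) = _
  simp only [map_sub, LinearMap.baseChange_tmul, LinearEquiv.coe_coe, g.2 u]

theorem eigenProj_injective (hT : ∀ u, T (T u) = c₁ • T u - c₂ • u)
    (hσ : σ = c₁ • 1 - τ) (hτσ : τ * σ = c₂ • 1)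
    (im : L →ₗ[k] k) (him : im 1 = 0) (himσ : im σ = -1) (hu : IsUnit (τ - σ)) :
    Function.Injective (eigenProj T τ σ hT hσ hτσ) := by
  rw [injective_iff_map_eq_zero]
  intro u h
  obtain ⟨e, he⟩ := hu
  have h1 : (1 : L) ⊗ₜ[k] T u - σ ⊗ₜ[k] u = 0 := by
    have h2 := congrArg (fun z : eigen T τ => (τ - σ) • (z : L ⊗[k] U)) h
    simp only [eigenProj, LinearMap.coe_mk, AddHom.coe_mk, Submodule.coe_smul, smul_smul] at h2
    rw [← he, Ring.mul_inverse_cancel _ e.isUnit] at h2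
    simpa using h2
  have h3 := congrArg (TensorProduct.lift (LinearMap.lsmul k U ∘ₗ im)) h1
  simpa [him, himσ] using h3

theorem restrict_injective (hT : ∀ u, T (T u) = c₁ • T u - c₂ • u)
    (hσ : σ = c₁ • 1 - τ) (hτσ : τ * σ = c₂ • 1)
    (im : L →ₗ[k] k) (him : im 1 = 0) (himσ : im σ = -1) (hu : IsUnit (τ - σ)) :
    Function.Injective (restrict T τ) := by
  rw [injective_iff_map_eq_one]
  intro g hg
  ext1
  ext1 u
  apply eigenProj_injective T τ σ hT hσ hτσ im him himσ hu
  rw [← restrict_eigenProj, hg]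
  rfl

theorem mem_span_of_mapsTo {E : Type*} [AddCommGroup E] [Module L E] (g : E ≃ₗ[L] E)
    {S : Set E} (h : ∀ v ∈ S, g v ∈ S) : ∀ v ∈ Submodule.span L S, g v ∈ Submodule.span L S := by
  intro v hv
  have h2 : Submodule.span L S ≤ (Submodule.span L S).comap g.toLinearMap :=
    Submodule.span_le.mpr fun w hw => Submodule.subset_span (h w hw)
  exact h2 hv

/-- The `L`-submodule of the eigenspace spanned by the image of a submodule `N` of `U`. -/
def eigenSpan (hT : ∀ u, T (T u) = c₁ • T u - c₂ • u)
    (hσ : σ = c₁ • 1 - τ) (hτσ : τ * σ = c₂ • 1)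
    (N : Submodule k U) : Submodule L (eigen T τ) :=
  Submodule.span L (eigenProj T τ σ hT hσ hτσ '' (N : Set U))

theorem eigenProj_mem (hT : ∀ u, T (T u) = c₁ • T u - c₂ • u)
    (hσ : σ = c₁ • 1 - τ) (hτσ : τ * σ = c₂ • 1)
    {N : Submodule k U} {u : U} (hu : u ∈ N) :
    eigenProj T τ σ hT hσ hτσ u ∈ eigenSpan T τ σ hT hσ hτσ N :=
  Submodule.subset_span ⟨u, hu, rfl⟩

/-- `eigenProj`, as a map from `N` to the submodule spanned by its image. -/
def eigenProjSpan (hT : ∀ u, T (T u) = c₁ • T u - c₂ • u)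
    (hσ : σ = c₁ • 1 - τ) (hτσ : τ * σ = c₂ • 1)
    (N : Submodule k U) : N →ₗ[k] eigenSpan T τ σ hT hσ hτσ N where
  toFun u := ⟨eigenProj T τ σ hT hσ hτσ u, Submodule.subset_span ⟨u.1, u.2, rfl⟩⟩
  map_add' u v := Subtype.ext (map_add (eigenProj T τ σ hT hσ hτσ) u.1 v.1)
  map_smul' r u := Subtype.ext (map_smul (eigenProj T τ σ hT hσ hτσ) r u.1)

/-- The ring homomorphism `Sym_k(M) → Sym_L(N)` that extends a `k`-linear map `M → N`. -/
def symMap {M N : Type*} [AddCommMonoid M] [Module k M] [AddCommMonoid N] [Module L N] [Module k N]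
    [IsScalarTower k L N] (f : M →ₗ[k] N) : SymmetricAlgebra k M →+* SymmetricAlgebra L N :=
  (SymmetricAlgebra.lift ((SymmetricAlgebra.ι L N).restrictScalars k ∘ₗ f)).toRingHom

/-- The ring homomorphism `Sym_k(N) → Sym_L(eigenSpan N)` that extends `eigenProj`. -/
def eigenSym (hT : ∀ u, T (T u) = c₁ • T u - c₂ • u)
    (hσ : σ = c₁ • 1 - τ) (hτσ : τ * σ = c₂ • 1) (N : Submodule k U) :
    SymmetricAlgebra k N →+* SymmetricAlgebra L (eigenSpan T τ σ hT hσ hτσ N) :=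
  symMap (eigenProjSpan T τ σ hT hσ hτσ N)

end Eigenspace

/-! ### The free quadratic algebra, the `τ`-form and the `τ`-operator -/

section Quadratic

variable {k : Subring ℝ} (c₁ c₂ : k) (n : ℕ)

/-- `L = k[x] / (x² - c₁ x + c₂)`; the element `⟨r, t⟩` stands for `r + t τ`. -/
def QuadAlg : Type := QuadraticAlgebra k (-c₂) c₁

instance : CommRing (QuadAlg c₁ c₂) := inferInstanceAs (CommRing (QuadraticAlgebra k (-c₂) c₁))

instance : Algebra k (QuadAlg c₁ c₂) := inferInstanceAs (Algebra k (QuadraticAlgebra k (-c₂) c₁))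

/-- The class `τ` of `x`. -/
def tau : QuadAlg c₁ c₂ := QuadraticAlgebra.mk 0 1

/-- The other root `σ = c₁ - τ`. -/
def sigma : QuadAlg c₁ c₂ := QuadraticAlgebra.mk c₁ (-1)

variable {c₁ c₂} in
/-- The coefficient of `1` of an element of `L`. -/
def QuadAlg.re : QuadAlg c₁ c₂ →ₗ[k] k where
  toFun := QuadraticAlgebra.re
  map_add' _ _ := rfl
  map_smul' _ _ := rfl

variable {c₁ c₂} in
/-- The coefficient of `τ` of an element of `L`. -/
def QuadAlg.im : QuadAlg c₁ c₂ →ₗ[k] k where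
  toFun := QuadraticAlgebra.im
  map_add' _ _ := rfl
  map_smul' _ _ := rfl

/-- The free `L`-module of rank `n` with its standard basis, which is also regarded as
a free `k`-module of rank `2 n`. -/
def UMod : Type := Fin n → QuadAlg c₁ c₂

instance : AddCommGroup (UMod c₁ c₂ n) := inferInstanceAs (AddCommGroup (Fin n → QuadAlg c₁ c₂))

instance : Module (QuadAlg c₁ c₂) (UMod c₁ c₂ n) :=
  inferInstanceAs (Module (QuadAlg c₁ c₂) (Fin n → QuadAlg c₁ c₂))

instance : Module k (UMod c₁ c₂ n) := inferInstanceAs (Module k (Fin n → QuadAlg c₁ c₂))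

instance : IsScalarTower k (QuadAlg c₁ c₂) (UMod c₁ c₂ n) :=
  inferInstanceAs (IsScalarTower k (QuadAlg c₁ c₂) (Fin n → QuadAlg c₁ c₂))

variable {c₁ c₂ n}

/-- The dot product on the `k`-module `U` with respect to the `{1, τ}`-basis. -/
def dot (u v : UMod c₁ c₂ n) : k :=
  ∑ i, (QuadAlg.re (u i) * QuadAlg.re (v i) + QuadAlg.im (u i) * QuadAlg.im (v i))

/-- The `L`-valued dot product. -/
def lDot (u v : UMod c₁ c₂ n) : QuadAlg c₁ c₂ := ∑ i, u i * v i

/-- The `τ`-form: the coefficient of `1` in the `L`-valued dot product. -/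
def tauForm (u v : UMod c₁ c₂ n) : k := QuadAlg.re (lDot u v)

/-- A nonzero vector is `τ`-rational if its `L`-valued square lies in `k`. -/
def IsTauRational (u : UMod c₁ c₂ n) : Prop :=
  u ≠ 0 ∧ ∃ q : k, lDot u u = algebraMap k (QuadAlg c₁ c₂) q

variable (c₁ c₂ n)

/-- The `τ`-operator: multiplication by `τ`. -/
def tauOp : Module.End k (UMod c₁ c₂ n) := Algebra.lsmul k k (UMod c₁ c₂ n) (tau c₁ c₂)

/-- The `τ`-eigenspace `U_τ` of the extended `τ`-operator on `L ⊗ U`. -/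
abbrev UTau : Submodule (QuadAlg c₁ c₂) (QuadAlg c₁ c₂ ⊗[k] UMod c₁ c₂ n) :=
  eigen (tauOp c₁ c₂ n) (tau c₁ c₂)

theorem tau_mul_tau : tau c₁ c₂ * tau c₁ c₂ = c₁ • tau c₁ c₂ - c₂ • 1 := by
  apply QuadraticAlgebra.ext
  · change 0 * 0 + -c₂ * 1 * 1 = c₁ * 0 - c₂ * 1
    ring
  · change 0 * 1 + 1 * 0 + c₁ * 1 * 1 = c₁ * 1 - c₂ * 0
    ring

theorem sigma_eq : sigma c₁ c₂ = c₁ • 1 - tau c₁ c₂ := by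
  apply QuadraticAlgebra.ext
  · change c₁ = c₁ * 1 - 0
    ring
  · change -1 = c₁ * 0 - 1
    ring

theorem tau_mul_sigma : tau c₁ c₂ * sigma c₁ c₂ = c₂ • 1 := by
  rw [sigma_eq, mul_sub, tau_mul_tau, mul_smul_comm, mul_one]
  abel

theorem tauOp_apply (u : UMod c₁ c₂ n) : tauOp c₁ c₂ n u = tau c₁ c₂ • u := rfl

theorem tauOp_tauOp (u : UMod c₁ c₂ n) :
    tauOp c₁ c₂ n (tauOp c₁ c₂ n u) = c₁ • tauOp c₁ c₂ n u - c₂ • u := by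
  simp only [tauOp_apply, smul_smul, tau_mul_tau, sub_smul, smul_assoc, one_smul]

/-- The projection `π_τ(u) = (τ - σ)⁻¹ (T - σ) u` from `U` to `U_τ`. -/
def proj : UMod c₁ c₂ n →ₗ[k] UTau c₁ c₂ n :=
  eigenProj _ _ (sigma c₁ c₂) (tauOp_tauOp c₁ c₂ n) (sigma_eq c₁ c₂) (tau_mul_sigma c₁ c₂)

theorem isUnit_tau_sub_sigma (h : IsUnit (c₁ ^ 2 - 4 * c₂)) :
    IsUnit (tau c₁ c₂ - sigma c₁ c₂) := by
  have h2 : (tau c₁ c₂ - sigma c₁ c₂) * (tau c₁ c₂ - sigma c₁ c₂) =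
      (c₁ ^ 2 - 4 * c₂) • 1 := by
    have h := tau_mul_tau c₁ c₂
    rw [sigma_eq]
    simp only [Algebra.smul_def, mul_one, map_sub, map_mul, map_pow, map_ofNat] at h ⊢
    linear_combination 4 * h
  have h3 : IsUnit ((c₁ ^ 2 - 4 * c₂) • (1 : QuadAlg c₁ c₂)) := by
    rw [← Algebra.algebraMap_eq_smul_one]
    exact h.map _
  exact isUnit_of_mul_isUnit_left (h2 ▸ h3)

/-- The group of `k`-linear automorphisms of `U` that commute with the `τ`-operator. -/
abbrev tauCommuting : Subgroup (UMod c₁ c₂ n ≃ₗ[k] UMod c₁ c₂ n) := commuting (tauOp c₁ c₂ n)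

/-- An automorphism of `U` commuting with the `τ`-operator, extended to `L ⊗ U` and then
restricted to `U_τ`. -/
abbrev restrictTau : tauCommuting c₁ c₂ n →* (UTau c₁ c₂ n ≃ₗ[QuadAlg c₁ c₂] UTau c₁ c₂ n) :=
  restrict (tauOp c₁ c₂ n) (tau c₁ c₂)

theorem restrictTau_proj (g : tauCommuting c₁ c₂ n) (u : UMod c₁ c₂ n) :
    restrictTau c₁ c₂ n g (proj c₁ c₂ n u) = proj c₁ c₂ n (g.1 u) :=
  restrict_eigenProj _ _ _ _ _ _ _ _

theorem restrictTau_injective (h : IsUnit (c₁ ^ 2 - 4 * c₂)) :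
    Function.Injective (restrictTau c₁ c₂ n) :=
  restrict_injective _ _ (sigma c₁ c₂) (tauOp_tauOp c₁ c₂ n) (sigma_eq c₁ c₂)
    (tau_mul_sigma c₁ c₂)
    QuadAlg.im rfl rfl (isUnit_tau_sub_sigma c₁ c₂ h)

theorem lDot_tauOp_left (u v : UMod c₁ c₂ n) :
    lDot (tauOp c₁ c₂ n u) v = tau c₁ c₂ * lDot u v := by
  rw [lDot, lDot, Finset.mul_sum]
  exact Finset.sum_congr rfl fun _ _ => mul_assoc _ _ _

theorem lDot_comm (u v : UMod c₁ c₂ n) : lDot u v = lDot v u :=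
  Finset.sum_congr rfl fun _ _ => mul_comm _ _

theorem tauForm_comm (u v : UMod c₁ c₂ n) : tauForm u v = tauForm v u := by
  rw [tauForm, tauForm, lDot_comm]

theorem tauForm_add_left (u v w : UMod c₁ c₂ n) :
    tauForm (u + v) w = tauForm u w + tauForm v w := by
  rw [tauForm, tauForm, tauForm, ← map_add, lDot, lDot, lDot, ← Finset.sum_add_distrib]
  exact congrArg _ (Finset.sum_congr rfl fun i _ => add_mul _ _ _)

theorem tauForm_smul_left (r : k) (u w : UMod c₁ c₂ n) :
    tauForm (r • u) w = r * tauForm u w := by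
  rw [tauForm, tauForm, ← smul_eq_mul, ← map_smul, lDot, lDot, Finset.smul_sum]
  exact congrArg _ (Finset.sum_congr rfl fun i _ => smul_mul_assoc r (u i) (w i))

theorem tauForm_tauOp (u v : UMod c₁ c₂ n) :
    tauForm u (tauOp c₁ c₂ n v) = tauForm (tauOp c₁ c₂ n u) v := by
  rw [tauForm, tauForm, lDot_comm, lDot_tauOp_left, lDot_tauOp_left, lDot_comm]

theorem dot_self_eq_zero {u : UMod c₁ c₂ n} (h : dot u u = 0) : u = 0 := by
  unfold dot at h
  rw [Finset.sum_eq_zero_iff_of_nonneg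
    (fun i _ => add_nonneg (mul_self_nonneg _) (mul_self_nonneg _))] at h
  funext i
  have h2 := h i (Finset.mem_univ i)
  rw [mul_self_add_mul_self_eq_zero] at h2
  exact QuadraticAlgebra.ext h2.1 h2.2

end Quadratic

/-! ### Folded representations -/

/-- A folded `k`-representation of a root datum `D` with simple system `b` on the `k`-module `U`
underlying `L^n`, where `L = k[x] / (x² - c₁ x + c₂)`. -/
structure FoldedRep {k : Subring ℝ} (c₁ c₂ : k) (n : ℕ) {ι X Y : Type*}
    [AddCommGroup X] [AddCommGroup Y] (D : RootDatum ι X Y) (b : D.Base) where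
  /-- `L` is separable over `k`. -/
  disc_isUnit : IsUnit (c₁ ^ 2 - 4 * c₂)
  /-- The inclusion of `Λ ⊗ k` in `U`. -/
  emb : k ⊗[ℤ] X →ₗ[k] UMod c₁ c₂ n
  emb_injective : Function.Injective emb
  /-- The functional `u ↦ 2 (α, u) / (α, α)` on `U`, which extends the coroot of `α`. -/
  coroot : ι → UMod c₁ c₂ n →ₗ[k] k
  coroot_mul_dot : ∀ i u, coroot i u * dot (emb (1 ⊗ₜ D.root i)) (emb (1 ⊗ₜ D.root i)) =
    2 * dot (emb (1 ⊗ₜ D.root i)) u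
  coroot_emb : ∀ i x, coroot i (emb (1 ⊗ₜ x)) = ((D.toLinearMap x (D.coroot i) : ℤ) : k)
  /-- The `τ`-form is the dot product of `U`. -/
  tauForm_eq_dot : ∀ u v : UMod c₁ c₂ n, tauForm u v = dot u v
  /-- `T Λ = Λ`. -/
  tauOp_lattice : tauOp c₁ c₂ n '' Set.range (fun x : X => emb (1 ⊗ₜ x)) =
    Set.range (fun x : X => emb (1 ⊗ₜ x))
  /-- `T` maps the root lattice onto itself. -/
  tauOp_rootLattice :
    tauOp c₁ c₂ n '' (AddSubgroup.closure (Set.range fun i => emb (1 ⊗ₜ D.root i)) : Set _) =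
      (AddSubgroup.closure (Set.range fun i => emb (1 ⊗ₜ D.root i)) : Set _)
  /-- (Indices of) the simple roots in `Δ_rat`. -/
  rat : Set ι
  isTauRational : ∀ i ∈ rat, IsTauRational (emb (1 ⊗ₜ D.root i))
  /-- `Δ = Δ^T ∪ Δ_rat ∪ T(Δ_rat)`. -/
  partition :
    (fun i => emb (1 ⊗ₜ D.root i)) '' (b.support : Set ι) =
      {α ∈ (fun i => emb (1 ⊗ₜ D.root i)) '' (b.support : Set ι) | tauOp c₁ c₂ n α = α} ∪
      (fun i => emb (1 ⊗ₜ D.root i)) '' rat ∪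
      tauOp c₁ c₂ n '' ((fun i => emb (1 ⊗ₜ D.root i)) '' rat)
  /-- The union is disjoint. -/
  disjoint_fixed_rat : ∀ i ∈ rat, tauOp c₁ c₂ n (emb (1 ⊗ₜ D.root i)) ≠ emb (1 ⊗ₜ D.root i)
  disjoint_fixed_image : ∀ i ∈ rat,
    tauOp c₁ c₂ n (tauOp c₁ c₂ n (emb (1 ⊗ₜ D.root i))) ≠ tauOp c₁ c₂ n (emb (1 ⊗ₜ D.root i))
  disjoint_rat_image : ∀ i ∈ rat, ∀ j ∈ rat,
    tauOp c₁ c₂ n (emb (1 ⊗ₜ D.root i)) ≠ emb (1 ⊗ₜ D.root j)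

namespace FoldedRep

variable {k : Subring ℝ} {c₁ c₂ : k} {n : ℕ} {ι X Y : Type*}
  [AddCommGroup X] [AddCommGroup Y] {D : RootDatum ι X Y} {b : D.Base}
  (F : FoldedRep c₁ c₂ n D b)

/-- The root with index `i`, as a vector of `U`. -/
def root (i : ι) : UMod c₁ c₂ n := F.emb (1 ⊗ₜ D.root i)

theorem coroot_root (i : ι) : F.coroot i (F.root i) = 2 := by
  rw [root, F.coroot_emb, D.root_coroot_two]
  norm_num

/-- The reflection `s_α` of `U`. -/
def refl (i : ι) : UMod c₁ c₂ n ≃ₗ[k] UMod c₁ c₂ n := Module.reflection (F.coroot_root i)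

theorem refl_apply (i : ι) (u : UMod c₁ c₂ n) :
    F.refl i u = u - F.coroot i u • F.root i := rfl

/-- The Weyl group `W` of the representation. -/
def W : Subgroup (UMod c₁ c₂ n ≃ₗ[k] UMod c₁ c₂ n) := Subgroup.closure (Set.range F.refl)

/-- The simple reflections of `W`. -/
def s (i : b.support) : F.W := ⟨F.refl i, Subgroup.subset_closure ⟨i, rfl⟩⟩

/-- The submodule `U_Λ = Λ ⊗ k` of `U`. -/
def ULat : Submodule k (UMod c₁ c₂ n) := LinearMap.range F.emb

theorem W_ULat : ∀ g ∈ F.W, ∀ v ∈ F.ULat, g v ∈ F.ULat := by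
  have h : F.W ≤
      { carrier := {g | (∀ v ∈ F.ULat, g v ∈ F.ULat) ∧ ∀ v ∈ F.ULat, g.symm v ∈ F.ULat}
        mul_mem' := fun {a b} ha hb =>
          ⟨fun v hv => ha.1 _ (hb.1 _ hv), fun v hv => hb.2 _ (ha.2 _ hv)⟩
        one_mem' := ⟨fun _ hv => hv, fun _ hv => hv⟩
        inv_mem' := fun {a} ha => ⟨ha.2, ha.1⟩ } := by
    rw [W, Subgroup.closure_le]
    rintro _ ⟨i, rfl⟩
    have h1 : ∀ v ∈ F.ULat, F.refl i v ∈ F.ULat := fun v hv =>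
      F.ULat.sub_mem hv (F.ULat.smul_mem _ ⟨_, rfl⟩)
    exact ⟨h1, h1⟩
  exact fun g hg => (h hg).1

/-- The simple roots, as elements of `U_Λ`. -/
def simpleRoot (i : b.support) : F.ULat := ⟨F.root i, ⟨_, rfl⟩⟩

/-- The Schubert class of `w ∈ W`, with values in `Sym_k(U_Λ)`. -/
def schubert (w g : F.W) : SymmetricAlgebra k F.ULat :=
  Folding.schubert F.W_ULat F.s F.simpleRoot w g

/-- (Indices of) the simple roots in `Δ^T`. -/
def fixed : Set ι := {i | i ∈ b.support ∧ tauOp c₁ c₂ n (F.root i) = F.root i}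

theorem exists_opp (i : ι) (hi : i ∈ F.rat) :
    ∃ j ∈ b.support, F.root j = tauOp c₁ c₂ n (F.root i) := by
  have h : tauOp c₁ c₂ n (F.root i) ∈
      (fun i => F.emb (1 ⊗ₜ D.root i)) '' (b.support : Set ι) := by
    rw [F.partition]
    exact Or.inr ⟨_, ⟨i, hi, rfl⟩, rfl⟩
  exact h

/-- For `α ∈ Δ_rat` with index `i`, the index of the simple root `T α`. -/
def opp (i : ι) (hi : i ∈ F.rat) : ι := (F.exists_opp i hi).choose

theorem root_opp (i : ι) (hi : i ∈ F.rat) :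
    F.root (F.opp i hi) = tauOp c₁ c₂ n (F.root i) := (F.exists_opp i hi).choose_spec.2

open Classical in
/-- The automorphism `s_α` of `U` if `α ∈ Δ^T`, and `s_α s_{Tα}` if `α ∈ Δ_rat`. -/
def orbitRefl (i : ι) : UMod c₁ c₂ n ≃ₗ[k] UMod c₁ c₂ n :=
  if hi : i ∈ F.rat then F.refl i * F.refl (F.opp i hi) else F.refl i

theorem coroot_mul (i : ι) (u : UMod c₁ c₂ n) :
    F.coroot i u * tauForm (F.root i) (F.root i) = 2 * tauForm (F.root i) u := by
  rw [F.tauForm_eq_dot, F.tauForm_eq_dot]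
  exact F.coroot_mul_dot i u

theorem tauForm_root_ne_zero (i : ι) : tauForm (F.root i) (F.root i) ≠ 0 := by
  intro h
  have h1 := F.coroot_root i
  rw [F.tauForm_eq_dot] at h
  rw [dot_self_eq_zero c₁ c₂ n h, map_zero] at h1
  exact two_ne_zero h1.symm

theorem c₂_eq_neg_one (F : FoldedRep c₁ c₂ n D b) (i : ι) : c₂ = -1 := by
  have hn : Nonempty (Fin n) := by
    by_contra h
    rw [not_nonempty_iff] at h
    exact F.tauForm_root_ne_zero i (by simp [tauForm, lDot])
  obtain ⟨j⟩ := hn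
  have h := F.tauForm_eq_dot (Pi.single j (tau c₁ c₂) : Fin n → QuadAlg c₁ c₂)
    (Pi.single j (tau c₁ c₂) : Fin n → QuadAlg c₁ c₂)
  unfold tauForm lDot dot at h
  rw [Finset.sum_eq_single j, Finset.sum_eq_single j, Pi.single_eq_same,
    tau_mul_tau] at h
  · change c₁ * 0 - c₂ * 1 = 0 * 0 + 1 * 1 at h
    linear_combination -h
  · intro l _ hl
    rw [Pi.single_eq_of_ne hl]
    change (0 : k) * 0 + 0 * 0 = 0
    ring
  · simp
  · intro l _ hl
    rw [Pi.single_eq_of_ne hl, mul_zero]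
  · simp

theorem tauOp_tauOp_root (i : ι) : tauOp c₁ c₂ n (tauOp c₁ c₂ n (F.root i)) =
    c₁ • tauOp c₁ c₂ n (F.root i) + F.root i := by
  have h : c₂ • F.root i = -F.root i := by
    rw [show c₂ • F.root i = (-1 : k) • F.root i from congrArg (· • _) (F.c₂_eq_neg_one i),
      neg_smul, one_smul]
  rw [tauOp_tauOp, h, sub_neg_eq_add]

theorem orbitRefl_commutes (i : ι) (hi : i ∈ F.fixed ∪ F.rat) :
    F.orbitRefl i ∈ tauCommuting c₁ c₂ n := by
  intro u
  have hN := F.tauForm_root_ne_zero i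
  by_cases hr : i ∈ F.rat
  · set j := F.opp i hr with hj
    have hrj : F.root j = tauOp c₁ c₂ n (F.root i) := F.root_opp i hr
    obtain ⟨-, q, hq⟩ := F.isTauRational i hr
    change lDot (F.root i) (F.root i) = _ at hq
    have h0 : tauForm (F.root i) (F.root j) = 0 := by
      rw [hrj, tauForm_tauOp, tauForm, lDot_tauOp_left, hq, Algebra.algebraMap_eq_smul_one,
        mul_smul_comm, mul_one, map_smul]
      exact mul_zero q
    have hNj : tauForm (F.root j) (F.root j) = tauForm (F.root i) (F.root i) := by
      rw [hrj, tauForm_tauOp, tauOp_tauOp_root, tauForm_add_left, tauForm_smul_left, ← hrj]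
      rw [tauForm_comm c₁ c₂ n (F.root j), h0]
      ring
    have hij : F.coroot i (F.root j) = 0 := by
      have := F.coroot_mul i (F.root j)
      rw [h0, mul_zero] at this
      exact (mul_eq_zero.mp this).resolve_right hN
    have e1 : ∀ v, F.coroot i (tauOp c₁ c₂ n v) = F.coroot j v := by
      intro v
      apply mul_right_cancel₀ hN
      rw [F.coroot_mul, tauForm_tauOp, ← hrj, ← hNj, F.coroot_mul]
    have e2 : ∀ v, F.coroot j (tauOp c₁ c₂ n v) = c₁ * F.coroot j v + F.coroot i v := by
      intro v
      apply mul_right_cancel₀ hN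
      have h1 := F.coroot_mul j v
      have h2 := F.coroot_mul i v
      have h3 := F.coroot_mul j (tauOp c₁ c₂ n v)
      rw [hNj] at h1 h3
      rw [h3, tauForm_tauOp, hrj, tauOp_tauOp_root, tauForm_add_left, tauForm_smul_left, ← hrj]
      linear_combination -c₁ * h1 - h2
    have hg : ∀ v, F.orbitRefl i v = v - F.coroot j v • F.root j - F.coroot i v • F.root i := by
      intro v
      rw [orbitRefl, dif_pos hr, LinearEquiv.mul_apply, refl_apply, refl_apply, ← hj, map_sub,
        map_smul, hij, smul_zero, sub_zero]
    rw [hg, hg, e1, e2]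
    simp only [map_sub, map_smul, ← hrj]
    have e3 : tauOp c₁ c₂ n (F.root j) = c₁ • F.root j + F.root i := by
      rw [hrj, tauOp_tauOp_root]
    rw [e3]
    module
  · have hf : tauOp c₁ c₂ n (F.root i) = F.root i := (hi.resolve_right hr).2
    have e1 : ∀ v, F.coroot i (tauOp c₁ c₂ n v) = F.coroot i v := by
      intro v
      apply mul_right_cancel₀ hN
      rw [F.coroot_mul, tauForm_tauOp, hf, F.coroot_mul]
    rw [orbitRefl, dif_neg hr, refl_apply, refl_apply, e1, map_sub, map_smul, hf]

/-- The index set of `Δ_τ`: the simple roots in `Δ^T ⊔ Δ_rat`. -/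
abbrev FoldedIndex : Type _ := {i : ι // i ∈ F.fixed ∪ F.rat}

/-- `orbitRefl`, as an element of the group of automorphisms commuting with `T`. -/
def gen (i : F.FoldedIndex) : tauCommuting c₁ c₂ n :=
  ⟨F.orbitRefl i.1, F.orbitRefl_commutes i.1 i.2⟩

/-- The folded reflection group `W_τ`, generated by the restrictions of the extensions of
`s_α` (for `α ∈ Δ^T`) and `s_α s_{Tα}` (for `α ∈ Δ_rat`) to `U_τ`. -/
def WTau : Subgroup (UTau c₁ c₂ n ≃ₗ[QuadAlg c₁ c₂] UTau c₁ c₂ n) :=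
  Subgroup.closure (Set.range fun i => restrictTau c₁ c₂ n (F.gen i))

/-- The simple reflections of `W_τ`. -/
def sTau (i : F.FoldedIndex) : F.WTau :=
  ⟨restrictTau c₁ c₂ n (F.gen i), Subgroup.subset_closure ⟨i, rfl⟩⟩

theorem map_closure_gen :
    (Subgroup.closure (Set.range F.gen)).map (restrictTau c₁ c₂ n) = F.WTau := by
  rw [MonoidHom.map_closure, WTau]
  congr 1
  rw [← Set.range_comp]
  rfl

theorem closure_gen_le :
    Subgroup.closure (Set.range F.gen) ≤ F.W.comap (tauCommuting c₁ c₂ n).subtype := by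
  rw [Subgroup.closure_le]
  rintro _ ⟨i, rfl⟩
  have h : ∀ j, F.refl j ∈ F.W := fun j => Subgroup.subset_closure ⟨j, rfl⟩
  change F.orbitRefl i.1 ∈ F.W
  rw [orbitRefl]
  split_ifs
  · exact F.W.mul_mem (h _) (h _)
  · exact h _

/-- The embedding of `W_τ` in `W`: it sends an element of `W_τ` to the unique element of the group
generated by the `s_α` (for `α ∈ Δ^T`) and `s_α s_{Tα}` (for `α ∈ Δ_rat`) that restricts to it. -/
def embedding : F.WTau →* F.W :=
  ((((tauCommuting c₁ c₂ n).subtype.comp (Subgroup.closure (Set.range F.gen)).subtype).codRestrict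
    F.W fun x => F.closure_gen_le x.2).comp
    ((Subgroup.closure (Set.range F.gen)).equivMapOfInjective _
      (restrictTau_injective c₁ c₂ n F.disc_isUnit)).symm.toMonoidHom).comp
    (MulEquiv.subgroupCongr F.map_closure_gen.symm).toMonoidHom

/-- The embedding sends each simple reflection of `W_τ` to `s_α`, respectively `s_α s_{Tα}`. -/
theorem embedding_sTau (i : F.FoldedIndex) : (F.embedding (F.sTau i)).1 = F.orbitRefl i.1 := by
  have h : (MulEquiv.subgroupCongr F.map_closure_gen.symm) (F.sTau i) =
      (Subgroup.closure (Set.range F.gen)).equivMapOfInjective _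
        (restrictTau_injective c₁ c₂ n F.disc_isUnit)
        ⟨F.gen i, Subgroup.subset_closure ⟨i, rfl⟩⟩ := Subtype.ext rfl
  change ((((Subgroup.closure (Set.range F.gen)).equivMapOfInjective _
      (restrictTau_injective c₁ c₂ n F.disc_isUnit)).symm
      (MulEquiv.subgroupCongr F.map_closure_gen.symm (F.sTau i))).1).1 = _
  rw [h, MulEquiv.symm_apply_apply]
  rfl

/-- The `L`-submodule of `U_τ` generated by `π_τ(U_Λ)`. Since `T` preserves `U_Λ`, it is
`π_τ(U_Λ)` itself. -/
abbrev ULatTau : Submodule (QuadAlg c₁ c₂) (UTau c₁ c₂ n) :=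
  eigenSpan _ _ _ (tauOp_tauOp c₁ c₂ n) (sigma_eq c₁ c₂) (tau_mul_sigma c₁ c₂) F.ULat

theorem WTau_ULatTau : ∀ g ∈ F.WTau, ∀ v ∈ F.ULatTau, g v ∈ F.ULatTau := by
  intro g hg v hv
  rw [← F.map_closure_gen] at hg
  obtain ⟨h, hh, rfl⟩ := hg
  have hW : h.1 ∈ F.W := F.closure_gen_le hh
  refine mem_span_of_mapsTo (restrictTau c₁ c₂ n h) ?_ v hv
  rintro _ ⟨u, hu, rfl⟩
  exact ⟨h.1 u, F.W_ULat _ hW _ hu, (restrictTau_proj c₁ c₂ n h u).symm⟩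

theorem proj_root_mem (i : ι) : proj c₁ c₂ n (F.root i) ∈ F.ULatTau :=
  eigenProj_mem _ _ _ _ _ _ ⟨1 ⊗ₜ D.root i, rfl⟩

/-- The simple roots `π_τ(α)` of the folded root system, as elements of `π_τ(U_Λ)`. -/
def simpleRootTau (i : F.FoldedIndex) : F.ULatTau :=
  ⟨proj c₁ c₂ n (F.root i.1), F.proj_root_mem i.1⟩

/-- The Schubert class of `u ∈ W_τ`, with values in `Sym_L(π_τ(U_Λ))`. -/
def schubertTau (u g : F.WTau) : SymmetricAlgebra (QuadAlg c₁ c₂) F.ULatTau :=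
  Folding.schubert F.WTau_ULatTau F.sTau F.simpleRootTau u g

/-- The ring homomorphism `Sym_k(U_Λ) → Sym_L(π_τ(U_Λ))` that extends `π_τ`. -/
def projSym : SymmetricAlgebra k F.ULat →+* SymmetricAlgebra (QuadAlg c₁ c₂) F.ULatTau :=
  eigenSym _ _ _ (tauOp_tauOp c₁ c₂ n) (sigma_eq c₁ c₂) (tau_mul_sigma c₁ c₂) F.ULat

/-- `W^P`, for a set `P` of (indices of) simple roots. -/
def WP (P : Set ι) : Set F.W := minReps F.s {i | i.1 ∈ P}

/-- `W_τ^P`, for a set `P` of (indices of) simple roots. -/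
def WTauP (P : Set ι) : Set F.WTau := minReps F.sTau {i | i.1 ∈ P}

/-- The folding map `ξ ↦ (u ↦ π_τ(ξ(embedding(u))))`, for `u ∈ W_τ^P`. -/
def foldingMap (P : Set ι) :
    (F.W → SymmetricAlgebra k F.ULat) →+*
      (F.WTauP P → SymmetricAlgebra (QuadAlg c₁ c₂) F.ULatTau) :=
  RingHom.pi fun u => F.projSym.comp (Pi.evalRingHom _ (F.embedding u.1))

end FoldedRep

end Folding

end

/-! The proof rests on a positive real specialisation. Comparing the two forms at a coordinate
vector `τ e` gives `c₂ = -1`, so `x² - c₁x - 1` has a positive root `λ` and a negative root `μ`. If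
`ρ` is the sum of the positive coroots, the functional `h(u) = ρ(Tu) - μ ρ(u)` (`heightFun`)
satisfies `h ∘ T = λ h` and is positive on all simple roots. Hence its sign detects positive roots,
in `W` and in `W_τ` alike, and both groups satisfy an exchange condition (`exchangeW`,
`exchangeWTau`). Deletion, lifting and the subword property follow from this condition alone
(`ExchangeSystem`). Chevalley's formula shows that the classes of `W` may be computed from any word
(`RootAction.wordSum_congr`).

Sending `τ` to `λ` and `π_τ(u)` to `t h(u)` defines a ring homomorphism to `ℝ` (`evalSym`). At `t =
1` it makes the folded value of `σ_w` at `x` positive when `w ≤ x`, and varying `t` reads off the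
degree `ℓ(w)`.

Necessity: if `φ*(σ_w) = c σ_u`, then positivity gives (C3), homogeneity at a point with `w ≤ ι(v)`
gives (C1), and (C2) follows from these two: a reduced word of `w` is a subword of the folding of a
word of the same length in `W_τ`, and (C3) forces that word to be a reduced word of `u`
(`wordProd_eq_of_sublist_foldWord`).

Sufficiency: the sum for `σ_w` over the folding of a word splits according to the set of blocks from
which letters are taken (`subSum_flatMap_foldPairs`). By (C1) and (C3) only reduced words of `u`
contribute, with exactly one letter from each block, so each contributes an element `foldCoeff` of
`L` times its term in `σ_u`. It remains to see that this coefficient may be taken the same for all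
reduced words of `u` (`foldCoeff_smul_prod_eq`). Its real value is the same, because both
`σ_w(ι(u))` and the product of the heights of the inversions depend only on `u`. To return from `ℝ`
to `L`: if `c₁ ≠ 0`, then `c₁` is an integer, the coefficients are integral, and `m² + 4` is not a
square. If `c₁ = 0` and the word has a `T`-fixed letter, then `τ` acts trivially on the product of
weights. If `c₁ = 0` and all letters are in `Δ_rat`, then the orthogonality assumption rules out odd
braid relations between `Δ_rat` and `T(Δ_rat)`, so all contributions are the same power of `τ` and
only a natural number has to be recovered. -/

namespace Folding

/-! ### Words, length and Bruhat order -/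

section Words

variable {B G : Type*} [Group G] {s : B → G}

@[simp] theorem wordProd_nil : wordProd s [] = 1 := rfl

@[simp] theorem wordProd_cons (i : B) (x : List B) :
    wordProd s (i :: x) = s i * wordProd s x := by
  simp [wordProd]

@[simp] theorem wordProd_append (x y : List B) :
    wordProd s (x ++ y) = wordProd s x * wordProd s y := by
  simp [wordProd]

theorem wordProd_singleton (i : B) : wordProd s [i] = s i := by simp

theorem length_wordProd_le (x : List B) : length s (wordProd s x) ≤ x.length :=
  Nat.sInf_le ⟨x, rfl, rfl⟩

theorem length_one : length s (1 : G) = 0 :=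
  Nat.le_zero.mp (length_wordProd_le (s := s) [])

theorem isReflection_gen (i : B) : IsReflection s (s i) := ⟨1, i, by simp⟩

theorem IsReflection.conj {t : G} (ht : IsReflection s t) (g : G) :
    IsReflection s (g * t * g⁻¹) := by
  obtain ⟨h, i, rfl⟩ := ht
  exact ⟨g * h, i, by group⟩

theorem BruhatLE.refl (x : G) : BruhatLE s x x := Relation.ReflTransGen.refl

theorem BruhatLE.trans {x y z : G} (h : BruhatLE s x y) (h' : BruhatLE s y z) : BruhatLE s x z :=
  Relation.ReflTransGen.trans h h'

theorem BruhatLE.of_mul_reflection {x t : G} (ht : IsReflection s t)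
    (h : length s x < length s (x * t)) : BruhatLE s x (x * t) :=
  .single ⟨x * t * x⁻¹, ht.conj x, by group, h⟩

theorem BruhatLE.eq_or_lt {x y : G} (h : BruhatLE s x y) : x = y ∨ length s x < length s y := by
  induction h with
  | refl => exact .inl rfl
  | tail _ h' ih =>
    obtain ⟨-, -, -, h'⟩ := h'
    rcases ih with rfl | ih
    · exact .inr h'
    · exact .inr (ih.trans h')

theorem BruhatLE.length_le {x y : G} (h : BruhatLE s x y) : length s x ≤ length s y := by
  rcases h.eq_or_lt with rfl | h
  exacts [le_rfl, h.le]

theorem BruhatLE.eq_of_length_le {x y : G} (h : BruhatLE s x y)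
    (h' : length s y ≤ length s x) : x = y :=
  h.eq_or_lt.resolve_right h'.not_gt

end Words

/-- A sign function on pairs of a group element and a generator, which behaves like the sign of
the image of a simple root under an element of a reflection group. Its existence means that
the group is a Coxeter group with respect to the generators. -/
structure ExchangeSystem {B G : Type*} [Group G] (s : B → G) where
  pos : G → B → Prop
  exists_word : ∀ g, ∃ x, wordProd s x = g
  mul_self : ∀ i, s i * s i = 1
  pos_one : ∀ i, pos 1 i
  pos_mul_self : ∀ g i, pos (g * s i) i ↔ ¬ pos g i
  exch : ∀ g i j, pos g j → ¬ pos (s i * g) j → s i * g = g * s j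

/-! ### Deletion, the subword property and lifting -/

namespace ExchangeSystem

variable {B G : Type*} [Group G] {s : B → G} (E : ExchangeSystem s)
include E

theorem mul_mul_self (g : G) (i : B) : g * s i * s i = g := by
  rw [mul_assoc, E.mul_self, mul_one]

theorem self_mul_mul (g : G) (i : B) : s i * (s i * g) = g := by
  rw [← mul_assoc, E.mul_self, one_mul]

theorem gen_inv (i : B) : (s i)⁻¹ = s i := inv_eq_of_mul_eq_one_left (E.mul_self i)

theorem reflection_mul_self {t : G} (ht : IsReflection s t) : t * t = 1 := by
  obtain ⟨g, i, rfl⟩ := ht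
  have : g * s i * g⁻¹ * (g * s i * g⁻¹) = g * (s i * s i) * g⁻¹ := by group
  rw [this, E.mul_self]
  group

theorem exists_reduced (g : G) : ∃ x : List B, x.length = length s g ∧ wordProd s x = g := by
  obtain ⟨x, hx⟩ := E.exists_word g
  exact Nat.sInf_mem (s := {r | ∃ x : List B, x.length = r ∧ wordProd s x = g}) ⟨_, x, rfl, hx⟩

theorem eq_one_of_length_eq_zero {g : G} (h : length s g = 0) : g = 1 := by
  obtain ⟨x, hx, rfl⟩ := E.exists_reduced g
  rw [h, List.length_eq_zero_iff] at hx
  rw [hx, wordProd_nil]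

/-- A change from negative to positive is the opposite change read at `s i * g`. -/
theorem exch_iff {g : G} {i j : B} (h : E.pos g j ↔ ¬ E.pos (s i * g) j) :
    s i * g = g * s j := by
  by_cases hg : E.pos g j
  · exact E.exch g i j hg (h.mp hg)
  · have h1 := E.exch (s i * g) i j (by tauto) (by rwa [E.self_mul_mul])
    rw [E.self_mul_mul] at h1
    nth_rw 2 [h1]
    rw [E.mul_mul_self]

/-- As the letters of `x` are applied from right to left, the sign of the pair changes at some
letter. By `exch_iff` that letter acts there as right multiplication by `s i`, so omitting it has
the stated effect. -/
theorem deletion {g : G} {i : B} (x : List B) (h : E.pos g i ↔ ¬ E.pos (wordProd s x * g) i) :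
    ∃ y : List B, y.Sublist x ∧ y.length + 1 = x.length ∧
      wordProd s y = wordProd s x * (g * s i * g⁻¹) := by
  induction x with
  | nil => simp at h
  | cons a x ih =>
    by_cases h1 : E.pos g i ↔ ¬ E.pos (wordProd s x * g) i
    · obtain ⟨y, hy, hl, hp⟩ := ih h1
      exact ⟨a :: y, hy.cons_cons a, by simp [hl], by simp [hp, mul_assoc]⟩
    · rw [wordProd_cons, mul_assoc] at h
      have h2 := E.exch_iff (g := wordProd s x * g) (i := a) (j := i) (by tauto)
      refine ⟨x, List.sublist_cons_self a x, rfl, ?_⟩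
      rw [wordProd_cons]
      calc wordProd s x = s a * (s a * (wordProd s x * g)) * g⁻¹ := by
            rw [E.self_mul_mul]; group
        _ = _ := by rw [h2]; group

/-- For `t = h s_i h⁻¹`, passing from `g` to `g t` replaces `g h` by `g h s_i` and so flips its sign
at `i`. Hence `deletion` applies to the words of exactly one of `g` and `g t`, reduced or not. -/
theorem reflection_dichotomy {t : G} (ht : IsReflection s t) (g : G) :
    (length s (g * t) < length s g ∧ ∀ x, wordProd s x = g →
      ∃ y : List B, y.Sublist x ∧ y.length + 1 = x.length ∧ wordProd s y = g * t) ∨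
    (length s g < length s (g * t) ∧ ∀ x, wordProd s x = g * t →
      ∃ y : List B, y.Sublist x ∧ y.length + 1 = x.length ∧ wordProd s y = g) := by
  have key : ∀ {a b : G}, (∀ x, wordProd s x = a →
      ∃ y : List B, y.Sublist x ∧ y.length + 1 = x.length ∧ wordProd s y = b) →
      length s b < length s a := by
    intro a b h
    obtain ⟨x, hx, rfl⟩ := E.exists_reduced a
    obtain ⟨y, -, hl, rfl⟩ := h x rfl
    have := length_wordProd_le (s := s) y
    omega
  have htt := E.reflection_mul_self ht
  obtain ⟨h, i, rfl⟩ := ht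
  by_cases hc : E.pos h i ↔ ¬ E.pos (g * h) i
  · have : ∀ x, wordProd s x = g → ∃ y : List B, y.Sublist x ∧ y.length + 1 = x.length ∧
        wordProd s y = g * (h * s i * h⁻¹) := by
      rintro x rfl
      exact E.deletion x hc
    exact .inl ⟨key this, this⟩
  · have : ∀ x, wordProd s x = g * (h * s i * h⁻¹) → ∃ y : List B, y.Sublist x ∧
        y.length + 1 = x.length ∧ wordProd s y = g := by
      intro x hx
      have h1 : E.pos h i ↔ ¬ E.pos (wordProd s x * h) i := by
        rw [hx, show g * (h * s i * h⁻¹) * h = g * h * s i by group, E.pos_mul_self]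
        tauto
      obtain ⟨y, hy, hl, hp⟩ := E.deletion x h1
      exact ⟨y, hy, hl, by rw [hp, hx, mul_assoc, htt, mul_one]⟩
    exact .inr ⟨key this, this⟩

theorem length_mul_le (g : G) (i : B) : length s (g * s i) ≤ length s g + 1 := by
  obtain ⟨x, hx, rfl⟩ := E.exists_reduced g
  have := length_wordProd_le (s := s) (x ++ [i])
  simp only [wordProd_append, wordProd_singleton, List.length_append, List.length_singleton] at this
  omega

theorem length_lt_of_pos {g : G} {i : B} (h : E.pos g i) : length s g < length s (g * s i) := by
  obtain ⟨x, hx, hp⟩ := E.exists_reduced (g * s i)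
  have h1 : E.pos 1 i ↔ ¬ E.pos (wordProd s x * 1) i := by
    rw [hp, mul_one, E.pos_mul_self]
    simp [E.pos_one, h]
  obtain ⟨y, -, hl, hy⟩ := E.deletion x h1
  rw [hp, one_mul, inv_one, mul_one, E.mul_mul_self] at hy
  have := length_wordProd_le (s := s) y
  rw [hy] at this
  omega

theorem length_mul_of_pos {g : G} {i : B} (h : E.pos g i) :
    length s (g * s i) = length s g + 1 :=
  le_antisymm (E.length_mul_le g i) (E.length_lt_of_pos h)

theorem length_mul_of_not_pos {g : G} {i : B} (h : ¬ E.pos g i) :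
    length s (g * s i) + 1 = length s g := by
  have := E.length_mul_of_pos ((E.pos_mul_self g i).mpr h)
  rw [E.mul_mul_self] at this
  exact this.symm

theorem length_lt_iff {g : G} {i : B} : length s g < length s (g * s i) ↔ E.pos g i := by
  refine ⟨fun h => ?_, E.length_lt_of_pos⟩
  by_contra h1
  have := E.length_mul_of_not_pos h1
  omega

theorem mem_minReps {P : Set B} {g : G} : g ∈ minReps s P ↔ ∀ i ∈ P, E.pos g i :=
  forall₂_congr fun _ _ => E.length_lt_iff

theorem le_mul_of_pos {g : G} {i : B} (h : E.pos g i) : BruhatLE s g (g * s i) :=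
  .of_mul_reflection (isReflection_gen i) (E.length_lt_of_pos h)

theorem mul_le_of_not_pos {g : G} {i : B} (h : ¬ E.pos g i) : BruhatLE s (g * s i) g := by
  have := E.le_mul_of_pos ((E.pos_mul_self g i).mpr h)
  rwa [E.mul_mul_self] at this

/-- Every word contains a reduced word of the same element. -/
theorem exists_reduced_sublist (x : List B) :
    ∃ y : List B, y.Sublist x ∧ y.length = length s (wordProd s x) ∧
      wordProd s y = wordProd s x := by
  induction x using List.reverseRecOn with
  | nil => exact ⟨[], .refl _, by simp [length_one], rfl⟩
  | append_singleton x i ih =>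
    obtain ⟨y, hy, hl, hp⟩ := ih
    rw [wordProd_append, wordProd_singleton]
    by_cases h : E.pos (wordProd s x) i
    · refine ⟨y ++ [i], hy.append (.refl _), ?_, by simp [hp]⟩
      rw [E.length_mul_of_pos h]
      simp [hl]
    · have h1 := E.deletion (g := 1) (i := i) y (by simp [hp, h, E.pos_one])
      obtain ⟨z, hz, hl', hp'⟩ := h1
      refine ⟨z, hz.trans (hy.trans (List.sublist_append_left _ _)), ?_, by simp [hp', hp]⟩
      have := E.length_mul_of_not_pos h
      omega

/-- One half of the subword property, for an arbitrary word of the larger element. -/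
theorem exists_sublist_of_le {w : G} {x : List B} (h : BruhatLE s w (wordProd s x)) :
    ∃ y : List B, y.Sublist x ∧ y.length = length s w ∧ wordProd s y = w := by
  suffices ∀ g, BruhatLE s w g → ∀ x, wordProd s x = g →
      ∃ y : List B, y.Sublist x ∧ wordProd s y = w by
    obtain ⟨y, hy, rfl⟩ := this _ h x rfl
    obtain ⟨z, hz, hl, hp⟩ := E.exists_reduced_sublist y
    exact ⟨z, hz.trans hy, hl, hp⟩
  intro g hg
  induction hg with
  | refl => exact fun x hx => ⟨x, .refl _, hx⟩
  | @tail b c _ h' ih =>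
    intro x hx
    obtain ⟨t, ht, rfl, hlt⟩ := h'
    have ht' : IsReflection s (b⁻¹ * t * b) := by simpa using ht.conj b⁻¹
    have e : t * b = b * (b⁻¹ * t * b) := by group
    rw [e] at hlt hx
    rcases E.reflection_dichotomy ht' b with ⟨h1, -⟩ | ⟨-, h1⟩
    · omega
    · obtain ⟨y, hy, -, hp⟩ := h1 x hx
      obtain ⟨z, hz, hp'⟩ := ih y hp
      exact ⟨z, hz.trans hy, hp'⟩

/-- A reduced word of `g t` can be chosen to end in `i`, and `g` arises from it by deleting a
letter. If that letter is not the last, then `g` has a reduced word ending in `i`, against the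
assumption on `g`. -/
theorem eq_of_pos_of_not_pos {g t : G} {i : B} (ht : IsReflection s t)
    (hl : length s (g * t) = length s g + 1) (hg : E.pos g i) (hgt : ¬ E.pos (g * t) i) :
    g * t = g * s i := by
  obtain ⟨x, hx, hp⟩ := E.exists_reduced (g * t * s i)
  have h1 : wordProd s (x ++ [i]) = g * t := by simp [hp, E.mul_mul_self]
  have h2 := E.length_mul_of_not_pos hgt
  rcases E.reflection_dichotomy ht g with ⟨h, -⟩ | ⟨-, h⟩
  · omega
  obtain ⟨y, hy, hyl, hyp⟩ := h _ h1
  obtain ⟨a, c, rfl, ha, hc⟩ := List.sublist_append_iff.mp hy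
  rcases List.sublist_singleton.mp hc with rfl | rfl
  · simp only [List.append_nil, List.length_append, List.length_singleton] at hyl hyp
    have : a = x := ha.eq_of_length (by omega)
    rw [this, hp] at hyp
    nth_rw 2 [← hyp]
    rw [E.mul_mul_self]
  · exfalso
    have h3 := E.length_lt_of_pos hg
    rw [← hyp, wordProd_append, wordProd_singleton, E.mul_mul_self] at h3
    have := length_wordProd_le (s := s) a
    simp only [List.length_append, List.length_singleton] at hyl
    rw [wordProd_append, wordProd_singleton] at hyp
    rw [hyp] at h3
    omega

theorem conj_gen_reflection {t : G} (ht : IsReflection s t) (i : B) :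
    IsReflection s (s i * t * s i) := by
  have := ht.conj (s i)
  rwa [E.gen_inv] at this

/-- The lifting property for one step of a Bruhat chain. If `g s_i` is longer than `g` but not below
`g t s_i`, then deletion in a word of `g s_i` ending in `i` can only remove the last letter, and `t
= s_i`. -/
theorem mul_gen_le_or_of_reflection {g t : G} (ht : IsReflection s t)
    (h : length s g < length s (g * t)) (i : B) :
    BruhatLE s (g * s i) (g * t) ∨ BruhatLE s (g * s i) (g * t * s i) := by
  by_cases hg : E.pos g i
  · have e : g * t * s i = g * s i * (s i * t * s i) := by
      simp only [← mul_assoc, E.mul_mul_self]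
    rcases E.reflection_dichotomy (E.conj_gen_reflection ht i) (g * s i) with ⟨h1, h2⟩ | ⟨h1, -⟩
    · obtain ⟨x, hx, rfl⟩ := E.exists_reduced g
      obtain ⟨y, hy, hyl, hyp⟩ := h2 (x ++ [i]) (by simp)
      rw [← e] at hyp
      obtain ⟨a, c, rfl, ha, hc⟩ := List.sublist_append_iff.mp hy
      rcases List.sublist_singleton.mp hc with rfl | rfl
      · simp only [List.append_nil, List.length_append, List.length_singleton] at hyl hyp
        have : a = x := ha.eq_of_length (by omega)
        subst this
        left
        have h3 : wordProd s a * s i = wordProd s a * t := by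
          nth_rw 1 [hyp]
          rw [E.mul_mul_self]
        rw [h3]
        exact BruhatLE.refl _
      · exfalso
        rw [wordProd_append, wordProd_singleton] at hyp
        rw [← mul_right_cancel hyp] at h
        have := length_wordProd_le (s := s) a
        simp only [List.length_append, List.length_singleton] at hyl
        omega
    · right
      rw [e]
      exact .of_mul_reflection (E.conj_gen_reflection ht i) h1
  · exact .inl ((E.mul_le_of_not_pos hg).trans (.of_mul_reflection ht h))

theorem mul_gen_le_or {w g : G} (h : BruhatLE s w g) (i : B) :
    BruhatLE s (w * s i) g ∨ BruhatLE s (w * s i) (g * s i) := by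
  induction h with
  | refl => exact .inr (.refl _)
  | @tail b c hb h' ih =>
    have hbc : BruhatLE s b c := .single h'
    obtain ⟨t, ht, rfl, hlt⟩ := h'
    have ht' : IsReflection s (b⁻¹ * t * b) := by simpa using ht.conj b⁻¹
    have e : t * b = b * (b⁻¹ * t * b) := by group
    rcases ih with ih | ih
    · exact .inl (ih.trans hbc)
    · rw [e] at hlt ⊢
      exact (E.mul_gen_le_or_of_reflection ht' hlt i).imp ih.trans ih.trans

theorem mul_gen_le_of_not_pos {w g : G} {i : B} (h : BruhatLE s w g) (hg : ¬ E.pos g i) :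
    BruhatLE s (w * s i) g :=
  (E.mul_gen_le_or h i).elim id fun h' => h'.trans (E.mul_le_of_not_pos hg)

theorem mul_gen_le_mul_gen {w g : G} {i : B} (h : BruhatLE s w g) (hg : E.pos g i) :
    BruhatLE s (w * s i) (g * s i) :=
  (E.mul_gen_le_or h i).elim (fun h' => h'.trans (E.le_mul_of_pos hg)) id

/-- The other half of the subword property. -/
theorem le_of_sublist {y x : List B} (hx : length s (wordProd s x) = x.length)
    (h : y.Sublist x) : BruhatLE s (wordProd s y) (wordProd s x) := by
  induction x using List.reverseRecOn generalizing y with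
  | nil => rw [List.sublist_nil.mp h]; exact .refl _
  | append_singleton x i ih =>
    rw [wordProd_append, wordProd_singleton, List.length_append, List.length_singleton] at hx
    have h1 := E.length_mul_le (wordProd s x) i
    have h2 := length_wordProd_le (s := s) x
    have h3 : E.pos (wordProd s x) i := E.length_lt_iff.mp (by omega)
    obtain ⟨a, c, rfl, ha, hc⟩ := List.sublist_append_iff.mp h
    have h4 := ih (by omega) ha
    rw [wordProd_append, wordProd_append, wordProd_singleton]
    rcases List.sublist_singleton.mp hc with rfl | rfl
    · rw [wordProd_nil, mul_one]
      exact h4.trans (E.le_mul_of_pos h3)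
    · rw [wordProd_singleton]
      exact E.mul_gen_le_mul_gen h4 h3

/-- In a word of `g` ending in `i`, a reduced subword for `w` cannot use that last letter, since `w`
has no descent at `i`. -/
theorem le_mul_gen {w g : G} {i : B} (hw : E.pos w i) (h : BruhatLE s w g) :
    BruhatLE s w (g * s i) := by
  obtain ⟨x, hx, hp⟩ := E.exists_reduced (g * s i)
  have h1 : wordProd s (x ++ [i]) = g := by simp [hp, E.mul_mul_self]
  rw [← h1] at h
  obtain ⟨y, hy, hyl, hyp⟩ := E.exists_sublist_of_le h
  obtain ⟨a, c, rfl, ha, hc⟩ := List.sublist_append_iff.mp hy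
  rcases List.sublist_singleton.mp hc with rfl | rfl
  · rw [← hyp, ← hp, List.append_nil]
    exact E.le_of_sublist (by rw [hp, hx]) ha
  · exfalso
    rw [wordProd_append, wordProd_singleton] at hyp
    have h2 := E.length_lt_of_pos hw
    have h3 := length_wordProd_le (s := s) a
    rw [← hyp, E.mul_mul_self] at h2
    rw [← hyp] at hyl
    simp only [List.length_append, List.length_singleton] at hyl
    omega

/-! ### Dihedral cosets and invariants of reduced words -/

/-- The alternating word of length `n` in two letters which ends in the second one. -/
def _root_.Folding.altWord {B : Type*} (i j : B) : ℕ → List B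
  | 0 => []
  | n + 1 => altWord j i n ++ [j]

omit E in
theorem length_altWord (i j : B) (n : ℕ) : (altWord i j n).length = n := by
  induction n generalizing i j with
  | zero => rfl
  | succ n ih => simp [altWord, ih]

/-- Descents at `j` and `i` are stripped off in turn, until the minimal element of the coset of the
dihedral subgroup is reached. -/
theorem exists_eq_mul_altWord (n : ℕ) : ∀ (g : G) (i j : B), length s g = n → E.pos g i →
    ∃ h m, g = h * wordProd s (altWord i j m) ∧ length s g = length s h + m ∧
      E.pos h i ∧ E.pos h j := by
  induction n with
  | zero =>
    intro g i j hg _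
    rw [E.eq_one_of_length_eq_zero hg]
    exact ⟨1, 0, by simp [altWord], by simp, E.pos_one i, E.pos_one j⟩
  | succ n ih =>
    intro g i j hg hi
    by_cases hj : E.pos g j
    · exact ⟨g, 0, by simp [altWord], by simp, hi, hj⟩
    · have h1 := E.length_mul_of_not_pos hj
      obtain ⟨h, m, he, hl, hj', hi'⟩ :=
        ih (g * s j) j i (by omega) ((E.pos_mul_self g j).mpr hj)
      refine ⟨h, m + 1, ?_, by omega, hi', hj'⟩
      rw [altWord, wordProd_append, wordProd_singleton, ← mul_assoc, ← he, E.mul_mul_self]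

theorem le_mul_altWord {w : G} {i j : B} (hi : E.pos w i) (hj : E.pos w j) (m : ℕ) :
    ∀ g, BruhatLE s w g → BruhatLE s w (g * (wordProd s (altWord i j m))⁻¹) := by
  induction m generalizing i j with
  | zero => simp [altWord]
  | succ m ih =>
    intro g hg
    rw [altWord, wordProd_append, wordProd_singleton, mul_inv_rev, E.gen_inv, ← mul_assoc]
    exact ih hj hi _ (E.le_mul_gen hj hg)

/-- An element with two descents has reduced words that end in either alternating word. -/
theorem exists_eq_mul_altWord_both {g : G} {i j : B} (hi : ¬ E.pos g i) (hj : ¬ E.pos g j) :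
    ∃ h m, g = h * wordProd s (altWord i j (m + 1)) ∧ g = h * wordProd s (altWord j i (m + 1)) ∧
      length s g = length s h + (m + 1) := by
  have key : ∀ i j, ¬ E.pos g j → ∃ h m, g = h * wordProd s (altWord i j (m + 1)) ∧
      length s g = length s h + (m + 1) ∧ E.pos h i ∧ E.pos h j := by
    intro i j hj
    have h1 := E.length_mul_of_not_pos hj
    obtain ⟨h, m, he, hl, hj', hi'⟩ :=
      E.exists_eq_mul_altWord _ (g * s j) j i rfl ((E.pos_mul_self g j).mpr hj)
    refine ⟨h, m, ?_, by omega, hi', hj'⟩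
    rw [altWord, wordProd_append, wordProd_singleton, ← mul_assoc, ← he, E.mul_mul_self]
  obtain ⟨h, m, he, hl, hhi, hhj⟩ := key i j hj
  obtain ⟨h', m', he', hl', hhj', hhi'⟩ := key j i hi
  have le_of : ∀ {a c : G} {p q} {n : ℕ}, E.pos a p → E.pos a q →
      BruhatLE s a (c * wordProd s (altWord p q n)) → BruhatLE s a c := by
    intro a c p q n hp hq h
    have := E.le_mul_altWord hp hq n _ h
    rwa [mul_inv_cancel_right] at this
  have up : ∀ {a : G} {i j} (n : ℕ), E.pos a i → E.pos a j →
      BruhatLE s a (a * wordProd s (altWord i j n)) := by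
    intro a i j n
    induction n generalizing i j with
    | zero => intro _ _; simpa [altWord] using BruhatLE.refl a
    | succ n ih =>
      intro hi hj
      rw [altWord, wordProd_append, wordProd_singleton, ← mul_assoc]
      exact E.le_mul_gen hj (ih hj hi)
  -- Both `h` and `h'` are minimal and lie below `g`, so each stays below when the letters leading
  -- to the other one are removed. This gives both inequalities.
  have h1 : BruhatLE s h g := he ▸ up (m + 1) hhi hhj
  have h2 : BruhatLE s h' g := he' ▸ up (m' + 1) hhj' hhi'
  have h3 : BruhatLE s h h' :=
    le_of hhj hhi (n := m' + 1) (he' ▸ h1)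
  have h4 : BruhatLE s h' h :=
    le_of hhi' hhj' (n := m + 1) (he ▸ h2)
  have h5 : h = h' := h3.eq_of_length_le h4.length_le
  subst h5
  have h6 : m = m' := by omega
  subst h6
  exact ⟨h, m, he, he', hl⟩

-- Two letters placed at the end of each word cancel in the comparison. A difference can remain only
-- for odd `n`, where one word has an extra `i` and the other an extra `j`.
omit E in
theorem sum_altWord {M : Type*} [AddCommMonoid M] (e : B → M) {i j : B} {n : ℕ}
    (h : Odd n → e i = e j) :
    ((altWord i j n).map e).sum = ((altWord j i n).map e).sum := by
  induction n using Nat.strong_induction_on generalizing i j with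
  | _ n ih =>
    rcases n with _ | _ | n
    · rfl
    · simpa [altWord] using (h odd_one).symm
    · have h1 := ih n (by omega) (i := i) (j := j) (fun ho => h (by grind))
      simp only [altWord, List.map_append, List.sum_append, List.map_cons, List.map_nil,
        List.sum_singleton, h1]
      rw [add_assoc, add_assoc, add_comm (e i)]

omit E in
theorem mem_altWord {i j a : B} {n : ℕ} (h : a ∈ altWord i j n) : a = i ∨ a = j := by
  induction n generalizing i j with
  | zero => simp [altWord] at h
  | succ n ih =>
    rw [altWord, List.mem_append, List.mem_singleton] at h
    exact h.elim (fun h => (ih h).symm) Or.inr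

/-- A function on letters whose values agree on any two letters that occur in a braid relation of
odd length has the same sum over any two reduced words of an element. -/
theorem sum_eq_of_reduced {M : Type*} [AddCommMonoid M] (e : B → M) (J : Set B)
    (he : ∀ i ∈ J, ∀ j ∈ J, ∀ n, Odd n →
      wordProd s (altWord i j n) = wordProd s (altWord j i n) → e i = e j)
    (n : ℕ) : ∀ x y : List B, x.length = n → y.length = n → wordProd s x = wordProd s y →
      length s (wordProd s x) = n → (∀ i ∈ x, i ∈ J) → (∀ i ∈ y, i ∈ J) →
      (x.map e).sum = (y.map e).sum := by
  induction n with
  | zero =>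
    intro x y hx hy _ _ _ _
    rw [List.length_eq_zero_iff.mp hx, List.length_eq_zero_iff.mp hy]
  | succ n ih =>
    intro x y hx hy hxy hl hxJ hyJ
    obtain ⟨x, i, rfl⟩ := List.eq_nil_or_concat'  x |>.resolve_left (by rintro rfl; simp at hx)
    obtain ⟨y, j, rfl⟩ := List.eq_nil_or_concat'  y |>.resolve_left (by rintro rfl; simp at hy)
    have aux : ∀ {x : List B} {i : B}, (x ++ [i]).length = n + 1 →
        length s (wordProd s (x ++ [i])) = n + 1 →
        x.length = n ∧ length s (wordProd s x) = n ∧ ¬ E.pos (wordProd s (x ++ [i])) i := by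
      intro x i hx hl
      rw [wordProd_append, wordProd_singleton] at hl ⊢
      rw [List.length_append, List.length_singleton] at hx
      have h1 := E.length_mul_le (wordProd s x) i
      have h2 := length_wordProd_le (s := s) x
      refine ⟨by omega, by omega, ?_⟩
      rw [E.pos_mul_self, not_not, ← E.length_lt_iff]
      omega
    obtain ⟨hx1, hx2, hx3⟩ := aux hx hl
    obtain ⟨hy1, hy2, hy3⟩ := aux hy (hxy ▸ hl)
    have hxJ1 : ∀ a ∈ x, a ∈ J := fun a ha => hxJ a (by simp [ha])
    have hyJ1 : ∀ a ∈ y, a ∈ J := fun a ha => hyJ a (by simp [ha])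
    have hiJ : i ∈ J := hxJ i (by simp)
    have hjJ : j ∈ J := hyJ j (by simp)
    rw [← hxy] at hy3
    obtain ⟨h, m, h1, h2, h3⟩ := E.exists_eq_mul_altWord_both hx3 hy3
    have hodd : wordProd s (altWord i j (m + 1)) = wordProd s (altWord j i (m + 1)) :=
      mul_left_cancel (h1.symm.trans h2)
    -- The reduced word of `h` must use letters of `J` only, because the induction hypothesis is
    -- restricted to such words. It is taken as a subword of `x i` followed by the reversed
    -- alternating word.
    obtain ⟨z, hz, hzl, hzp⟩ : ∃ z : List B, (∀ a ∈ z, a ∈ J) ∧ z.length = length s h ∧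
        wordProd s z = h := by
      have h4 : wordProd s (x ++ [i] ++ (altWord i j (m + 1)).reverse) = h := by
        have h5 : ∀ x : List B, wordProd s x.reverse = (wordProd s x)⁻¹ := by
          intro x
          induction x with
          | nil => simp
          | cons a x ih => simp [ih, E.gen_inv]
        rw [wordProd_append, h5]
        exact mul_inv_eq_of_eq_mul h1
      obtain ⟨z, hz, hzl, hzp⟩ := E.exists_reduced_sublist
        (x ++ [i] ++ (altWord i j (m + 1)).reverse)
      refine ⟨z, fun a ha => ?_, by rw [hzl, h4], by rw [hzp, h4]⟩
      have := hz.mem ha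
      rw [List.mem_append, List.mem_reverse] at this
      rcases this with h | h
      · exact hxJ a h
      · rcases mem_altWord h with rfl | rfl <;> assumption
    -- The prefix `x` and the word `z` followed by an alternating word are reduced words of the same
    -- element of length `n`, so the induction hypothesis compares them.
    have main : ∀ {x : List B} {i j : B}, x.length = n → length s (wordProd s x) = n →
        (∀ a ∈ x, a ∈ J) → i ∈ J → j ∈ J →
        wordProd s (x ++ [i]) = h * wordProd s (altWord j i (m + 1)) →
        ((x ++ [i]).map e).sum = (z.map e).sum + ((altWord j i (m + 1)).map e).sum := by
      intro x i j hx1 hx2 hxJ1 hi hj hp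
      have h4 : wordProd s x = wordProd s (z ++ altWord i j m) := by
        rw [altWord, wordProd_append, wordProd_append, ← mul_assoc] at hp
        rw [wordProd_append, hzp]
        exact mul_right_cancel hp
      rw [altWord, List.map_append, List.sum_append, List.map_append, List.sum_append, ← add_assoc]
      congr 1
      rw [ih x (z ++ altWord i j m) hx1 (by rw [List.length_append, length_altWord]; omega) h4
        hx2 hxJ1, List.map_append, List.sum_append]
      intro a ha
      rw [List.mem_append] at ha
      rcases ha with ha | ha
      · exact hz a ha
      · rcases mem_altWord ha with rfl | rfl <;> assumption
    rw [main hx1 hx2 hxJ1 hiJ hjJ h2, main hy1 hy2 hyJ1 hjJ hiJ (hxy ▸ h1),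
      sum_altWord e (i := j) (j := i) (n := m + 1)]
    intro ho
    exact (he i hiJ j hjJ _ ho hodd).symm

end ExchangeSystem

end Folding

/-! ### Sums over subwords of given length and product -/

namespace Folding

section SubwordSums

variable {B G A : Type*} [Group G] [CommSemiring A]

open Classical in
/-- For a list of group elements with weights, the sum of the products of the weights over all
sublists of length `n` whose product is `w`. -/
noncomputable def subSum : List (G × A) → ℤ → G → A
  | [], n, w => if n = 0 ∧ w = 1 then 1 else 0
  | (g, a) :: l, n, w => subSum l n w + a * subSum l (n - 1) (g⁻¹ * w)

/-- Degrees are integers so that `n - 1` in the recursion does not truncate at zero; the price is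
this vanishing. -/
theorem subSum_of_neg (l : List (G × A)) {n : ℤ} (hn : n < 0) (w : G) : subSum l n w = 0 := by
  induction l generalizing n w with
  | nil => simp [subSum, hn.ne]
  | cons p l ih => simp [subSum, ih hn, ih (show n - 1 < 0 by omega)]

theorem subSum_zero_one (l : List (G × A)) : subSum l 0 1 = 1 := by
  induction l with
  | nil => simp [subSum]
  | cons p l ih => simp [subSum, ih, subSum_of_neg]

theorem subSum_append_singleton (l : List (G × A)) (g : G) (a : A) (n : ℤ) (w : G) :
    subSum (l ++ [(g, a)]) n w = subSum l n w + subSum l (n - 1) (w * g⁻¹) * a := by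
  induction l generalizing n w with
  | nil =>
    have : (g⁻¹ * w = 1) ↔ (w * g⁻¹ = 1) := by
      rw [inv_mul_eq_one, mul_inv_eq_one, eq_comm]
    by_cases h : w * g⁻¹ = 1
    · simp [subSum, h, this.mpr h]
    · simp [subSum, h, mt this.mp h]
  | cons p l ih =>
    simp only [List.cons_append, subSum, ih, ← mul_assoc]
    ring

theorem exists_sublist_of_subSum_ne_zero {l : List (G × A)} {n : ℤ} {w : G}
    (h : subSum l n w ≠ 0) :
    ∃ y : List (G × A), y.Sublist l ∧ (y.length : ℤ) = n ∧ (y.map Prod.fst).prod = w := by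
  induction l generalizing n w with
  | nil =>
    rw [subSum] at h
    classical
    rw [ite_ne_right_iff] at h
    exact ⟨[], .refl _, by simp [h.1.1], by simp [h.1.2]⟩
  | cons p l ih =>
    rw [subSum] at h
    by_cases h1 : subSum l n w = 0
    · rw [h1, zero_add] at h
      obtain ⟨y, hy, hl, hp⟩ := ih (right_ne_zero_of_mul h)
      exact ⟨p :: y, hy.cons_cons p, by simp [hl], by simp [hp]⟩
    · obtain ⟨y, hy, hl, hp⟩ := ih h1
      exact ⟨y, hy.cons p, hl, hp⟩

theorem map_subSum {A' : Type*} [CommSemiring A'] (φ : A →+* A') (l : List (G × A)) (n : ℤ)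
    (w : G) : φ (subSum l n w) = subSum (l.map (Prod.map id φ)) n w := by
  induction l generalizing n w with
  | nil => simp [subSum, apply_ite φ]
  | cons p l ih => simp [subSum, ih]

theorem subSum_nonneg {l : List (G × ℝ)} (hl : ∀ p ∈ l, 0 < p.2) (n : ℤ) (w : G) :
    0 ≤ subSum l n w := by
  induction l generalizing n w with
  | nil => rw [subSum]; split_ifs <;> norm_num
  | cons p l ih =>
    rw [List.forall_mem_cons] at hl
    exact add_nonneg (ih hl.2 _ _) (mul_nonneg hl.1.le (ih hl.2 _ _))

theorem subSum_pos {l y : List (G × ℝ)} (hl : ∀ p ∈ l, 0 < p.2) (h : y.Sublist l) :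
    0 < subSum l y.length (y.map Prod.fst).prod := by
  induction h with
  | slnil => simp [subSum]
  | @cons y l p _ ih =>
    rw [List.forall_mem_cons] at hl
    exact add_pos_of_pos_of_nonneg (ih hl.2) (mul_nonneg hl.1.le (subSum_nonneg hl.2 _ _))
  | @cons_cons y l p _ ih =>
    rw [List.forall_mem_cons] at hl
    refine add_pos_of_nonneg_of_pos (subSum_nonneg hl.2 _ _) (mul_pos hl.1 ?_)
    simpa using ih hl.2

theorem subSum_smul (l : List (G × A)) (t : A) (n : ℕ) (w : G) :
    subSum (l.map fun p => (p.1, t * p.2)) n w = t ^ n * subSum l n w := by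
  induction l generalizing n w with
  | nil =>
    rcases n with _ | n
    · simp [subSum]
    · have : ((n : ℤ) + 1) ≠ 0 := by omega
      simp [subSum, this]
  | cons p l ih =>
    rcases n with _ | n
    · simpa [subSum, subSum_of_neg] using ih 0 w
    · have h := ih n (p.1⁻¹ * w)
      have h' := ih (n + 1) w
      rw [Nat.cast_succ] at h' ⊢
      simp only [List.map_cons, subSum, add_sub_cancel_right, h, h']
      ring

variable (s : B → G) (f : G → B → A)

/-- The list of the letters of a word, each with a weight that depends on the letter and on
the product of the preceding letters. -/
def weightedWord : G → List B → List (G × A)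
  | _, [] => []
  | g, i :: x => (s i, f g i) :: weightedWord (g * s i) x

omit [CommSemiring A] in
theorem weightedWord_append (g : G) (x y : List B) :
    weightedWord s f g (x ++ y) =
      weightedWord s f g x ++ weightedWord s f (g * wordProd s x) y := by
  induction x generalizing g with
  | nil => simp [weightedWord]
  | cons i x ih => simp [weightedWord, ih, mul_assoc]

omit [CommSemiring A] in
theorem map_fst_weightedWord (g : G) (x : List B) :
    (weightedWord s f g x).map Prod.fst = x.map s := by
  induction x generalizing g with
  | nil => rfl
  | cons i x ih => simp [weightedWord, ih]

omit [CommSemiring A] in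
theorem sublist_of_sublist_weightedWord {g : G} {x : List B} {y : List (G × A)}
    (h : y.Sublist (weightedWord s f g x)) :
    ∃ z : List B, z.Sublist x ∧ y.map Prod.fst = z.map s := by
  have := h.map Prod.fst
  rw [map_fst_weightedWord] at this
  obtain ⟨z, hz, he⟩ := List.sublist_map_iff.mp this
  exact ⟨z, hz, he⟩

omit [CommSemiring A] in
theorem exists_sublist_weightedWord {g : G} {x z : List B} (h : z.Sublist x) :
    ∃ y : List (G × A), y.Sublist (weightedWord s f g x) ∧ y.map Prod.fst = z.map s := by
  have := h.map s
  rw [← map_fst_weightedWord s f g x] at this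
  obtain ⟨y, hy, he⟩ := List.sublist_map_iff.mp this
  exact ⟨y, hy, he.symm⟩

omit [Group G] [CommSemiring A] in
theorem sum_finset_fin_succ {M : Type*} [AddCommMonoid M] {m : ℕ}
    (φ : Finset (Fin (m + 1)) → M) :
    ∑ I, φ I = ∑ I : Finset (Fin m),
      (φ (I.map (Fin.succEmb m)) + φ (insert 0 (I.map (Fin.succEmb m)))) := by
  have h1 : (Finset.univ : Finset (Finset (Fin (m + 1)))) =
      (insert 0 (Finset.univ.map (Fin.succEmb m))).powerset := by
    rw [← Finset.powerset_univ, Fin.univ_succ]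
    congr 1
    ext i
    simp
  have h2 : (Finset.univ.map (Fin.succEmb m)).powerset =
      (Finset.univ : Finset (Finset (Fin m))).map (Finset.mapEmbedding (Fin.succEmb m)).toEmbedding := by
    ext I
    simp only [Finset.mem_powerset, Finset.mem_map, Finset.mem_univ, true_and]
    rw [Finset.subset_map_iff]
    simp [eq_comm]
  rw [h1, Finset.sum_powerset_insert (by simp), h2, Finset.sum_map, Finset.sum_map,
    ← Finset.sum_add_distrib]
  rfl

-- Links the sum over index sets in the definition of Schubert classes to the recursive sum, by
-- splitting the sets according to whether they contain the first index.
open Classical in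
theorem sum_finset_eq_subSum_ofFn : ∀ (m : ℕ) (a : Fin m → G) (c : Fin m → A) (n : ℕ) (w : G),
    ∑ I : Finset (Fin m) with I.card = n ∧ ((I.sort (· ≤ ·)).map a).prod = w, ∏ p ∈ I, c p =
      subSum (List.ofFn fun p => (a p, c p)) n w := by
  intro m
  induction m with
  | zero =>
    intro a c n w
    have : (Finset.univ : Finset (Finset (Fin 0))) = {∅} := rfl
    rw [Finset.sum_filter, this, Finset.sum_singleton]
    simp [subSum, eq_comm]
  | succ m ih =>
    intro a c n w
    have h1 : ∀ I : Finset (Fin m), (I.map (Fin.succEmb m)).sort (· ≤ ·) =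
        (I.sort (· ≤ ·)).map (Fin.succEmb m) := fun I =>
      (Finset.map_sort _ _ _ _ (by simp)).symm
    have h2 : ∀ I : Finset (Fin m), (insert 0 (I.map (Fin.succEmb m))).sort (· ≤ ·) =
        0 :: (I.sort (· ≤ ·)).map (Fin.succEmb m) := fun I => by
      rw [Finset.sort_insert _ (by simp) (by simp), h1]
    rw [Finset.sum_filter, sum_finset_fin_succ, Finset.sum_add_distrib, List.ofFn_succ, subSum]
    congr 1
    · rw [← ih, Finset.sum_filter]
      refine Finset.sum_congr rfl fun I _ => ?_
      rw [h1]
      simp [Function.comp_def]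
    · rcases n with _ | n
      · rw [subSum_of_neg _ (by simp), mul_zero]
        refine Finset.sum_eq_zero fun I _ => if_neg ?_
        simp
      · rw [show ((n + 1 : ℕ) : ℤ) - 1 = n by simp, ← ih, Finset.mul_sum, Finset.sum_filter]
        refine Finset.sum_congr rfl fun I _ => ?_
        rw [h2, Finset.card_insert_of_notMem (by simp), Finset.prod_insert (by simp)]
        simp [eq_inv_mul_iff_mul_eq, Function.comp_def]

omit [CommSemiring A] in
theorem weightedWord_eq_ofFn (g : G) (x : List B) :
    weightedWord s f g x = List.ofFn fun p : Fin x.length =>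
      (s (x.get p), f (g * wordProd s (x.take p)) (x.get p)) := by
  induction x generalizing g with
  | nil => rfl
  | cons i x ih => simp [weightedWord, ih, List.ofFn_succ, mul_assoc]

end SubwordSums

section Schubert

variable {R V B : Type*} [CommRing R] [AddCommMonoid V] [Module R V]
  {N : Submodule R V} {G : Subgroup (V ≃ₗ[R] V)} (hN : ∀ g ∈ G, ∀ v ∈ N, g v ∈ N)
  (s : B → G) (a : B → N)

/-- The image of `α_i` under `g`, in the symmetric algebra. -/
def rootWeight (g : G) (i : B) : SymmetricAlgebra R N :=
  SymmetricAlgebra.ι R N ⟨g.1 (a i), hN _ (SetLike.coe_mem g) _ (a i).2⟩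

theorem schubertSum_eq_subSum (w : G) (x : List B) :
    schubertSum hN s a w x =
      subSum (weightedWord s (rootWeight hN a) 1 x) (length s w) w := by
  classical
  rw [weightedWord_eq_ofFn, ← sum_finset_eq_subSum_ofFn, schubertSum]
  refine Finset.sum_congr ?_ ?_
  · ext I
    simp [wordProd, Function.comp_def]
  · intro I _
    refine Finset.prod_congr rfl fun p _ => ?_
    rw [rootWeight]
    congr 2

end Schubert

end Folding

/-! ### Chevalley's formula and independence of the word -/

namespace Folding

section

variable {B G A : Type*} [Group G] [CommRing A] {s : B → G}

/-- The combinatorial Schubert class of `w`, computed from a given word. -/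
noncomputable def wordSum (s : B → G) (f : G → B → A) (x : List B) (w : G) : A :=
  subSum (weightedWord s f 1 x) (length s w) w

theorem subSum_weightedWord_eq_zero (f : G → B → A) (g : G) (x : List B) {n : ℤ} {w : G}
    (h : n < length s w) : subSum (weightedWord s f g x) n w = 0 := by
  by_contra hc
  obtain ⟨y, hy, hl, hp⟩ := exists_sublist_of_subSum_ne_zero hc
  obtain ⟨z, -, hz⟩ := sublist_of_sublist_weightedWord s f hy
  have h1 := length_wordProd_le (s := s) z
  rw [wordProd, ← hz, hp] at h1
  have h2 := congrArg List.length hz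
  simp only [List.length_map] at h2
  omega

theorem wordSum_eq_zero_of_length_lt (f : G → B → A) {x : List B} {w : G}
    (h : x.length < length s w) : wordSum s f x w = 0 := by
  by_contra hc
  obtain ⟨y, hy, hl, -⟩ := exists_sublist_of_subSum_ne_zero hc
  obtain ⟨z, hz, hyz⟩ := sublist_of_sublist_weightedWord s f hy
  have h2 := congrArg List.length hyz
  have h3 := hz.length_le
  simp only [List.length_map] at h2
  omega

theorem wordSum_one (f : G → B → A) (x : List B) : wordSum s f x 1 = 1 := by
  rw [wordSum, length_one]
  exact subSum_zero_one _

variable (E : ExchangeSystem s)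
include E

-- A subword for `w` that uses the last letter leaves a subword for `w s_i` with `ℓ(w) - 1` letters,
-- which is too few unless `i` is a descent of `w`.
open Classical in
theorem wordSum_append_singleton (f : G → B → A) (x : List B) (i : B) (w : G) :
    wordSum s f (x ++ [i]) w = wordSum s f x w +
      if E.pos w i then 0 else wordSum s f x (w * s i) * f (wordProd s x) i := by
  rw [wordSum, weightedWord_append, weightedWord, weightedWord, subSum_append_singleton, one_mul,
    E.gen_inv]
  congr 1
  split_ifs with h
  · rw [subSum_weightedWord_eq_zero, zero_mul]
    have := E.length_mul_of_pos h
    omega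
  · have := E.length_mul_of_not_pos h
    rw [wordSum, ← this]
    simp

/-- A word has just one subword of full length, so for a reduced word the sum is a single product of
nonzero weights. -/
theorem wordSum_ne_zero [IsDomain A] {f : G → B → A} (hf : ∀ g i, f g i ≠ 0) (x : List B)
    (hx : length s (wordProd s x) = x.length) : wordSum s f x (wordProd s x) ≠ 0 := by
  induction x using List.reverseRecOn with
  | nil => rw [wordProd_nil, wordSum_one]; exact one_ne_zero
  | append_singleton x i ih =>
    rw [wordProd_append, wordProd_singleton, List.length_append, List.length_singleton] at hx
    have h1 := E.length_mul_le (wordProd s x) i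
    have h2 := length_wordProd_le (s := s) x
    have h3 : E.pos (wordProd s x) i := E.length_lt_iff.mp (by omega)
    rw [wordSum_append_singleton E, wordProd_append, wordProd_singleton, E.mul_mul_self,
      wordSum_eq_zero_of_length_lt f (by omega), zero_add, if_neg (by rwa [E.pos_mul_self, not_not])]
    exact mul_ne_zero (ih (by omega)) (hf _ _)

end

/-- Positive roots, with their reflections and coroots, for a reflection group that acts on a
space of vectors `V`. -/
structure RootAction {B G : Type*} [Group G] (s : B → G) (A V J : Type*) [CommRing A] where
  refl : J → G
  simple : B → J
  perm : B → J → J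
  coroot : J → V → A
  reflVec : B → V → V
  act : G → V → A
  weight : G → B → A
  isReflection_refl : ∀ j, IsReflection s (refl j)
  refl_simple : ∀ i, refl (simple i) = s i
  eq_simple : ∀ i j, refl j = s i → j = simple i
  perm_perm : ∀ i j, perm i (perm i j) = j
  perm_simple : ∀ i, perm i (simple i) = simple i
  refl_perm : ∀ i j, refl (perm i j) = s i * refl j * s i
  coroot_perm : ∀ i j v, j ≠ simple i → coroot (perm i j) (reflVec i v) = coroot j v
  coroot_simple : ∀ i v, coroot (simple i) (reflVec i v) = -coroot (simple i) v
  act_mul : ∀ g i v, act (g * s i) v = act g (reflVec i v)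
  act_reflVec : ∀ g i v, act g (reflVec i v) = act g v - coroot (simple i) v * weight g i
  act_separates : ∀ g h, (∀ v, act g v = act h v) → g = h
  weight_ne_zero : ∀ g i, weight g i ≠ 0

namespace RootAction

variable {B G A V J : Type*} [Group G] [CommRing A] {s : B → G} [Fintype J]
  (R : RootAction s A V J) (E : ExchangeSystem s)
include E

open Classical in
/-- Chevalley's formula for combinatorial Schubert classes. -/
theorem chevalley (x : List B) : ∀ (w : G) (v : V),
    (R.act w v - R.act (wordProd s x) v) * wordSum s R.weight x w =
      ∑ j, if length s (w * R.refl j) = length s w + 1 then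
        R.coroot j v * wordSum s R.weight x (w * R.refl j) else 0 := by
  induction x using List.reverseRecOn with
  | nil =>
    intro w v
    by_cases hw : w = 1
    · subst hw
      rw [wordProd_nil, sub_self, zero_mul, Finset.sum_eq_zero]
      intro j _
      split_ifs with h
      · rw [wordSum_eq_zero_of_length_lt _ (by rw [h]; simp), mul_zero]
      · rfl
    · rw [wordSum_eq_zero_of_length_lt, mul_zero, Finset.sum_eq_zero]
      · intro j _
        split_ifs with h
        · rw [wordSum_eq_zero_of_length_lt _ (by rw [h]; simp), mul_zero]
        · rfl
      · exact Nat.pos_of_ne_zero (mt E.eq_one_of_length_eq_zero hw)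
  | append_singleton x i ih =>
    intro w v
    set β := R.weight (wordProd s x) i with hβ
    -- The right-hand side for `x ++ [i]` is the one for `x` plus `β` times the terms whose element
    -- `w * R.refl j` has a descent at `i`.
    have hsplit : (∑ j, if length s (w * R.refl j) = length s w + 1 then
        R.coroot j v * wordSum s R.weight (x ++ [i]) (w * R.refl j) else 0) =
        (∑ j, if length s (w * R.refl j) = length s w + 1 then
          R.coroot j v * wordSum s R.weight x (w * R.refl j) else 0) +
        (∑ j, if length s (w * R.refl j) = length s w + 1 ∧ ¬ E.pos (w * R.refl j) i then
          R.coroot j v * wordSum s R.weight x (w * R.refl j * s i) else 0) * β := by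
      rw [Finset.sum_mul, ← Finset.sum_add_distrib]
      refine Finset.sum_congr rfl fun j _ => ?_
      rw [wordSum_append_singleton E, ← hβ]
      by_cases h1 : length s (w * R.refl j) = length s w + 1 <;>
        by_cases h2 : E.pos (w * R.refl j) i <;> simp [h1, h2] <;> ring
    have hact : R.act (wordProd s (x ++ [i])) v =
        R.act (wordProd s x) v - R.coroot (R.simple i) v * β := by
      rw [wordProd_append, wordProd_singleton, R.act_mul, R.act_reflVec]
    rw [hsplit, ← ih, hact, wordSum_append_singleton E, ← hβ]
    by_cases hw : E.pos w i
    -- If `i` is an ascent of `w`, the only cover of `w` with a descent at `i` is `w s_i`.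
    · rw [if_pos hw, Finset.sum_eq_single (R.simple i), R.refl_simple, if_pos, E.mul_mul_self]
      · ring
      · exact ⟨E.length_mul_of_pos hw, by rwa [E.pos_mul_self, not_not]⟩
      · intro j _ hj
        refine if_neg fun h => hj (R.eq_simple i j ?_)
        exact mul_left_cancel (E.eq_of_pos_of_not_pos (R.isReflection_refl j) h.1 hw h.2)
      · simp
    · have hlen := E.length_mul_of_not_pos hw
      -- If `i` is a descent of `w`, permuting the positive roots by `s_i` turns the second sum into
      -- the formula for `w s_i` and the vector `s_i v`. The root `α_i`, absent on the left,
      -- contributes there with a negative sign; the extra term cancels it.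
      have h1 : (∑ j, if length s (w * R.refl j) = length s w + 1 ∧ ¬ E.pos (w * R.refl j) i then
          R.coroot j v * wordSum s R.weight x (w * R.refl j * s i) else 0) =
          (∑ j, if length s (w * s i * R.refl j) = length s (w * s i) + 1 then
            R.coroot j (R.reflVec i v) * wordSum s R.weight x (w * s i * R.refl j) else 0) +
          R.coroot (R.simple i) v * wordSum s R.weight x w := by
        have h2 : R.coroot (R.simple i) v * wordSum s R.weight x w =
            ∑ j, if j = R.simple i then R.coroot (R.simple i) v * wordSum s R.weight x w else 0 := by
          simp
        let e : J ≃ J := ⟨R.perm i, R.perm i, R.perm_perm i, R.perm_perm i⟩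
        rw [h2, ← Equiv.sum_comp e fun j =>
          if length s (w * s i * R.refl j) = length s (w * s i) + 1 then
            R.coroot j (R.reflVec i v) * wordSum s R.weight x (w * s i * R.refl j) else 0,
          ← Finset.sum_add_distrib]
        refine Finset.sum_congr rfl fun j _ => ?_
        change _ = (if length s (w * s i * R.refl (R.perm i j)) = length s (w * s i) + 1 then
            R.coroot (R.perm i j) (R.reflVec i v) *
              wordSum s R.weight x (w * s i * R.refl (R.perm i j)) else 0) + _
        by_cases hj : j = R.simple i
        · subst hj
          rw [R.perm_simple, R.refl_simple, E.mul_mul_self, if_neg (by omega), if_pos hlen.symm,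
            if_pos rfl, R.coroot_simple]
          ring
        · have e : w * s i * R.refl (R.perm i j) = w * R.refl j * s i := by
            rw [R.refl_perm]
            simp only [← mul_assoc, E.mul_mul_self]
          rw [if_neg hj, add_zero, e, R.coroot_perm i j v hj]
          refine if_congr ?_ rfl rfl
          rw [hlen]
          constructor
          · rintro ⟨h3, h4⟩
            have := E.length_mul_of_not_pos h4
            omega
          · intro h3
            by_cases h4 : E.pos (w * R.refl j) i
            · exfalso
              have h5 := E.length_mul_of_pos h4
              have ht := R.isReflection_refl j
              have h6 : w * R.refl j * R.refl j = w := by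
                rw [mul_assoc, E.reflection_mul_self ht, mul_one]
              have h7 := E.eq_of_pos_of_not_pos (g := w * R.refl j) ht
                (by rw [h6]; omega) h4 (by rwa [h6])
              exact hj (R.eq_simple i j (mul_left_cancel h7))
            · have := E.length_mul_of_not_pos h4
              exact ⟨by omega, h4⟩
      have h9 : R.act (w * s i) (R.reflVec i v) = R.act w v := by
        rw [← R.act_mul, E.mul_mul_self]
      rw [h1, ← ih, if_neg hw, h9]
      have h8 := R.act_reflVec (wordProd s x) i v
      rw [← hβ] at h8
      rw [h8]
      ring

/-- The combinatorial Schubert classes do not depend on the choice of words. -/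
theorem wordSum_congr [IsDomain A] {x y : List B} (h : wordProd s x = wordProd s y) (w : G) :
    wordSum s R.weight x w = wordSum s R.weight y w := by
  classical
  -- It is enough to compare any word with a reduced one, since the sum of a reduced word at its own
  -- element does not vanish.
  suffices ∀ {x y : List B}, length s (wordProd s y) = y.length → wordProd s x = wordProd s y →
      wordSum s R.weight x w = wordSum s R.weight y w by
    obtain ⟨z, hz, hp⟩ := E.exists_reduced (wordProd s y)
    rw [this (by rw [hp, hz]) (h.trans hp.symm), this (by rw [hp, hz]) hp.symm]
  intro x y hy h
  set g := wordProd s y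
  set a := wordSum s R.weight x g with ha
  set a' := wordSum s R.weight y g with ha'
  -- Downward induction on `ℓ(w)`. The combination is trivially zero at `w = g` and for `w` longer
  -- than both words; elsewhere Chevalley's formula, for a vector separating `w` and `g`, expresses
  -- it by longer elements. Its value at `w = 1` then gives `a = a'`.
  have main : ∀ m w, x.length + y.length < length s w + m →
      a' * wordSum s R.weight x w - a * wordSum s R.weight y w = 0 := by
    intro m
    induction m with
    | zero =>
      intro w hw
      rw [wordSum_eq_zero_of_length_lt _ (by omega), wordSum_eq_zero_of_length_lt _ (by omega)]
      ring
    | succ m ih =>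
      intro w hw
      by_cases hwg : w = g
      · rw [hwg, ← ha, ← ha']
        ring
      · obtain ⟨v, hv⟩ : ∃ v, R.act w v ≠ R.act g v := by
          by_contra hc
          push Not at hc
          exact hwg (R.act_separates _ _ hc)
        refine (mul_eq_zero.mp ?_).resolve_left (sub_ne_zero.mpr hv)
        have h1 := R.chevalley E x w v
        have h2 := R.chevalley E y w v
        rw [h] at h1
        calc (R.act w v - R.act g v) *
              (a' * wordSum s R.weight x w - a * wordSum s R.weight y w) =
            a' * ((R.act w v - R.act g v) * wordSum s R.weight x w) -
              a * ((R.act w v - R.act g v) * wordSum s R.weight y w) := by ring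
          _ = 0 := by
            rw [h1, h2, Finset.mul_sum, Finset.mul_sum, ← Finset.sum_sub_distrib]
            refine Finset.sum_eq_zero fun j _ => ?_
            split_ifs with hj
            · linear_combination R.coroot j v * ih (w * R.refl j) (by omega)
            · ring
  have h0 : ∀ w, a' * wordSum s R.weight x w - a * wordSum s R.weight y w = 0 := fun w =>
    main (x.length + y.length + 1) w (by omega)
  have h1 := h0 1
  rw [wordSum_one, wordSum_one, mul_one, mul_one, sub_eq_zero] at h1
  have h2 := h0 w
  rw [← h1, ← mul_sub] at h2
  exact sub_eq_zero.mp ((mul_eq_zero.mp h2).resolve_left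
    (wordSum_ne_zero E R.weight_ne_zero y hy))

end RootAction

end Folding

/-! ### Roots, reflections and the positive height functional on `U` -/

noncomputable section

namespace Folding

namespace FoldedRep

variable {k : Subring ℝ} {c₁ c₂ : k} {n : ℕ} {ι X Y : Type*}
  [AddCommGroup X] [AddCommGroup Y] {D : RootDatum ι X Y} {b : D.Base}
  (F : FoldedRep c₁ c₂ n D b)

theorem linearIndependent_root [Module.Free ℤ X] :
    LinearIndependent k fun i : b.support => F.root i := by
  have h : LinearIndependent ℤ fun i : b.support => D.root i := b.linearIndepOn_root
  exact (Module.Flat.linearIndependent_one_tmul (S := k) h).map' F.emb (LinearMap.ker_eq_bot.mpr F.emb_injective)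

theorem root_injective [Module.Free ℤ X] : Function.Injective F.root := by
  intro i j h
  have h1 := Module.Flat.tensorProduct_mk_injective (R := ℤ) (S := k) (M := X)
  exact D.root.injective (h1 (F.emb_injective h))

/-- The vector of `U` given by an element of the lattice. -/
def latticeVec : X →+ UMod c₁ c₂ n where
  toFun x := F.emb (1 ⊗ₜ x)
  map_zero' := by simp
  map_add' x y := by simp [TensorProduct.tmul_add]

theorem latticeVec_root (i : ι) : F.latticeVec (D.root i) = F.root i := rfl

theorem coroot_apply_root (i j : ι) : F.coroot i (F.root j) = ((D.pairing j i : ℤ) : k) :=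
  F.coroot_emb i (D.root j)

theorem refl_root (i j : ι) : F.refl i (F.root j) = F.root (D.reflectionPerm i j) := by
  rw [refl_apply, coroot_apply_root, ← latticeVec_root, ← latticeVec_root, ← latticeVec_root,
    D.root_reflectionPerm, RootPairing.reflection_apply_root, map_sub, map_zsmul]
  congr 1
  exact (Int.cast_smul_eq_zsmul k _ _)

theorem refl_refl (i : ι) : F.refl i * F.refl i = 1 :=
  LinearEquiv.ext fun u => Module.involutive_reflection (F.coroot_root i) u

theorem exists_root_of_mem {g : UMod c₁ c₂ n ≃ₗ[k] UMod c₁ c₂ n} (hg : g ∈ F.W) :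
    ∀ i, ∃ j, g (F.root i) = F.root j := by
  induction hg using Subgroup.closure_induction'' with
  | mem x hx =>
    obtain ⟨i, rfl⟩ := hx
    exact fun j => ⟨_, F.refl_root i j⟩
  | inv_mem x hx =>
    obtain ⟨i, rfl⟩ := hx
    intro j
    rw [inv_eq_of_mul_eq_one_left (F.refl_refl i)]
    exact ⟨_, F.refl_root i j⟩
  | one => exact fun i => ⟨i, rfl⟩
  | mul x y _ _ hx hy =>
    intro i
    obtain ⟨j, hj⟩ := hy i
    obtain ⟨l, hl⟩ := hx j
    exact ⟨l, by rw [LinearEquiv.mul_apply, hj, hl]⟩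

theorem tauForm_refl (i : ι) (u v : UMod c₁ c₂ n) :
    tauForm (F.refl i u) (F.refl i v) = tauForm u v := by
  have h1 := F.coroot_mul i u
  have h2 := F.coroot_mul i v
  have e : ∀ u v : UMod c₁ c₂ n, ∀ r : k, tauForm (u - r • v) = fun w =>
      tauForm u w - r * tauForm v w := by
    intro u v r
    funext w
    rw [sub_eq_add_neg, ← neg_smul, tauForm_add_left, tauForm_smul_left]
    ring
  rw [refl_apply, refl_apply, e]
  simp only [tauForm_comm c₁ c₂ n _ (v - _), e]
  rw [tauForm_comm c₁ c₂ n v u, tauForm_comm c₁ c₂ n v (F.root i),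
    tauForm_comm c₁ c₂ n (F.root i) u] at *
  have h3 : (2 : k) ≠ 0 := two_ne_zero
  apply mul_left_cancel₀ h3
  rw [tauForm_comm c₁ c₂ n u (F.root i)] at *
  linear_combination F.coroot i v * h1 + F.coroot i u * h2

theorem tauForm_apply_apply {g : UMod c₁ c₂ n ≃ₗ[k] UMod c₁ c₂ n} (hg : g ∈ F.W) :
    ∀ u v, tauForm (g u) (g v) = tauForm u v := by
  induction hg using Subgroup.closure_induction'' with
  | mem x hx =>
    obtain ⟨i, rfl⟩ := hx
    exact F.tauForm_refl i
  | inv_mem x hx =>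
    obtain ⟨i, rfl⟩ := hx
    rw [inv_eq_of_mul_eq_one_left (F.refl_refl i)]
    exact F.tauForm_refl i
  | one => exact fun _ _ => rfl
  | mul x y _ _ hx hy => exact fun u v => (hx _ _).trans (hy _ _)

theorem coroot_apply_apply {g : UMod c₁ c₂ n ≃ₗ[k] UMod c₁ c₂ n} (hg : g ∈ F.W) {i j : ι}
    (h : g (F.root i) = F.root j) (u : UMod c₁ c₂ n) : F.coroot j (g u) = F.coroot i u := by
  apply mul_right_cancel₀ (F.tauForm_root_ne_zero j)
  rw [F.coroot_mul, ← h, F.tauForm_apply_apply hg, F.tauForm_apply_apply hg, F.coroot_mul]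

theorem mul_refl {g : UMod c₁ c₂ n ≃ₗ[k] UMod c₁ c₂ n} (hg : g ∈ F.W) {i j : ι}
    (h : g (F.root i) = F.root j) : g * F.refl i = F.refl j * g := by
  ext1 u
  rw [LinearEquiv.mul_apply, LinearEquiv.mul_apply, refl_apply, refl_apply, map_sub, map_smul, h,
    F.coroot_apply_apply hg h]

/-! ### The positive roots of the characteristic polynomial and a positive functional -/

variable (c₁) in
/-- The positive root of `x² - c₁ x - 1`. -/
def posRoot : ℝ := (c₁ + √((c₁ : ℝ) ^ 2 + 4)) / 2

variable (c₁) in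
/-- The negative root of `x² - c₁ x - 1`. -/
def negRoot : ℝ := c₁ - posRoot c₁

variable (c₁) in
theorem posRoot_mul_self : posRoot c₁ * posRoot c₁ = c₁ * posRoot c₁ + 1 := by
  have := Real.mul_self_sqrt (show (0 : ℝ) ≤ (c₁ : ℝ) ^ 2 + 4 by positivity)
  unfold posRoot
  linear_combination this / 4

variable (c₁) in
theorem posRoot_pos : 0 < posRoot c₁ := by
  have h1 : |(c₁ : ℝ)| < √((c₁ : ℝ) ^ 2 + 4) := by
    rw [← Real.sqrt_sq_eq_abs]
    exact Real.sqrt_lt_sqrt (sq_nonneg _) (by linarith)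
  have := neg_abs_le (c₁ : ℝ)
  unfold posRoot
  linarith

variable (c₁) in
theorem posRoot_mul_negRoot : posRoot c₁ * negRoot c₁ = -1 := by
  have := posRoot_mul_self c₁
  unfold negRoot
  linear_combination -this

variable (c₁) in
theorem negRoot_neg : negRoot c₁ < 0 := by
  have h1 := posRoot_mul_negRoot c₁
  have h2 := posRoot_pos c₁
  by_contra h
  push Not at h
  nlinarith [mul_nonneg h2.le h]

/-- The sum of the positive coroots. -/
def corootSum : UMod c₁ c₂ n →ₗ[k] k := ∑ᶠ j : {j // b.IsPos j}, F.coroot j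

theorem tauOp_tauOp_eq (F : FoldedRep c₁ c₂ n D b) (i : ι) (u : UMod c₁ c₂ n) :
    tauOp c₁ c₂ n (tauOp c₁ c₂ n u) = c₁ • tauOp c₁ c₂ n u + u := by
  rw [tauOp_tauOp, show c₂ • u = (-1 : k) • u from congrArg (· • _) (F.c₂_eq_neg_one i), neg_smul,
    one_smul, sub_neg_eq_add]

/-- A functional on `U` on which `T` acts by the positive eigenvalue and which is positive
on the simple roots. -/
def heightFun : UMod c₁ c₂ n →ₗ[k] ℝ :=
  (Algebra.linearMap k ℝ ∘ₗ F.corootSum) ∘ₗ tauOp c₁ c₂ n -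
    negRoot c₁ • (Algebra.linearMap k ℝ ∘ₗ F.corootSum)

theorem heightFun_apply (u : UMod c₁ c₂ n) :
    F.heightFun u = (F.corootSum (tauOp c₁ c₂ n u) : ℝ) - negRoot c₁ * (F.corootSum u : ℝ) := rfl

/-- Since `(T - λ)(T - μ) = 0`, composing any functional with `T - μ` gives an eigenvector for `λ`.
The index `i` only serves to know `c₂ = -1`. -/
theorem heightFun_tauOp (i : ι) (u : UMod c₁ c₂ n) :
    F.heightFun (tauOp c₁ c₂ n u) = posRoot c₁ * F.heightFun u := by
  rw [heightFun_apply, heightFun_apply, F.tauOp_tauOp_eq i, map_add, map_smul]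
  have h := posRoot_mul_negRoot c₁
  have h' : posRoot c₁ = c₁ - negRoot c₁ := by unfold negRoot; ring
  rw [mul_sub, ← mul_assoc, h, h']
  push_cast [smul_eq_mul]
  ring

theorem mem_support_of_mem_rat [Module.Free ℤ X] {i : ι} (hi : i ∈ F.rat) : i ∈ b.support := by
  have h : F.root i ∈ (fun i => F.emb (1 ⊗ₜ D.root i)) '' (b.support : Set ι) := by
    rw [F.partition]
    exact .inl (.inr ⟨i, hi, rfl⟩)
  obtain ⟨j, hj, he⟩ := h
  rwa [← F.root_injective he]

theorem opp_mem_support {i : ι} (hi : i ∈ F.rat) : F.opp i hi ∈ b.support :=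
  (F.exists_opp i hi).choose_spec.1

theorem fixed_or_rat_or_opp [Module.Free ℤ X] {i : ι} (hi : i ∈ b.support) :
    i ∈ F.fixed ∨ i ∈ F.rat ∨ ∃ j, ∃ hj : j ∈ F.rat, i = F.opp j hj := by
  have h : F.root i ∈ (fun i => F.emb (1 ⊗ₜ D.root i)) '' (b.support : Set ι) := ⟨i, hi, rfl⟩
  rw [F.partition] at h
  rcases h with (⟨-, h⟩ | ⟨j, hj, h⟩) | ⟨_, ⟨j, hj, rfl⟩, h⟩
  · exact .inl ⟨hi, h⟩
  · rw [← F.root_injective h]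
    exact .inr (.inl hj)
  · exact .inr (.inr ⟨j, hj, F.root_injective (h.symm.trans (F.root_opp j hj).symm)⟩)

theorem not_mem_rat_of_mem_fixed {i : ι} (hi : i ∈ F.fixed) : i ∉ F.rat := fun h =>
  F.disjoint_fixed_rat i h hi.2

theorem refl_root_self (i : ι) : F.refl i (F.root i) = -F.root i := by
  rw [refl_apply, F.coroot_root, two_smul]
  abel

theorem _root_.Folding.exists_wordProd_eq {B G : Type*} [Group G] {s : B → G}
    (hs : ∀ i, s i * s i = 1) {g : G} (hg : g ∈ Subgroup.closure (Set.range s)) :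
    ∃ x, wordProd s x = g := by
  induction hg using Subgroup.closure_induction'' with
  | mem x hx =>
    obtain ⟨i, rfl⟩ := hx
    exact ⟨[i], by simp⟩
  | inv_mem x hx =>
    obtain ⟨i, rfl⟩ := hx
    exact ⟨[i], by rw [wordProd_singleton, inv_eq_of_mul_eq_one_left (hs i)]⟩
  | one => exact ⟨[], rfl⟩
  | mul x y _ _ hx hy =>
    obtain ⟨a, rfl⟩ := hx
    obtain ⟨c, rfl⟩ := hy
    exact ⟨a ++ c, by simp⟩

theorem s_mul_self (i : b.support) : F.s i * F.s i = 1 := Subtype.ext (F.refl_refl i)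

section Positive

variable [Finite ι]

variable [D.IsReduced]

open Classical in
/-- The permutation of the positive roots other than `α_i` by the simple reflection `s_i`, extended
to `α_i` by fixing it. -/
def posPerm (b : D.Base) (i : b.support) (j : {j // b.IsPos j}) : {j // b.IsPos j} :=
  if h : j.1 = i then j else ⟨D.reflectionPerm i j, j.2.reflectionPerm i.2 h⟩

theorem posPerm_self (i : b.support) (h : b.IsPos i) : posPerm b i ⟨i, h⟩ = ⟨i, h⟩ :=
  dif_pos rfl

theorem posPerm_of_ne {i : b.support} {j : {j // b.IsPos j}} (h : j.1 ≠ i) :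
    posPerm b i j = ⟨D.reflectionPerm i j, j.2.reflectionPerm i.2 h⟩ :=
  dif_neg h

theorem posPerm_posPerm (i : b.support) (j : {j // b.IsPos j}) :
    posPerm b i (posPerm b i j) = j := by
  by_cases h : j.1 = i
  · rw [posPerm, dif_pos (by rw [posPerm, dif_pos h, h]), posPerm, dif_pos h]
  · rw [posPerm_of_ne h, posPerm_of_ne]
    · simp
    · intro h1
      have h2 : b.IsPos (D.reflectionPerm i j) := j.2.reflectionPerm i.2 h
      have h3 : j.1 = D.reflectionPerm i i := by
        conv_rhs => arg 2; rw [← h1]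
        simp
      have h4 := j.2
      rw [h3] at h4
      have h5 := (RootPairing.Base.IsPos.neg_iff_not b i.1).mp h4
      exact h5 (RootPairing.Base.isPos_of_mem_support i.2)

/-- The reflection `s_i` permutes the other positive roots and negates the pairing of `α_i` with
their coroots, so these cancel and only `⟨α_i, α_i^∨⟩` is left. -/
theorem corootSum_root (i : b.support) : F.corootSum (F.root i) = 2 := by
  classical
  have := Fintype.ofFinite {j // b.IsPos j}
  set e : {j // b.IsPos j} := ⟨i, RootPairing.Base.isPos_of_mem_support i.2⟩ with he
  have h1 : F.corootSum (F.root i) = ((∑ j : {j // b.IsPos j}, D.pairing i j : ℤ) : k) := by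
    rw [corootSum, finsum_eq_sum_of_fintype, LinearMap.sum_apply, Int.cast_sum]
    exact Finset.sum_congr rfl fun j _ => F.coroot_apply_root _ _
  have h2 : ∑ j ∈ Finset.univ.erase e, D.pairing i j = -∑ j ∈ Finset.univ.erase e, D.pairing i j := by
    rw [← Finset.sum_neg_distrib]
    refine Finset.sum_bij' (fun j _ => posPerm b i j) (fun j _ => posPerm b i j) ?_ ?_ ?_ ?_ ?_
    · intro j hj
      simp only [Finset.mem_erase, Finset.mem_univ, and_true] at hj ⊢
      intro h
      apply hj
      rw [← posPerm_posPerm i j, h, he, posPerm_self]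
    · intro j hj
      simp only [Finset.mem_erase, Finset.mem_univ, and_true] at hj ⊢
      intro h
      apply hj
      rw [← posPerm_posPerm i j, h, he, posPerm_self]
    · exact fun j _ => posPerm_posPerm i j
    · exact fun j _ => posPerm_posPerm i j
    · intro j hj
      have hj' : j.1 ≠ i := fun h => Finset.ne_of_mem_erase hj (Subtype.ext h)
      rw [posPerm_of_ne hj']
      change _ = -D.pairing i (D.reflectionPerm i j)
      rw [D.pairing_reflectionPerm, D.pairing_reflectionPerm_self_left, neg_neg]
  rw [h1, ← Finset.add_sum_erase _ _ (Finset.mem_univ e), show D.pairing i e = 2 from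
    D.pairing_same i]
  have h3 : ∑ j ∈ Finset.univ.erase e, D.pairing i j = 0 := by omega
  rw [h3]
  norm_num

variable [Module.Free ℤ X]

/-- If `α` is simple and `Tα` is simple too, which includes `Tα = α`, then `h(α) = 2 - 2μ > 0`. The
roots of `T(Δ_rat)` follow from `h ∘ T = λ h`. -/
theorem heightFun_simple_pos {i : ι} (hi : i ∈ b.support) : 0 < F.heightFun (F.root i) := by
  have h0 := negRoot_neg c₁
  have hrat : ∀ i, i ∈ F.rat → 0 < F.heightFun (F.root i) := by
    intro i hi
    have h1 := F.corootSum_root ⟨i, F.mem_support_of_mem_rat hi⟩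
    have h2 := F.corootSum_root ⟨_, F.opp_mem_support hi⟩
    rw [F.root_opp] at h2
    rw [heightFun_apply, h1, h2, show ((2 : k) : ℝ) = 2 from rfl]
    linarith
  rcases F.fixed_or_rat_or_opp hi with h | h | ⟨j, hj, rfl⟩
  · have h1 := F.corootSum_root ⟨i, hi⟩
    rw [heightFun_apply, h.2, h1, show ((2 : k) : ℝ) = 2 from rfl]
    linarith
  · exact hrat i h
  · rw [F.root_opp, F.heightFun_tauOp j]
    exact mul_pos (posRoot_pos c₁) (hrat j hj)

theorem heightFun_pos_of_isPos {i : ι} (hi : b.IsPos i) : 0 < F.heightFun (F.root i) := by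
  refine hi.induction_on_add (p := fun i => 0 < F.heightFun (F.root i)) ?_ ?_
  · exact fun j hj => F.heightFun_simple_pos hj
  · intro i j l h hi hj
    have : F.root l = F.root i + F.root j := by
      rw [← latticeVec_root, h, map_add, latticeVec_root, latticeVec_root]
    change 0 < F.heightFun (F.root l)
    rw [this, map_add]
    exact add_pos hi (F.heightFun_simple_pos hj)

theorem heightFun_neg_of_not_isPos {i : ι} (hi : ¬ b.IsPos i) : F.heightFun (F.root i) < 0 := by
  have h1 := F.heightFun_pos_of_isPos ((RootPairing.Base.IsPos.neg_iff_not b i).mpr hi)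
  have : F.root (D.reflectionPerm i i) = -F.root i := by
    rw [← F.refl_root, refl_apply, F.coroot_root, two_smul]
    abel
  change 0 < F.heightFun (F.root (D.reflectionPerm i i)) at h1
  rw [this, map_neg] at h1
  linarith

theorem heightFun_pos_iff {i : ι} : 0 < F.heightFun (F.root i) ↔ b.IsPos i :=
  ⟨fun h => by_contra fun hi => (F.heightFun_neg_of_not_isPos hi).not_gt h,
    F.heightFun_pos_of_isPos⟩

theorem heightFun_ne_zero (i : ι) : F.heightFun (F.root i) ≠ 0 := by
  by_cases h : b.IsPos i
  · exact (F.heightFun_pos_of_isPos h).ne'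
  · exact (F.heightFun_neg_of_not_isPos h).ne

theorem heightFun_neg_iff {i : ι} : ¬ 0 < F.heightFun (F.root i) ↔ F.heightFun (F.root i) < 0 := by
  rw [not_lt]
  exact ⟨fun h => lt_of_le_of_ne h (F.heightFun_ne_zero i), le_of_lt⟩

/-- A simple reflection makes no positive root negative except its own root. -/
theorem eq_of_refl_neg {i j : ι} (hi : i ∈ b.support) (hj : 0 < F.heightFun (F.root j))
    (h : ¬ 0 < F.heightFun (F.refl i (F.root j))) : j = i := by
  by_contra hne
  rw [heightFun_pos_iff] at hj
  rw [F.refl_root, heightFun_pos_iff] at h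
  exact h (hj.reflectionPerm hi hne)

/-- The sign of the image of a simple root. -/
def posW (g : F.W) (i : b.support) : Prop := 0 < F.heightFun (g.1 (F.root i))

-- Every root is obtained from simple ones by simple reflections and sign changes, and its
-- reflection is conjugated accordingly.
omit [Module.Free ℤ X] in
theorem mem_closure_s (g : F.W) : g ∈ Subgroup.closure (Set.range F.s) := by
  have key : ∀ i, (⟨F.refl i, Subgroup.subset_closure ⟨i, rfl⟩⟩ : F.W) ∈
      Subgroup.closure (Set.range F.s) := by
    intro i
    refine b.induction_reflect i (p := fun i => (⟨F.refl i, Subgroup.subset_closure ⟨i, rfl⟩⟩ : F.W) ∈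
      Subgroup.closure (Set.range F.s)) ?_ ?_ ?_
    · intro i hi
      have hmem : F.refl i ∈ F.W := Subgroup.subset_closure ⟨i, rfl⟩
      have h1 := F.mul_refl hmem (F.refl_root i i)
      have h2 : F.refl (D.reflectionPerm i i) = F.refl i := (mul_right_cancel h1).symm
      simpa only [h2] using hi
    · exact fun i hi => Subgroup.subset_closure ⟨⟨i, hi⟩, rfl⟩
    · intro i j hi hj
      have hmem : F.refl j ∈ F.W := Subgroup.subset_closure ⟨j, rfl⟩
      have h1 := F.mul_refl hmem (F.refl_root j i)
      have hs : F.s ⟨j, hj⟩ ∈ Subgroup.closure (Set.range F.s) :=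
        Subgroup.subset_closure ⟨⟨j, hj⟩, rfl⟩
      have h2 : (⟨F.refl (D.reflectionPerm j i), Subgroup.subset_closure ⟨_, rfl⟩⟩ : F.W) =
          F.s ⟨j, hj⟩ * ⟨F.refl i, Subgroup.subset_closure ⟨i, rfl⟩⟩ * F.s ⟨j, hj⟩ := by
        apply Subtype.ext
        change F.refl (D.reflectionPerm j i) = F.refl j * F.refl i * F.refl j
        rw [h1, mul_assoc, F.refl_refl, mul_one]
      rw [h2]
      exact Subgroup.mul_mem _ (Subgroup.mul_mem _ hs hi) hs
  obtain ⟨g, hg⟩ := g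
  induction hg using Subgroup.closure_induction with
  | mem x hx =>
    obtain ⟨i, rfl⟩ := hx
    exact key i
  | one => exact Subgroup.one_mem _
  | mul x y hx hy h1 h2 => exact Subgroup.mul_mem _ h1 h2
  | inv x hx h => exact Subgroup.inv_mem _ h

/-- The Weyl group satisfies the exchange condition. -/
def exchangeW : ExchangeSystem F.s where
  pos := F.posW
  exists_word g := exists_wordProd_eq F.s_mul_self (F.mem_closure_s g)
  mul_self := F.s_mul_self
  pos_one i := F.heightFun_simple_pos i.2
  pos_mul_self g i := by
    obtain ⟨j, hj⟩ := F.exists_root_of_mem g.2 i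
    change 0 < F.heightFun (g.1 (F.refl i (F.root i))) ↔ ¬ 0 < F.heightFun (g.1 (F.root i))
    rw [F.refl_root_self, map_neg, map_neg, hj, F.heightFun_neg_iff]
    exact neg_pos
  exch g i j hg hn := by
    obtain ⟨m, hm⟩ := F.exists_root_of_mem g.2 j
    have h1 : m = i := by
      refine F.eq_of_refl_neg i.2 ?_ ?_
      · rwa [← hm]
      · rw [← hm]
        exact hn
    exact Subtype.ext (F.mul_refl g.2 (hm.trans (congrArg F.root h1))).symm

end Positive

end FoldedRep

end Folding

end

/-! ### Schubert classes of `W` from arbitrary words; the exchange condition for `W_τ` -/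

noncomputable section

namespace Folding

namespace ExchangeSystem

variable {B G A : Type*} [Group G] {s : B → G} (E : ExchangeSystem s)
include E

theorem eq_one_of_forall_pos {g : G} (h : ∀ i, E.pos g i) : g = 1 := by
  obtain ⟨x, hx, rfl⟩ := E.exists_reduced g
  rcases List.eq_nil_or_concat' x with rfl | ⟨y, i, rfl⟩
  · rfl
  · have h1 := E.length_lt_of_pos (h i)
    have h2 := length_wordProd_le (s := s) y
    simp only [wordProd_append, wordProd_singleton, E.mul_mul_self, List.length_append,
      List.length_singleton] at h1 hx
    omega

theorem pos_of_reduced_append {x : List B} {i : B}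
    (hx : length s (wordProd s (x ++ [i])) = (x ++ [i]).length) :
    E.pos (wordProd s x) i ∧ length s (wordProd s x) = x.length := by
  rw [wordProd_append, wordProd_singleton, List.length_append, List.length_singleton] at hx
  have h1 := E.length_mul_le (wordProd s x) i
  have h2 := length_wordProd_le (s := s) x
  exact ⟨E.length_lt_iff.mp (by omega), by omega⟩

theorem forall_mem_weightedWord {f : G → B → A} {x : List B}
    (hx : length s (wordProd s x) = x.length) {q : A → Prop} (hq : ∀ g i, E.pos g i → q (f g i)) :
    ∀ p ∈ weightedWord s f 1 x, q p.2 := by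
  induction x using List.reverseRecOn with
  | nil => simp [weightedWord]
  | append_singleton x i ih =>
    obtain ⟨h1, h2⟩ := E.pos_of_reduced_append hx
    intro p hp
    rw [weightedWord_append, List.mem_append] at hp
    rcases hp with hp | hp
    · exact ih h2 p hp
    · simp only [weightedWord, List.mem_singleton, one_mul] at hp
      rw [hp]
      exact hq _ _ h1

end ExchangeSystem

theorem symmetricAlgebra_ι_injective {R M : Type*} [CommRing R] [AddCommGroup M] [Module R M]
    [Module.Free R M] : Function.Injective (SymmetricAlgebra.ι R M) := by
  intro x y h
  have ⟨⟨_, B⟩⟩ := ‹Module.Free R M›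
  refine B.ext_elem fun i => ?_
  have := congrArg (SymmetricAlgebra.lift (B.coord i)) h
  simpa using this

theorem map_weightedWord {B G A A' : Type*} [Group G] (s : B → G) (f : G → B → A) (φ : A → A')
    (g : G) (x : List B) :
    (weightedWord s f g x).map (Prod.map id φ) = weightedWord s (fun g i => φ (f g i)) g x := by
  induction x generalizing g with
  | nil => rfl
  | cons i x ih => simp [weightedWord, ih]

namespace FoldedRep

variable {k : Subring ℝ} {c₁ c₂ : k} {n : ℕ} {ι X Y : Type*}
  [AddCommGroup X] [AddCommGroup Y] {D : RootDatum ι X Y} {b : D.Base}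
  (F : FoldedRep c₁ c₂ n D b)

instance [Module.Free ℤ X] : Module.Free k F.ULat :=
  Module.Free.of_equiv (LinearEquiv.ofInjective F.emb F.emb_injective)

/-- The reflection with index `i`, as an element of the Weyl group. -/
def reflW (i : ι) : F.W := ⟨F.refl i, Subgroup.subset_closure ⟨i, rfl⟩⟩

section Reduced

variable [Finite ι] [D.IsReduced]

theorem isReflection_reflW {i : ι} (hi : b.IsPos i) : IsReflection F.s (F.reflW i) := by
  refine hi.induction_on_reflect (p := fun i => IsReflection F.s (F.reflW i)) ?_ ?_
  · exact fun i hi => isReflection_gen (s := F.s) ⟨i, hi⟩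
  · intro i j h hj
    have h1 := F.mul_refl (F.reflW j).2 (F.refl_root j i)
    have h2 : F.reflW (D.reflectionPerm j i) = F.s ⟨j, hj⟩ * F.reflW i * (F.s ⟨j, hj⟩)⁻¹ :=
      eq_mul_inv_of_mul_eq (Subtype.ext h1.symm)
    change IsReflection F.s (F.reflW (D.reflectionPerm j i))
    rw [h2]
    exact h.conj _

variable [Module.Free ℤ X]

/-- The Weyl group acts on the symmetric algebra. -/
def rootAction : RootAction F.s (SymmetricAlgebra k F.ULat) F.ULat {j // b.IsPos j} where
  refl j := F.reflW j
  simple i := ⟨i, RootPairing.Base.isPos_of_mem_support i.2⟩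
  perm := posPerm b
  coroot j v := algebraMap k _ (F.coroot j v)
  reflVec i v := ⟨F.refl i v, F.W_ULat _ (F.s i).2 _ v.2⟩
  act g v := SymmetricAlgebra.ι k F.ULat ⟨g.1 v, F.W_ULat _ g.2 _ v.2⟩
  weight := rootWeight F.W_ULat F.simpleRoot
  isReflection_refl j := F.isReflection_reflW j.2
  refl_simple _ := rfl
  eq_simple i j h := by
    apply Subtype.ext
    refine F.eq_of_refl_neg i.2 (F.heightFun_pos_of_isPos j.2) ?_
    rw [← show F.refl j = F.refl i from congrArg Subtype.val h, F.refl_root_self, map_neg]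
    have := F.heightFun_pos_of_isPos j.2
    linarith
  perm_perm := posPerm_posPerm
  perm_simple i := posPerm_self i _
  refl_perm i j := by
    by_cases h : j.1 = i
    · obtain ⟨j, hj⟩ := j
      obtain rfl : j = i := h
      rw [posPerm_self]
      exact (F.exchangeW.mul_mul_self _ i).symm
    · rw [posPerm_of_ne h]
      have h1 : F.refl i * F.refl j = F.refl (D.reflectionPerm i j) * F.refl i :=
        F.mul_refl (F.reflW i).2 (F.refl_root i j)
      apply Subtype.ext
      change F.refl (D.reflectionPerm i j) = F.refl i * F.refl j * F.refl i
      rw [h1, mul_assoc, F.refl_refl, mul_one]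
  coroot_perm i j v h := by
    rw [posPerm_of_ne fun h' => h (Subtype.ext h')]
    exact congrArg _ (F.coroot_apply_apply (F.reflW i).2 (F.refl_root i j) v)
  coroot_simple i v := by
    rw [← map_neg]
    congr 1
    change F.coroot i (F.refl i v) = _
    rw [refl_apply, map_sub, map_smul, F.coroot_root, smul_eq_mul]
    ring
  act_mul _ _ _ := rfl
  act_reflVec g i v := by
    have : (⟨g.1 (F.refl i v), F.W_ULat _ g.2 _ (F.W_ULat _ (F.s i).2 _ v.2)⟩ : F.ULat) =
        ⟨g.1 v, F.W_ULat _ g.2 _ v.2⟩ -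
          F.coroot i v • ⟨g.1 (F.root i), F.W_ULat _ g.2 _ (F.simpleRoot i).2⟩ := by
      apply Subtype.ext
      change g.1 (F.refl i v) = g.1 v - F.coroot i v • g.1 (F.root i)
      rw [refl_apply, map_sub, map_smul]
    change SymmetricAlgebra.ι k F.ULat ⟨g.1 (F.refl i v), _⟩ = _
    rw [this, map_sub, map_smul, Algebra.smul_def]
    rfl
  -- Elements that agree on the roots differ by one that fixes every simple root. It has no descent,
  -- so it is trivial, on all of `U` and not just on `U_Λ`.
  act_separates g h H := by
    have h1 : ∀ i, g.1 (F.root i) = h.1 (F.root i) := fun i =>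
      congrArg Subtype.val (symmetricAlgebra_ι_injective (H ⟨F.root i, ⟨_, rfl⟩⟩))
    rw [← inv_mul_eq_one]
    refine F.exchangeW.eq_one_of_forall_pos fun i => ?_
    change 0 < F.heightFun ((g⁻¹ * h).1 (F.root i))
    have h2 : (g⁻¹ * h).1 (F.root i) = F.root i := by
      change g.1.symm (h.1 (F.root i)) = _
      rw [← h1]
      exact g.1.symm_apply_apply _
    rw [h2]
    exact F.heightFun_simple_pos i.2
  weight_ne_zero g i := by
    rw [rootWeight, ← map_zero (SymmetricAlgebra.ι k F.ULat)]
    refine symmetricAlgebra_ι_injective.ne fun h => ?_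
    obtain ⟨j, hj⟩ := F.exists_root_of_mem g.2 i
    have h1 : g.1 (F.root i) = 0 := congrArg Subtype.val h
    have h2 := F.heightFun_ne_zero j
    rw [← hj, h1, map_zero] at h2
    exact h2 rfl

/-- The weights of the letters in the definition of Schubert classes. -/
abbrev weightW : F.W → b.support → SymmetricAlgebra k F.ULat :=
  rootWeight F.W_ULat F.simpleRoot

theorem wordSum_congr {x y : List b.support} (h : wordProd F.s x = wordProd F.s y) (w : F.W) :
    wordSum F.s F.weightW x w = wordSum F.s F.weightW y w := by
  have := Fintype.ofFinite {j // b.IsPos j}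
  exact F.rootAction.wordSum_congr F.exchangeW h w

/-- A Schubert class can be computed from any word. -/
theorem schubert_eq (w : F.W) (x : List b.support) :
    F.schubert w (wordProd F.s x) = wordSum F.s F.weightW x w := by
  classical
  rw [schubert, Folding.schubert]
  split_ifs with h
  · rw [schubertSum_eq_subSum]
    exact F.wordSum_congr (Classical.epsilon_spec (p := fun y => wordProd F.s y = wordProd F.s x)
      ⟨x, rfl⟩) w
  -- The class vanishes by definition here. So does the sum: over a reduced word of the same
  -- element, a nonzero sum would exhibit `w` as a subword, hence as a smaller element.
  · obtain ⟨y, hy, hp⟩ := F.exchangeW.exists_reduced (wordProd F.s x)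
    rw [← F.wordSum_congr hp]
    by_contra hc
    obtain ⟨l, hl, -, hlp⟩ := exists_sublist_of_subSum_ne_zero (Ne.symm hc)
    obtain ⟨z, hz, hlz⟩ := sublist_of_sublist_weightedWord _ _ hl
    apply h
    rw [← hp, ← hlp, hlz]
    exact F.exchangeW.le_of_sublist (by rw [hp, hy]) hz

/-- Over a reduced word all weights are images of positive roots, so no cancellation occurs, and the
subword property provides at least one term. -/
theorem map_wordSum_pos (φ : SymmetricAlgebra k F.ULat →+* ℝ)
    (hφ : ∀ g i, F.posW g i → 0 < φ (F.weightW g i)) {w : F.W} {x : List b.support}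
    (h : BruhatLE F.s w (wordProd F.s x)) : 0 < φ (wordSum F.s F.weightW x w) := by
  obtain ⟨y, hy, hp⟩ := F.exchangeW.exists_reduced (wordProd F.s x)
  rw [← F.wordSum_congr hp, wordSum, map_subSum, map_weightedWord]
  rw [← hp] at h
  obtain ⟨z, hz, hl, hzp⟩ := F.exchangeW.exists_sublist_of_le h
  obtain ⟨l, hl', hlz⟩ := exists_sublist_weightedWord F.s (fun g i => φ (F.weightW g i)) (g := 1) hz
  have hpos := F.exchangeW.forall_mem_weightedWord (f := fun g i => φ (F.weightW g i)) (x := y)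
    (by rw [hp, hy]) (q := (0 < ·)) hφ
  have := subSum_pos hpos hl'
  rw [hlz] at this
  have h2 : l.length = z.length := by simpa using congrArg List.length hlz
  rw [h2, hl] at this
  change 0 < subSum _ _ (wordProd F.s z) at this
  rwa [hzp] at this

end Reduced

/-! ### The embedding of the folded group -/

theorem exists_embedding_eq (v : F.WTau) : ∃ h : tauCommuting c₁ c₂ n,
    (F.embedding v).1 = h.1 ∧ restrictTau c₁ c₂ n h = v.1 := by
  refine ⟨(((Subgroup.closure (Set.range F.gen)).equivMapOfInjective _
      (restrictTau_injective c₁ c₂ n F.disc_isUnit)).symm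
      (MulEquiv.subgroupCongr F.map_closure_gen.symm v)).1, rfl, ?_⟩
  rw [← Subgroup.coe_equivMapOfInjective_apply (Subgroup.closure (Set.range F.gen)) _
      (restrictTau_injective c₁ c₂ n F.disc_isUnit), MulEquiv.apply_symm_apply]
  rfl

theorem embedding_injective : Function.Injective F.embedding := by
  intro v v' h
  obtain ⟨g, hg, hv⟩ := F.exists_embedding_eq v
  obtain ⟨g', hg', hv'⟩ := F.exists_embedding_eq v'
  have : g = g' := Subtype.ext (by rw [← hg, ← hg', h])
  exact Subtype.ext (by rw [← hv, ← hv', this])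

theorem embedding_tauOp (v : F.WTau) (u : UMod c₁ c₂ n) :
    (F.embedding v).1 (tauOp c₁ c₂ n u) = tauOp c₁ c₂ n ((F.embedding v).1 u) := by
  obtain ⟨g, hg, -⟩ := F.exists_embedding_eq v
  rw [hg]
  exact g.2 u

theorem apply_proj (v : F.WTau) (u : UMod c₁ c₂ n) :
    v.1 (proj c₁ c₂ n u) = proj c₁ c₂ n ((F.embedding v).1 u) := by
  obtain ⟨g, hg, hv⟩ := F.exists_embedding_eq v
  rw [hg, ← hv]
  exact restrictTau_proj c₁ c₂ n g u

/-- This is how the weights of a block become `β` and `τ β`. -/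
theorem _root_.Folding.proj_tauOp (u : UMod c₁ c₂ n) :
    proj c₁ c₂ n (tauOp c₁ c₂ n u) = tau c₁ c₂ • proj c₁ c₂ n u := by
  apply Subtype.ext
  have h := Module.End.mem_eigenspace_iff.mp (proj c₁ c₂ n u).2
  rw [Submodule.coe_smul, ← h]
  simp only [proj, eigenProj, LinearMap.coe_mk, AddHom.coe_mk, Submodule.coe_smul, map_smul,
    map_sub, LinearMap.baseChange_tmul]

/-! ### Orthogonality -/

/-- The `L`-valued product of `α` and `Tα` is `τ` times the `L`-valued square of `α`; rationality of
`α` makes this a `k`-multiple of `τ`, which has no coefficient of `1`. -/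
theorem tauForm_root_opp {i : ι} (hi : i ∈ F.rat) :
    tauForm (F.root i) (F.root (F.opp i hi)) = 0 := by
  obtain ⟨-, q, hq⟩ := F.isTauRational i hi
  change lDot (F.root i) (F.root i) = _ at hq
  rw [F.root_opp, tauForm_tauOp, tauForm, lDot_tauOp_left, hq, Algebra.algebraMap_eq_smul_one,
    mul_smul_comm, mul_one, map_smul]
  exact mul_zero q

theorem tauForm_opp_opp {i : ι} (hi : i ∈ F.rat) :
    tauForm (F.root (F.opp i hi)) (F.root (F.opp i hi)) = tauForm (F.root i) (F.root i) := by
  have h0 := F.tauForm_root_opp hi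
  rw [F.root_opp] at h0 ⊢
  rw [tauForm_tauOp, tauOp_tauOp_root, tauForm_add_left, tauForm_smul_left, tauForm_comm, h0]
  ring

theorem coroot_eq_zero_of_tauForm {i : ι} {u : UMod c₁ c₂ n} (h : tauForm (F.root i) u = 0) :
    F.coroot i u = 0 := by
  have h1 := F.coroot_mul i u
  rw [h, mul_zero] at h1
  exact (mul_eq_zero.mp h1).resolve_right (F.tauForm_root_ne_zero i)

theorem refl_eq_self_of_tauForm {i : ι} {u : UMod c₁ c₂ n} (h : tauForm (F.root i) u = 0) :
    F.refl i u = u := by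
  rw [refl_apply, F.coroot_eq_zero_of_tauForm h, zero_smul, sub_zero]

theorem refl_comm_of_tauForm {i j : ι} (h : tauForm (F.root i) (F.root j) = 0) :
    F.refl i * F.refl j = F.refl j * F.refl i :=
  F.mul_refl (F.reflW i).2 (F.refl_eq_self_of_tauForm h)

theorem orbitRefl_of_rat {i : ι} (hi : i ∈ F.rat) :
    F.orbitRefl i = F.refl i * F.refl (F.opp i hi) := dif_pos hi

theorem orbitRefl_of_not_rat {i : ι} (hi : i ∉ F.rat) : F.orbitRefl i = F.refl i := dif_neg hi

theorem orbitRefl_root (i : ι) : F.orbitRefl i (F.root i) = -F.root i := by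
  by_cases hi : i ∈ F.rat
  · rw [F.orbitRefl_of_rat hi, LinearEquiv.mul_apply,
      F.refl_eq_self_of_tauForm (i := F.opp i hi) (u := F.root i)
        (by rw [tauForm_comm, F.tauForm_root_opp]), F.refl_root_self]
  · rw [F.orbitRefl_of_not_rat hi, F.refl_root_self]

theorem orbitRefl_mul_self (i : ι) : F.orbitRefl i * F.orbitRefl i = 1 := by
  by_cases hi : i ∈ F.rat
  · rw [F.orbitRefl_of_rat hi]
    nth_rw 2 [F.refl_comm_of_tauForm (F.tauForm_root_opp hi)]
    rw [mul_assoc, ← mul_assoc (F.refl (F.opp i hi)), F.refl_refl, one_mul, F.refl_refl]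
  · rw [F.orbitRefl_of_not_rat hi, F.refl_refl]

theorem sTau_mul_self (i : F.FoldedIndex) : F.sTau i * F.sTau i = 1 := by
  apply F.embedding_injective
  apply Subtype.ext
  rw [map_mul, map_one]
  change (F.embedding (F.sTau i)).1 * (F.embedding (F.sTau i)).1 = 1
  rw [F.embedding_sTau, F.orbitRefl_mul_self]

theorem mem_closure_sTau (v : F.WTau) : v ∈ Subgroup.closure (Set.range F.sTau) := by
  obtain ⟨v, hv⟩ := v
  induction hv using Subgroup.closure_induction with
  | mem x hx =>
    obtain ⟨i, rfl⟩ := hx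
    exact Subgroup.subset_closure ⟨i, rfl⟩
  | one => exact Subgroup.one_mem _
  | mul x y hx hy h1 h2 => exact Subgroup.mul_mem _ h1 h2
  | inv x hx h => exact Subgroup.inv_mem _ h

section Reduced

variable [Finite ι] [D.IsReduced] [Module.Free ℤ X]

omit [Finite ι] [D.IsReduced] in
theorem index_mem_support {i : ι} (hi : i ∈ F.fixed ∪ F.rat) : i ∈ b.support :=
  hi.elim And.left F.mem_support_of_mem_rat

/-- The exchange condition for `W_τ`. A positive root made negative by a block is one of the simple
roots of the block, and as `ι(v)` commutes with `T` it carries the block of `j` to the block of `i`.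
-/
theorem orbitRefl_mul_eq {v : F.WTau} {i j : ι} (hi : i ∈ F.fixed ∪ F.rat)
    (hj : j ∈ F.fixed ∪ F.rat) (h1 : 0 < F.heightFun ((F.embedding v).1 (F.root j)))
    (h2 : ¬ 0 < F.heightFun (F.orbitRefl i ((F.embedding v).1 (F.root j)))) :
    F.orbitRefl i * (F.embedding v).1 = (F.embedding v).1 * F.orbitRefl j := by
  have hT := F.embedding_tauOp v
  have hW := (F.embedding v).2
  set g := (F.embedding v).1
  obtain ⟨m, hm⟩ := F.exists_root_of_mem hW j
  rw [hm] at h1 h2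
  by_cases hir : i ∈ F.rat
  · rw [F.orbitRefl_of_rat hir, LinearEquiv.mul_apply] at h2
    have hio := F.tauForm_root_opp hir
    have hcase : m = i ∨ m = F.opp i hir := by
      by_cases h3 : 0 < F.heightFun (F.refl (F.opp i hir) (F.root m))
      · left
        rw [F.refl_root] at h3 h2
        have h4 := F.eq_of_refl_neg (F.mem_support_of_mem_rat hir) h3 h2
        apply F.root_injective
        have h5 := congrArg F.root h4
        rw [← F.refl_root] at h5
        apply (F.refl (F.opp i hir)).injective
        rw [h5, F.refl_eq_self_of_tauForm]
        rwa [tauForm_comm]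
      · exact .inr (F.eq_of_refl_neg (F.opp_mem_support hir) h1 h3)
    rcases hcase with rfl | rfl
    · have hjr : j ∈ F.rat := by
        refine hj.resolve_left fun hjf => F.disjoint_fixed_rat m hir ?_
        change tauOp c₁ c₂ n (F.root m) = F.root m
        rw [← hm, ← hT, hjf.2]
      have h3 : g (F.root (F.opp j hjr)) = F.root (F.opp m hir) := by
        rw [F.root_opp, F.root_opp, hT, hm]
      rw [F.orbitRefl_of_rat hir, F.orbitRefl_of_rat hjr, ← mul_assoc, F.mul_refl hW hm, mul_assoc,
        mul_assoc, F.mul_refl hW h3]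
    · have hjr : j ∈ F.rat := by
        refine hj.resolve_left fun hjf => F.disjoint_fixed_image i hir ?_
        change tauOp c₁ c₂ n (tauOp c₁ c₂ n (F.root i)) = tauOp c₁ c₂ n (F.root i)
        rw [← F.root_opp i hir, ← hm, ← hT, hjf.2]
      have h3 : g (F.root (F.opp j hjr)) = c₁ • F.root (F.opp i hir) + F.root i := by
        rw [F.root_opp, hT, hm, F.root_opp, F.tauOp_tauOp_root]
      have h4 := F.tauForm_apply_apply hW (F.root (F.opp j hjr)) (F.root (F.opp j hjr))
      have h5 := F.tauForm_apply_apply hW (F.root j) (F.root j)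
      -- Here `ι(v)` sends `α_j` to `Tα_i`, hence `Tα_j` to `c₁ Tα_i + α_i`. As `α_i` and `Tα_i` are
      -- orthogonal of equal norm, preservation of norms forces `c₁² = 0`; the block is then carried
      -- over with its two roots swapped.
      have hc : c₁ = 0 := by
        rw [hm, F.tauForm_opp_opp] at h5
        rw [F.tauForm_opp_opp, ← h5, h3, tauForm_add_left, tauForm_smul_left,
          tauForm_comm c₁ c₂ n (F.root (F.opp i hir)), tauForm_comm c₁ c₂ n (F.root i) (_ + _),
          tauForm_add_left, tauForm_smul_left, tauForm_add_left, tauForm_smul_left,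
          F.tauForm_opp_opp, tauForm_comm c₁ c₂ n (F.root (F.opp i hir)), hio] at h4
        have h6 : c₁ * c₁ * tauForm (F.root i) (F.root i) = 0 := by linear_combination h4
        exact mul_self_eq_zero.mp
          ((mul_eq_zero.mp h6).resolve_right (F.tauForm_root_ne_zero i))
      have h6 : g (F.root (F.opp j hjr)) = F.root i := by
        rw [h3, show c₁ • F.root (F.opp i hir) = (0 : k) • F.root (F.opp i hir) from
          congrArg (· • _) hc, zero_smul, zero_add]
      rw [F.orbitRefl_of_rat hir, F.orbitRefl_of_rat hjr, ← mul_assoc g, F.mul_refl hW hm,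
        mul_assoc _ g, F.mul_refl hW h6, ← mul_assoc, F.refl_comm_of_tauForm hio]
  · rw [F.orbitRefl_of_not_rat hir] at h2
    have hif := hi.resolve_right hir
    obtain rfl := F.eq_of_refl_neg (F.index_mem_support hi) h1 h2
    have hjr : j ∉ F.rat := by
      intro hjr
      apply F.disjoint_fixed_rat j hjr
      apply g.injective
      change g (tauOp c₁ c₂ n (F.root j)) = g (F.root j)
      rw [hT, hm, hif.2]
    rw [F.orbitRefl_of_not_rat hir, F.orbitRefl_of_not_rat hjr, F.mul_refl hW hm]

/-- The folded group satisfies the exchange condition. -/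
def exchangeWTau : ExchangeSystem F.sTau where
  pos v i := 0 < F.heightFun ((F.embedding v).1 (F.root i.1))
  exists_word v := exists_wordProd_eq F.sTau_mul_self (F.mem_closure_sTau v)
  mul_self := F.sTau_mul_self
  pos_one i := by
    rw [map_one]
    exact F.heightFun_simple_pos (F.index_mem_support i.2)
  pos_mul_self v i := by
    obtain ⟨j, hj⟩ := F.exists_root_of_mem (F.embedding v).2 i.1
    rw [map_mul, Subgroup.coe_mul, F.embedding_sTau, LinearEquiv.mul_apply, F.orbitRefl_root,
      map_neg, map_neg, hj, F.heightFun_neg_iff]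
    exact neg_pos
  exch v i j h1 h2 := by
    apply F.embedding_injective
    apply Subtype.ext
    rw [map_mul, Subgroup.coe_mul, F.embedding_sTau, LinearEquiv.mul_apply] at h2
    rw [map_mul, map_mul, Subgroup.coe_mul, Subgroup.coe_mul, F.embedding_sTau, F.embedding_sTau]
    exact F.orbitRefl_mul_eq i.2 j.2 h1 h2

end Reduced

end FoldedRep

end Folding

end

/-! ### Folded words and the consequences of (C3) -/

noncomputable section

namespace Folding

namespace ExchangeSystem

variable {B G : Type*} [Group G] {s : B → G} (E : ExchangeSystem s)

/-- Each letter of the word lengthens the product of `g` with the preceding letters. -/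
def Ascending : G → List B → Prop
  | _, [] => True
  | g, i :: x => E.pos g i ∧ Ascending (g * s i) x

include E

theorem ascending_append {g : G} {x y : List B} :
    E.Ascending g (x ++ y) ↔ E.Ascending g x ∧ E.Ascending (g * wordProd s x) y := by
  induction x generalizing g with
  | nil => simp [Ascending]
  | cons i x ih => simp [Ascending, ih, and_assoc, mul_assoc]

theorem length_mul_of_ascending {g : G} {x : List B} (h : E.Ascending g x) :
    length s (g * wordProd s x) = length s g + x.length := by
  induction x generalizing g with
  | nil => simp
  | cons i x ih =>
    rw [wordProd_cons, ← mul_assoc, ih h.2, E.length_mul_of_pos h.1, List.length_cons]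
    omega

theorem ascending_of_length {g : G} {x : List B}
    (h : length s (g * wordProd s x) = length s g + x.length) : E.Ascending g x := by
  induction x using List.reverseRecOn with
  | nil => trivial
  | append_singleton x i ih =>
    have h1 := E.length_mul_le (g * wordProd s x) i
    have h2 : length s (g * wordProd s x) ≤ length s g + x.length := by
      clear h ih h1
      induction x using List.reverseRecOn with
      | nil => simp
      | append_singleton x j ih =>
        have := E.length_mul_le (g * wordProd s x) j
        simp only [wordProd_append, wordProd_singleton, List.length_append,
          List.length_singleton, ← mul_assoc]
        omega
    simp only [wordProd_append, wordProd_singleton, List.length_append,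
      List.length_singleton, ← mul_assoc] at h
    refine E.ascending_append.mpr ⟨ih (by omega), E.length_lt_iff.mp (by omega), trivial⟩

theorem ascending_one_iff {x : List B} :
    E.Ascending 1 x ↔ length s (wordProd s x) = x.length := by
  refine ⟨fun h => ?_, fun h => E.ascending_of_length ?_⟩
  · simpa [length_one] using E.length_mul_of_ascending h
  · simpa [length_one] using h

theorem mul_wordProd_le_of_ascending {w g : G} {x y : List B} (h : BruhatLE s w g)
    (hx : E.Ascending g x) (hy : y.Sublist x) :
    BruhatLE s (w * wordProd s y) (g * wordProd s x) := by
  induction hy generalizing w g with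
  | slnil => simpa
  | @cons y x i _ ih =>
    rw [wordProd_cons, ← mul_assoc]
    exact ih (h.trans (E.le_mul_of_pos hx.1)) hx.2
  | @cons_cons y x i _ ih =>
    rw [wordProd_cons, wordProd_cons, ← mul_assoc, ← mul_assoc]
    exact ih (E.mul_gen_le_mul_gen h hx.1) hx.2

theorem mul_wordProd_le_of_forall_not_pos {w g : G} {y : List B} (h : BruhatLE s w g)
    (hy : ∀ i ∈ y, ¬ E.pos g i) : BruhatLE s (w * wordProd s y) g := by
  induction y generalizing w with
  | nil => simpa
  | cons i y ih =>
    rw [List.forall_mem_cons] at hy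
    rw [wordProd_cons, ← mul_assoc]
    exact ih (E.mul_gen_le_of_not_pos h hy.1) hy.2

theorem le_mul_wordProd {w g : G} {y : List B} (h : BruhatLE s w g) (hy : ∀ i ∈ y, E.pos w i) :
    BruhatLE s w (g * wordProd s y) := by
  induction y generalizing g with
  | nil => simpa
  | cons i y ih =>
    rw [List.forall_mem_cons] at hy
    rw [wordProd_cons, ← mul_assoc]
    exact ih (E.le_mul_gen hy.1 h) hy.2

end ExchangeSystem

namespace FoldedRep

variable {k : Subring ℝ} {c₁ c₂ : k} {n : ℕ} {ι X Y : Type*}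
  [AddCommGroup X] [AddCommGroup Y] {D : RootDatum ι X Y} {b : D.Base}
  (F : FoldedRep c₁ c₂ n D b) [Module.Free ℤ X]

/-- Simple roots are linearly independent, so a simple root in the span of `Δ_P` belongs to `Δ_P`.
-/
theorem opp_mem_of_map_span_eq {P : Set ι} (hP : P ⊆ b.support)
    (hPT : (Submodule.span k (F.root '' P)).map (tauOp c₁ c₂ n) =
      Submodule.span k (F.root '' P)) {i : ι} (hi : i ∈ F.rat) (hiP : i ∈ P) : F.opp i hi ∈ P := by
  have h1 : F.root (F.opp i hi) ∈ Submodule.span k (F.root '' P) := by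
    rw [← hPT, F.root_opp]
    exact Submodule.mem_map_of_mem (Submodule.subset_span ⟨i, hiP, rfl⟩)
  have h2 : F.root '' P = (fun i : b.support => F.root i) '' {i | i.1 ∈ P} := by
    ext u
    constructor
    · rintro ⟨j, hj, rfl⟩
      exact ⟨⟨j, hP hj⟩, hj, rfl⟩
    · rintro ⟨j, hj, rfl⟩
      exact ⟨j, hj, rfl⟩
  rw [h2] at h1
  by_contra h
  exact F.linearIndependent_root.notMem_span_image (s := {i | i.1 ∈ P})
    (x := ⟨_, F.opp_mem_support hi⟩) h h1

open Classical in
/-- The word of `W` that corresponds to a generator of `W_τ`. -/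
def foldBlock (i : F.FoldedIndex) : List b.support :=
  if hi : i.1 ∈ F.rat then [⟨i, F.index_mem_support i.2⟩, ⟨F.opp i hi, F.opp_mem_support hi⟩]
  else [⟨i, F.index_mem_support i.2⟩]

theorem foldBlock_of_rat {i : F.FoldedIndex} (hi : i.1 ∈ F.rat) : F.foldBlock i =
    [⟨i, F.index_mem_support i.2⟩, ⟨F.opp i hi, F.opp_mem_support hi⟩] := dif_pos hi

theorem foldBlock_of_not_rat {i : F.FoldedIndex} (hi : i.1 ∉ F.rat) : F.foldBlock i =
    [⟨i, F.index_mem_support i.2⟩] := dif_neg hi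

theorem wordProd_foldBlock (i : F.FoldedIndex) :
    wordProd F.s (F.foldBlock i) = F.embedding (F.sTau i) := by
  apply Subtype.ext
  rw [F.embedding_sTau]
  by_cases hi : i.1 ∈ F.rat
  · rw [F.foldBlock_of_rat hi, F.orbitRefl_of_rat hi, wordProd_cons, wordProd_singleton]
    rfl
  · rw [F.foldBlock_of_not_rat hi, F.orbitRefl_of_not_rat hi, wordProd_singleton]
    rfl

/-- The word of `W` that corresponds to a word of `W_τ`. -/
def foldWord (x : List F.FoldedIndex) : List b.support := x.flatMap F.foldBlock

@[simp] theorem foldWord_nil : F.foldWord [] = [] := rfl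

@[simp] theorem foldWord_cons (i : F.FoldedIndex) (x : List F.FoldedIndex) :
    F.foldWord (i :: x) = F.foldBlock i ++ F.foldWord x := List.flatMap_cons

theorem foldWord_append (x y : List F.FoldedIndex) :
    F.foldWord (x ++ y) = F.foldWord x ++ F.foldWord y := List.flatMap_append

theorem foldWord_singleton (i : F.FoldedIndex) : F.foldWord [i] = F.foldBlock i := by simp

theorem wordProd_foldWord (x : List F.FoldedIndex) :
    wordProd F.s (F.foldWord x) = F.embedding (wordProd F.sTau x) := by
  induction x with
  | nil => simp
  | cons i x ih => rw [foldWord_cons, wordProd_append, ih, wordProd_foldBlock, wordProd_cons, map_mul]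

theorem exists_mem_foldBlock (i : b.support) : ∃ j, i ∈ F.foldBlock j := by
  rcases F.fixed_or_rat_or_opp i.2 with h | h | ⟨j, hj, h⟩
  · refine ⟨⟨i, .inl h⟩, ?_⟩
    rw [F.foldBlock_of_not_rat (F.not_mem_rat_of_mem_fixed h)]
    exact List.mem_singleton_self _
  · refine ⟨⟨i, .inr h⟩, ?_⟩
    rw [F.foldBlock_of_rat h]
    exact List.mem_cons_self
  · refine ⟨⟨j, .inr hj⟩, ?_⟩
    rw [F.foldBlock_of_rat hj]
    exact List.mem_cons_of_mem _ (List.mem_singleton.mpr (Subtype.ext h))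

theorem exists_sublist_foldWord (x : List b.support) :
    ∃ y, y.length = x.length ∧ x.Sublist (F.foldWord y) := by
  induction x with
  | nil => exact ⟨[], rfl, .refl _⟩
  | cons i x ih =>
    obtain ⟨y, hy, h⟩ := ih
    obtain ⟨j, hj⟩ := F.exists_mem_foldBlock i
    refine ⟨j :: y, by simp [hy], ?_⟩
    rw [foldWord_cons]
    exact (List.singleton_sublist.mpr hj).append h

section Reduced

variable [Finite ι] [D.IsReduced]

omit [Module.Free ℤ X] [Finite ι] [D.IsReduced] in
theorem heightFun_embedding_opp (v : F.WTau) {i : ι} (hi : i ∈ F.rat) :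
    F.heightFun ((F.embedding v).1 (F.root (F.opp i hi))) =
      posRoot c₁ * F.heightFun ((F.embedding v).1 (F.root i)) := by
  rw [F.root_opp, F.embedding_tauOp, F.heightFun_tauOp i]

/-- The heights of the images of `α` and `Tα` under `ι(v)` differ by the factor `λ > 0`, so both
letters of a block are ascents of `ι(v)` or both are descents. -/
theorem posW_iff_of_mem_foldBlock (v : F.WTau) {i : F.FoldedIndex} {j : b.support}
    (hj : j ∈ F.foldBlock i) : F.exchangeW.pos (F.embedding v) j ↔ F.exchangeWTau.pos v i := by
  by_cases hi : i.1 ∈ F.rat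
  · rw [F.foldBlock_of_rat hi, List.mem_pair] at hj
    rcases hj with rfl | rfl
    · rfl
    · change 0 < F.heightFun ((F.embedding v).1 (F.root (F.opp i hi))) ↔
        0 < F.heightFun ((F.embedding v).1 (F.root i))
      rw [F.heightFun_embedding_opp]
      exact mul_pos_iff_of_pos_left (posRoot_pos c₁)
  · rw [F.foldBlock_of_not_rat hi, List.mem_singleton] at hj
    subst hj
    rfl

/-- The first reflection of a two-letter block fixes `Tα` by orthogonality, so it does not disturb
the sign at the second letter. -/
theorem ascending_foldBlock {v : F.WTau} {i : F.FoldedIndex} (h : F.exchangeWTau.pos v i) :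
    F.exchangeW.Ascending (F.embedding v) (F.foldBlock i) := by
  by_cases hi : i.1 ∈ F.rat
  · have h2 := (F.posW_iff_of_mem_foldBlock v (i := i)
      (j := ⟨F.opp i hi, F.opp_mem_support hi⟩) (by simp [F.foldBlock_of_rat hi])).mpr h
    rw [F.foldBlock_of_rat hi]
    refine ⟨h, ?_, trivial⟩
    change 0 < F.heightFun ((F.embedding v).1 (F.refl i (F.root (F.opp i hi))))
    rw [F.refl_eq_self_of_tauForm (F.tauForm_root_opp hi)]
    exact h2
  · rw [F.foldBlock_of_not_rat hi]
    exact ⟨h, trivial⟩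

theorem ascending_foldWord {v : F.WTau} {x : List F.FoldedIndex}
    (h : F.exchangeWTau.Ascending v x) :
    F.exchangeW.Ascending (F.embedding v) (F.foldWord x) := by
  induction x generalizing v with
  | nil => trivial
  | cons i x ih =>
    rw [foldWord_cons, ExchangeSystem.ascending_append, wordProd_foldBlock, ← map_mul]
    exact ⟨F.ascending_foldBlock h.1, ih h.2⟩

/-- The word `z` is built greedily from the left: a block is added if it lengthens the element of
`W_τ`. Otherwise both its letters are descents, and multiplying the smaller element by them stays
below. -/
theorem exists_le_embedding_of_sublist (x : List F.FoldedIndex) {y : List b.support}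
    (hy : y.Sublist (F.foldWord x)) : ∃ z : List F.FoldedIndex, z.Sublist x ∧
      BruhatLE F.s (wordProd F.s y) (F.embedding (wordProd F.sTau z)) := by
  induction x using List.reverseRecOn generalizing y with
  | nil =>
    rw [List.sublist_nil.mp hy]
    exact ⟨[], .refl _, by simpa using BruhatLE.refl _⟩
  | append_singleton x i ih =>
    rw [foldWord_append, foldWord_singleton] at hy
    obtain ⟨a, c, rfl, ha, hc⟩ := List.sublist_append_iff.mp hy
    obtain ⟨z, hz, h⟩ := ih ha
    rw [wordProd_append]
    by_cases hp : F.exchangeWTau.pos (wordProd F.sTau z) i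
    · refine ⟨z ++ [i], hz.append (.refl _), ?_⟩
      rw [wordProd_append, wordProd_singleton, map_mul, ← wordProd_foldBlock]
      exact F.exchangeW.mul_wordProd_le_of_ascending h (F.ascending_foldBlock hp) hc
    · refine ⟨z, hz.trans (List.sublist_append_left _ _), ?_⟩
      refine F.exchangeW.mul_wordProd_le_of_forall_not_pos h fun j hj => ?_
      rwa [F.posW_iff_of_mem_foldBlock _ (hc.mem hj)]

/-- Descents of `v` in `P` are removed one by one. The relation to `w` survives because all letters
of such a block lie in `P` and are ascents of `w ∈ W^P`. -/
theorem exists_le_mem_WTauP {P : Set ι} (hP : P ⊆ b.support)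
    (hPT : (Submodule.span k (F.root '' P)).map (tauOp c₁ c₂ n) =
      Submodule.span k (F.root '' P)) {w : F.W} (hw : w ∈ F.WP P) {v : F.WTau}
    (h : BruhatLE F.s w (F.embedding v)) :
    ∃ v' ∈ F.WTauP P, BruhatLE F.sTau v' v ∧ BruhatLE F.s w (F.embedding v') := by
  induction hl : length F.sTau v using Nat.strong_induction_on generalizing v with
  | _ m ih =>
    by_cases hv : v ∈ F.WTauP P
    · exact ⟨v, hv, .refl _, h⟩
    rw [WTauP, F.exchangeWTau.mem_minReps] at hv
    push Not at hv
    obtain ⟨i, hi, hp⟩ := hv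
    have h1 := F.exchangeWTau.length_mul_of_not_pos hp
    have h2 : BruhatLE F.s w (F.embedding (v * F.sTau i)) := by
      rw [map_mul, ← wordProd_foldBlock]
      refine F.exchangeW.le_mul_wordProd h fun j hj => F.exchangeW.mem_minReps.mp hw j ?_
      by_cases hir : i.1 ∈ F.rat
      · rw [F.foldBlock_of_rat hir, List.mem_pair] at hj
        rcases hj with rfl | rfl
        · exact hi
        · exact F.opp_mem_of_map_span_eq hP hPT hir hi
      · rw [F.foldBlock_of_not_rat hir, List.mem_singleton] at hj
        subst hj
        exact hi
    obtain ⟨v', hv', hle, h3⟩ := ih _ (by omega) h2 rfl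
    exact ⟨v', hv', hle.trans (F.exchangeWTau.mul_le_of_not_pos hp), h3⟩

theorem exists_le_embedding_of_mem_WP {P : Set ι} (hP : P ⊆ b.support)
    (hPT : (Submodule.span k (F.root '' P)).map (tauOp c₁ c₂ n) =
      Submodule.span k (F.root '' P)) {w : F.W} (hw : w ∈ F.WP P) {x : List F.FoldedIndex}
    {y : List b.support} (hy : y.Sublist (F.foldWord x)) (hyw : wordProd F.s y = w) :
    ∃ z, z.Sublist x ∧ ∃ v ∈ F.WTauP P, BruhatLE F.sTau v (wordProd F.sTau z) ∧
      BruhatLE F.s w (F.embedding v) := by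
  obtain ⟨z, hz, h⟩ := F.exists_le_embedding_of_sublist x hy
  rw [hyw] at h
  exact ⟨z, hz, F.exists_le_mem_WTauP hP hPT hw h⟩

/-- A word of length at most `ℓ(u)` whose folded word contains `w` is a reduced word of `u`. -/
theorem wordProd_eq_of_sublist_foldWord {P : Set ι} (hP : P ⊆ b.support)
    (hPT : (Submodule.span k (F.root '' P)).map (tauOp c₁ c₂ n) =
      Submodule.span k (F.root '' P)) {u : F.WTau} {w : F.W} (hw : w ∈ F.WP P)
    (hC : ∀ u' ∈ F.WTauP P, ¬ BruhatLE F.sTau u u' → ¬ BruhatLE F.s w (F.embedding u'))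
    {x : List F.FoldedIndex} (hx : x.length ≤ length F.sTau u)
    {y : List b.support} (hy : y.Sublist (F.foldWord x)) (hyw : wordProd F.s y = w) :
    x.length = length F.sTau u ∧ wordProd F.sTau x = u ∧ BruhatLE F.s w (F.embedding u) := by
  obtain ⟨z, hz, v, hv, hvz, hwv⟩ := F.exists_le_embedding_of_mem_WP hP hPT hw hy hyw
  -- This closes the chain `ℓ(u) ≤ ℓ(v) ≤ ℓ(z) ≤ |x| ≤ ℓ(u)`, where `ℓ(z)` is the length of the
  -- element spelled by `z`; so `z = x` and `v = u`.
  have huv : BruhatLE F.sTau u v := by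
    by_contra h
    exact hC v hv h hwv
  have h1 := huv.length_le
  have h2 := hvz.length_le
  have h3 := length_wordProd_le (s := F.sTau) z
  have h4 := hz.length_le
  obtain rfl := hz.eq_of_length (by omega)
  obtain rfl := huv.eq_of_length_le (by omega)
  exact ⟨by omega, (hvz.eq_of_length_le (by omega)).symm, hwv⟩

end Reduced

end FoldedRep

end Folding

end

/-! ### Block-by-block expansion of `σ_w` over a folded word -/

noncomputable section

namespace Folding

section LetterWeights

variable {B G A : Type*} [Group G] (s : B → G)

/-- The list of the letters of a word, each with a weight that depends on the letter and on
the product of the preceding letters. -/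
def letterWeights (f : G → B → A) : G → List B → List (B × A)
  | _, [] => []
  | g, i :: x => (i, f g i) :: letterWeights f (g * s i) x

theorem weightedWord_eq_map_letterWeights (f : G → B → A) (g : G) (x : List B) :
    weightedWord s f g x = (letterWeights s f g x).map (Prod.map s id) := by
  induction x generalizing g with
  | nil => rfl
  | cons i x ih => simp [weightedWord, letterWeights, ih]

theorem map_fst_letterWeights (f : G → B → A) (g : G) (x : List B) :
    (letterWeights s f g x).map Prod.fst = x := by
  induction x generalizing g with
  | nil => rfl
  | cons i x ih => simp [letterWeights, ih]

theorem letterWeights_append (f : G → B → A) (g : G) (x y : List B) :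
    letterWeights s f g (x ++ y) =
      letterWeights s f g x ++ letterWeights s f (g * wordProd s x) y := by
  induction x generalizing g with
  | nil => simp [letterWeights]
  | cons i x ih => simp [letterWeights, ih, mul_assoc]

theorem map_letterWeights {A' : Type*} (φ : A → A') (f : G → B → A) (g : G) (x : List B) :
    (letterWeights s f g x).map (Prod.map id φ) = letterWeights s (fun g i => φ (f g i)) g x := by
  induction x generalizing g with
  | nil => rfl
  | cons i x ih => simp [letterWeights, ih]

theorem exists_of_mem_letterWeights {f : G → B → A} {g : G} {x : List B} {p : B × A}
    (h : p ∈ letterWeights s f g x) : ∃ g', p.2 = f g' p.1 := by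
  induction x generalizing g with
  | nil => simp [letterWeights] at h
  | cons i x ih =>
    rw [letterWeights, List.mem_cons] at h
    rcases h with rfl | h
    · exact ⟨g, rfl⟩
    · exact ih h

theorem _root_.Folding.ExchangeSystem.forall_mem_letterWeights {s : B → G} (E : ExchangeSystem s)
    {f : G → B → A} {q : A → Prop} (hq : ∀ g i, E.pos g i → q (f g i)) {g : G} {x : List B}
    (hx : E.Ascending g x) : ∀ p ∈ letterWeights s f g x, q p.2 := by
  induction x generalizing g with
  | nil => simp [letterWeights]
  | cons i x ih =>
    rw [letterWeights, List.forall_mem_cons]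
    exact ⟨hq _ _ hx.1, ih hx.2⟩

open Classical in
theorem subSum_eq_sum_sublists [CommSemiring A] (l : List (B × A)) (n : ℤ) (w : G) :
    subSum (l.map (Prod.map s id)) n w = (l.sublists'.map fun y =>
      if (y.length : ℤ) = n ∧ wordProd s (y.map Prod.fst) = w
        then (y.map Prod.snd).prod else 0).sum := by
  induction l generalizing n w with
  | nil => simp [subSum, eq_comm]
  | cons p l ih =>
    rw [List.map_cons, Prod.map, subSum, ih, ih, List.sublists'_cons, List.map_append,
      List.sum_append, List.map_map, ← List.sum_map_mul_left]
    congr 3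
    funext y
    simp only [Function.comp_apply, List.length_cons, List.map_cons, List.prod_cons, mul_ite,
      mul_zero, id]
    congr 1
    rw [wordProd_cons, eq_inv_mul_iff_mul_eq]
    push_cast
    rw [eq_sub_iff_add_eq]

end LetterWeights

namespace FoldedRep

variable {k : Subring ℝ} {c₁ c₂ : k} {n : ℕ} {ι X Y : Type*}
  [AddCommGroup X] [AddCommGroup Y] {D : RootDatum ι X Y} {b : D.Base}
  (F : FoldedRep c₁ c₂ n D b) [Module.Free ℤ X]

/-- The first simple reflection of `W` in the folded word of a generator of `W_τ`. -/
abbrev refl₁ (i : F.FoldedIndex) : F.W := F.s ⟨i, F.index_mem_support i.2⟩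

/-- The second simple reflection of `W` in the folded word of a generator of `W_τ`. -/
abbrev refl₂ {i : F.FoldedIndex} (hi : i.1 ∈ F.rat) : F.W := F.s ⟨F.opp i hi, F.opp_mem_support hi⟩

section Sums

variable {A : Type*} [CommRing A] [Algebra (QuadAlg c₁ c₂) A]

open Classical in
/-- The folded word of a generator of `W_τ`, with the weights `β` and `τ β`. -/
def foldPairs (p : F.FoldedIndex × A) : List (F.W × A) :=
  if hi : p.1.1 ∈ F.rat then [(F.refl₁ p.1, p.2), (F.refl₂ hi, tau c₁ c₂ • p.2)]
  else [(F.refl₁ p.1, p.2)]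

open Classical in
/-- The part of the sum over the sublists of a folded word to which every block contributes. -/
def foldSum : List (F.FoldedIndex × A) → ℤ → F.W → A
  | [], m, w => if m = 0 ∧ w = 1 then 1 else 0
  | p :: l, m, w =>
    if hi : p.1.1 ∈ F.rat then
      p.2 * foldSum l (m - 1) ((F.refl₁ p.1)⁻¹ * w) +
        tau c₁ c₂ • p.2 * foldSum l (m - 1) ((F.refl₂ hi)⁻¹ * w) +
        tau c₁ c₂ • (p.2 * p.2) * foldSum l (m - 2) ((F.refl₂ hi)⁻¹ * ((F.refl₁ p.1)⁻¹ * w))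
    else p.2 * foldSum l (m - 1) ((F.refl₁ p.1)⁻¹ * w)

theorem foldSum_cons_of_rat {p : F.FoldedIndex × A} (hi : p.1.1 ∈ F.rat)
    (l : List (F.FoldedIndex × A)) (m : ℤ) (w : F.W) : F.foldSum (p :: l) m w =
      p.2 * F.foldSum l (m - 1) ((F.refl₁ p.1)⁻¹ * w) +
        tau c₁ c₂ • p.2 * F.foldSum l (m - 1) ((F.refl₂ hi)⁻¹ * w) +
        tau c₁ c₂ • (p.2 * p.2) *
          F.foldSum l (m - 2) ((F.refl₂ hi)⁻¹ * ((F.refl₁ p.1)⁻¹ * w)) := by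
  rw [foldSum, dif_pos hi]

theorem foldSum_cons_of_not_rat {p : F.FoldedIndex × A} (hi : p.1.1 ∉ F.rat)
    (l : List (F.FoldedIndex × A)) (m : ℤ) (w : F.W) : F.foldSum (p :: l) m w =
      p.2 * F.foldSum l (m - 1) ((F.refl₁ p.1)⁻¹ * w) := by
  rw [foldSum, dif_neg hi]

/-- Subwords of a folded word are grouped by the set of blocks they meet. A block that is met gives
its first letter, its second, or both, which are the three terms of `foldSum`. -/
theorem subSum_flatMap_foldPairs (l : List (F.FoldedIndex × A)) (m : ℤ) (w : F.W) :
    subSum (l.flatMap F.foldPairs) m w = (l.sublists'.map fun y => F.foldSum y m w).sum := by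
  induction l generalizing m w with
  | nil => simp [subSum, foldSum]
  | cons p l ih =>
    rw [List.flatMap_cons, List.sublists'_cons, List.map_append, List.sum_append, ← ih,
      List.map_map]
    by_cases hi : p.1.1 ∈ F.rat
    · have h : (fun y => F.foldSum y m w) ∘ List.cons p = fun l =>
          p.2 * F.foldSum l (m - 1) ((F.refl₁ p.1)⁻¹ * w) +
          tau c₁ c₂ • p.2 * F.foldSum l (m - 1) ((F.refl₂ hi)⁻¹ * w) +
          tau c₁ c₂ • (p.2 * p.2) *
            F.foldSum l (m - 2) ((F.refl₂ hi)⁻¹ * ((F.refl₁ p.1)⁻¹ * w)) :=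
        funext fun y => F.foldSum_cons_of_rat hi y m w
      rw [h, List.sum_map_add, List.sum_map_add, List.sum_map_mul_left, List.sum_map_mul_left,
        List.sum_map_mul_left, ← ih, ← ih, ← ih, foldPairs, dif_pos hi, List.cons_append,
        List.cons_append, List.nil_append, subSum, subSum, subSum, sub_sub, one_add_one_eq_two,
        smul_mul_assoc, smul_mul_assoc, smul_mul_assoc, mul_add, mul_smul_comm, mul_assoc]
      abel
    · have h : (fun y => F.foldSum y m w) ∘ List.cons p = fun l =>
          p.2 * F.foldSum l (m - 1) ((F.refl₁ p.1)⁻¹ * w) :=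
        funext fun y => F.foldSum_cons_of_not_rat hi y m w
      rw [h, List.sum_map_mul_left, ← ih, foldPairs, dif_neg hi, List.cons_append,
        List.nil_append, subSum]

/-- Every block contributes at least one letter, hence the bound on the number of blocks by the
degree. -/
theorem exists_sublist_of_foldSum_ne_zero {l : List (F.FoldedIndex × A)} {m : ℤ} {w : F.W}
    (h : F.foldSum l m w ≠ 0) : (l.length : ℤ) ≤ m ∧
      ∃ y : List b.support, y.Sublist (F.foldWord (l.map Prod.fst)) ∧ wordProd F.s y = w := by
  induction l generalizing m w with
  | nil =>
    rw [foldSum] at h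
    classical
    rw [ite_ne_right_iff] at h
    exact ⟨by simp [h.1.1], [], .refl _, by simp [h.1.2]⟩
  | cons p l ih =>
    simp only [List.length_cons, List.map_cons, foldWord_cons]
    push_cast
    by_cases hi : p.1.1 ∈ F.rat
    · rw [F.foldSum_cons_of_rat hi] at h
      rw [F.foldBlock_of_rat hi]
      by_cases h1 : F.foldSum l (m - 1) ((F.refl₁ p.1)⁻¹ * w) = 0
      · by_cases h2 : F.foldSum l (m - 1) ((F.refl₂ hi)⁻¹ * w) = 0
        · rw [h1, h2, mul_zero, mul_zero, add_zero, zero_add] at h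
          obtain ⟨hl, y, hy, hp⟩ := ih (right_ne_zero_of_mul h)
          refine ⟨by omega, _ :: _ :: y, (hy.cons_cons _).cons_cons _, ?_⟩
          rw [wordProd_cons, wordProd_cons, hp, mul_inv_cancel_left, mul_inv_cancel_left]
        · obtain ⟨hl, y, hy, hp⟩ := ih h2
          refine ⟨by omega, _ :: y, (hy.cons_cons _).cons _, ?_⟩
          rw [wordProd_cons, hp, mul_inv_cancel_left]
      · obtain ⟨hl, y, hy, hp⟩ := ih h1
        refine ⟨by omega, _ :: y, (hy.cons _).cons_cons _, ?_⟩
        rw [wordProd_cons, hp, mul_inv_cancel_left]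
    · rw [F.foldSum_cons_of_not_rat hi] at h
      rw [F.foldBlock_of_not_rat hi]
      obtain ⟨hl, y, hy, hp⟩ := ih (right_ne_zero_of_mul h)
      refine ⟨by omega, _ :: y, hy.cons_cons _, ?_⟩
      rw [wordProd_cons, hp, mul_inv_cancel_left]

theorem foldSum_eq_zero_of_lt {l : List (F.FoldedIndex × A)} {m : ℤ} (h : m < l.length) (w : F.W) :
    F.foldSum l m w = 0 := by
  by_contra hc
  have := (F.exists_sublist_of_foldSum_ne_zero hc).1
  omega

open Classical in
/-- The coefficient of the product of the weights in `foldSum`. -/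
def foldCoeff : List F.FoldedIndex → F.W → QuadAlg c₁ c₂
  | [], w => if w = 1 then 1 else 0
  | i :: x, w =>
    if hi : i.1 ∈ F.rat then
      foldCoeff x ((F.refl₁ i)⁻¹ * w) + tau c₁ c₂ * foldCoeff x ((F.refl₂ hi)⁻¹ * w)
    else foldCoeff x ((F.refl₁ i)⁻¹ * w)

theorem foldCoeff_cons_of_rat {i : F.FoldedIndex} (hi : i.1 ∈ F.rat) (x : List F.FoldedIndex)
    (w : F.W) : F.foldCoeff (i :: x) w = F.foldCoeff x ((F.refl₁ i)⁻¹ * w) +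
      tau c₁ c₂ * F.foldCoeff x ((F.refl₂ hi)⁻¹ * w) := by
  rw [foldCoeff, dif_pos hi]

theorem foldCoeff_cons_of_not_rat {i : F.FoldedIndex} (hi : i.1 ∉ F.rat)
    (x : List F.FoldedIndex) (w : F.W) :
    F.foldCoeff (i :: x) w = F.foldCoeff x ((F.refl₁ i)⁻¹ * w) := by
  rw [foldCoeff, dif_neg hi]

/-- When there are as many blocks as letters to choose, no block gives two letters. The weights then
factor out, and only the choices of `β` or `τ β` are recorded in the coefficient. -/
theorem foldSum_length (l : List (F.FoldedIndex × A)) (w : F.W) :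
    F.foldSum l l.length w = F.foldCoeff (l.map Prod.fst) w • (l.map Prod.snd).prod := by
  induction l generalizing w with
  | nil => by_cases h : w = 1 <;> simp [foldSum, foldCoeff, h]
  | cons p l ih =>
    have e : ((p :: l).length : ℤ) - 1 = l.length := by simp
    rw [List.map_cons, List.map_cons, List.prod_cons]
    by_cases hi : p.1.1 ∈ F.rat
    · rw [F.foldSum_cons_of_rat hi, e, ih, ih,
        F.foldSum_eq_zero_of_lt (m := ((p :: l).length : ℤ) - 2) (by simp; omega),
        F.foldCoeff_cons_of_rat hi, add_smul, mul_zero, add_zero, mul_smul]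
      simp only [mul_smul_comm, smul_mul_assoc]
      rw [smul_comm (tau c₁ c₂)]
    · rw [F.foldSum_cons_of_not_rat hi, e, ih, F.foldCoeff_cons_of_not_rat hi, mul_smul_comm]

end Sums

/-- The weights of the letters in the definition of the Schubert classes of `W_τ`. -/
abbrev weightTau : F.WTau → F.FoldedIndex → SymmetricAlgebra (QuadAlg c₁ c₂) F.ULatTau :=
  rootWeight F.WTau_ULatTau F.simpleRootTau

/-- The image of `π_τ(u)` in the symmetric algebra. -/
def projVec (u : F.ULat) : SymmetricAlgebra (QuadAlg c₁ c₂) F.ULatTau :=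
  SymmetricAlgebra.ι _ F.ULatTau
    ⟨proj c₁ c₂ n u.1, eigenProj_mem _ _ _ _ _ _ u.2⟩

omit [Module.Free ℤ X] in
theorem projSym_weightW (g : F.W) (i : b.support) : F.projSym (F.weightW g i) =
    F.projVec ⟨g.1 (F.root i), F.W_ULat _ g.2 _ (F.simpleRoot i).2⟩ :=
  SymmetricAlgebra.lift_ι_apply _ _

theorem weightTau_eq (v : F.WTau) (i : F.FoldedIndex) : F.weightTau v i =
    F.projSym (F.weightW (F.embedding v) ⟨i, F.index_mem_support i.2⟩) := by
  rw [projSym_weightW]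
  exact congrArg (SymmetricAlgebra.ι (QuadAlg c₁ c₂) F.ULatTau)
    (Subtype.ext (F.apply_proj v (F.root i)))

theorem tau_smul_weightTau_eq (v : F.WTau) {i : F.FoldedIndex} (hi : i.1 ∈ F.rat) :
    tau c₁ c₂ • F.weightTau v i = F.projSym (F.weightW (F.embedding v * F.refl₁ i)
      ⟨F.opp i hi, F.opp_mem_support hi⟩) := by
  rw [projSym_weightW, weightTau_eq, projSym_weightW, projVec, ← map_smul]
  refine congrArg _ (Subtype.ext ?_)
  change tau c₁ c₂ • proj c₁ c₂ n ((F.embedding v).1 (F.root i)) =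
    proj c₁ c₂ n ((F.embedding v).1 (F.refl i (F.root (F.opp i hi))))
  rw [F.refl_eq_self_of_tauForm (F.tauForm_root_opp hi), ← proj_tauOp, F.root_opp,
    F.embedding_tauOp]

/-- The root is fixed by `T`, and so is its image under `ι(v)`; on projections `T` acts as `τ`. -/
theorem tau_smul_weightTau_of_not_rat (v : F.WTau) {i : F.FoldedIndex} (hi : i.1 ∉ F.rat) :
    tau c₁ c₂ • F.weightTau v i = F.weightTau v i := by
  rw [weightTau_eq, projSym_weightW, projVec, ← map_smul]
  refine congrArg _ (Subtype.ext ?_)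
  change tau c₁ c₂ • proj c₁ c₂ n ((F.embedding v).1 (F.root i)) =
    proj c₁ c₂ n ((F.embedding v).1 (F.root i))
  rw [← proj_tauOp, ← F.embedding_tauOp, (i.2.resolve_right hi).2]

theorem map_weightedWord_foldWord (v : F.WTau) (x : List F.FoldedIndex) :
    (weightedWord F.s F.weightW (F.embedding v) (F.foldWord x)).map (Prod.map id F.projSym) =
      (letterWeights F.sTau F.weightTau v x).flatMap F.foldPairs := by
  induction x generalizing v with
  | nil => rfl
  | cons i x ih =>
    have h : F.embedding v * wordProd F.s (F.foldBlock i) = F.embedding (v * F.sTau i) := by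
      rw [wordProd_foldBlock, map_mul]
    rw [foldWord_cons, weightedWord_append, List.map_append, letterWeights, List.flatMap_cons, h]
    refine congrArg₂ (· ++ ·) ?_ (ih (v * F.sTau i))
    by_cases hi : i.1 ∈ F.rat
    · refine Eq.trans ?_ (dif_pos hi).symm
      rw [F.foldBlock_of_rat hi]
      exact congrArg₂ (fun p q => [p, q]) (Prod.ext rfl (F.weightTau_eq v i).symm)
        (Prod.ext rfl (F.tau_smul_weightTau_eq v hi).symm)
    · refine Eq.trans ?_ (dif_neg hi).symm
      rw [F.foldBlock_of_not_rat hi]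
      exact congrArg (fun p => [p]) (Prod.ext rfl (F.weightTau_eq v i).symm)

theorem projSym_wordSum_foldWord (x : List F.FoldedIndex) (w : F.W) :
    F.projSym (wordSum F.s F.weightW (F.foldWord x) w) =
      ((letterWeights F.sTau F.weightTau 1 x).sublists'.map fun y =>
        F.foldSum y (length F.s w) w).sum := by
  rw [wordSum, map_subSum, ← subSum_flatMap_foldPairs, ← map_weightedWord_foldWord, map_one]

end FoldedRep

end Folding

end

/-! ### Real evaluation and products over inversions -/

noncomputable section

namespace Folding

namespace FoldedRep

variable {k : Subring ℝ} {c₁ c₂ : k} {n : ℕ} {ι X Y : Type*}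
  [AddCommGroup X] [AddCommGroup Y] {D : RootDatum ι X Y} {b : D.Base}
  (F : FoldedRep c₁ c₂ n D b)

/-- The real embedding of `L` which sends `τ` to the positive root of `x² - c₁ x - 1`. -/
def evalQuad (hc : c₂ = -1) : QuadAlg c₁ c₂ →ₐ[k] ℝ :=
  QuadraticAlgebra.lift ⟨posRoot c₁, by
    rw [posRoot_mul_self, hc, neg_neg, one_smul, Subring.smul_def, smul_eq_mul, add_comm]⟩

theorem evalQuad_apply (hc : c₂ = -1) (a : QuadAlg c₁ c₂) :
    evalQuad hc a = (QuadAlg.re a : ℝ) + QuadAlg.im a * posRoot c₁ := by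
  change (QuadAlg.re a) • (1 : ℝ) + QuadAlg.im a • posRoot c₁ = _
  rw [Subring.smul_def, Subring.smul_def, smul_eq_mul, smul_eq_mul, mul_one]

theorem evalQuad_tau (hc : c₂ = -1) : evalQuad hc (tau c₁ c₂) = posRoot c₁ := by
  rw [evalQuad_apply]
  change ((0 : k) : ℝ) + ((1 : k) : ℝ) * _ = _
  simp

theorem evalQuad_sigma (hc : c₂ = -1) : evalQuad hc (sigma c₁ c₂) = negRoot c₁ := by
  rw [evalQuad_apply]
  change (c₁ : ℝ) + ((-1 : k) : ℝ) * _ = _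
  push_cast
  unfold negRoot
  ring

/-- The real-valued ring homomorphism on `Sym_L(π_τ(U_Λ))` given by `evalQuad` on `L`
and by `t` times the height function on `π_τ(U_Λ)`. -/
def evalSym (hc : c₂ = -1) (t : ℝ) : SymmetricAlgebra (QuadAlg c₁ c₂) F.ULatTau →+* ℝ :=
  letI : Algebra (QuadAlg c₁ c₂) ℝ := (evalQuad hc).toRingHom.toAlgebra
  haveI : IsScalarTower k (QuadAlg c₁ c₂) ℝ :=
    IsScalarTower.of_algebraMap_eq fun r => ((evalQuad hc).commutes r).symm
  (SymmetricAlgebra.lift (LinearMap.liftBaseChange (QuadAlg c₁ c₂) (t • F.heightFun) ∘ₗ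
    (UTau c₁ c₂ n).subtype ∘ₗ F.ULatTau.subtype)).toRingHom

theorem evalSym_smul (hc : c₂ = -1) (t : ℝ) (a : QuadAlg c₁ c₂)
    (x : SymmetricAlgebra (QuadAlg c₁ c₂) F.ULatTau) :
    F.evalSym hc t (a • x) = evalQuad hc a * F.evalSym hc t x := by
  let _ : Algebra (QuadAlg c₁ c₂) ℝ := (evalQuad hc).toRingHom.toAlgebra
  have : IsScalarTower k (QuadAlg c₁ c₂) ℝ :=
    IsScalarTower.of_algebraMap_eq fun r => ((evalQuad hc).commutes r).symm
  exact map_smul (SymmetricAlgebra.lift (LinearMap.liftBaseChange (QuadAlg c₁ c₂)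
    (t • F.heightFun) ∘ₗ (UTau c₁ c₂ n).subtype ∘ₗ F.ULatTau.subtype)) a x

/-- Both factors of `π_τ` evaluate compatibly: `(T - σ)u` goes to `t(λ - μ)h(u)` and `(τ - σ)⁻¹` to
`(λ - μ)⁻¹`. -/
theorem evalSym_projVec [Nonempty ι] (hc : c₂ = -1) (t : ℝ) (u : F.ULat) :
    F.evalSym hc t (F.projVec u) = t * F.heightFun u.1 := by
  let _ : Algebra (QuadAlg c₁ c₂) ℝ := (evalQuad hc).toRingHom.toAlgebra
  have : IsScalarTower k (QuadAlg c₁ c₂) ℝ :=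
    IsScalarTower.of_algebraMap_eq fun r => ((evalQuad hc).commutes r).symm
  have h1 : F.evalSym hc t (F.projVec u) = LinearMap.liftBaseChange (QuadAlg c₁ c₂)
      (t • F.heightFun) (proj c₁ c₂ n u.1).1 := SymmetricAlgebra.lift_ι_apply _ _
  have h2 : ∀ a : QuadAlg c₁ c₂, ∀ r : ℝ, a • r = evalQuad hc a * r := fun _ _ => rfl
  obtain ⟨e, he⟩ := isUnit_tau_sub_sigma c₁ c₂ F.disc_isUnit
  have h3 := congrArg (evalQuad hc) (Ring.inverse_mul_cancel _ e.isUnit)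
  rw [he, map_mul, map_one, map_sub, evalQuad_tau, evalQuad_sigma] at h3
  have h4 : (proj c₁ c₂ n u.1).1 = Ring.inverse (tau c₁ c₂ - sigma c₁ c₂) •
      ((1 : QuadAlg c₁ c₂) ⊗ₜ[k] tauOp c₁ c₂ n u.1 - sigma c₁ c₂ ⊗ₜ[k] u.1) := rfl
  rw [h1, h4, map_smul, map_sub,
    LinearMap.liftBaseChange_tmul, LinearMap.liftBaseChange_tmul, h2, h2, h2, map_one, evalQuad_sigma,
    LinearMap.smul_apply, LinearMap.smul_apply, F.heightFun_tauOp (Classical.arbitrary ι),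
    smul_eq_mul, smul_eq_mul]
  linear_combination t * F.heightFun u.1 * h3

theorem evalSym_projSym_weightW [Nonempty ι] (hc : c₂ = -1) (t : ℝ) (g : F.W) (i : b.support) :
    F.evalSym hc t (F.projSym (F.weightW g i)) = t * F.heightFun (g.1 (F.root i)) := by
  rw [projSym_weightW, evalSym_projVec]

theorem evalSym_weightTau [Nonempty ι] [Module.Free ℤ X] (hc : c₂ = -1) (t : ℝ) (v : F.WTau)
    (i : F.FoldedIndex) :
    F.evalSym hc t (F.weightTau v i) = t * F.heightFun ((F.embedding v).1 (F.root i)) := by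
  rw [weightTau_eq, evalSym_projSym_weightW]

/-- Homogeneity: each term has `ℓ(u)` factors and each factor scales by `t`. Varying `t` thus
detects the length. -/
theorem evalSym_wordSum_weightTau [Nonempty ι] [Module.Free ℤ X] (hc : c₂ = -1) (t : ℝ)
    (x : List F.FoldedIndex) (u : F.WTau) :
    F.evalSym hc t (wordSum F.sTau F.weightTau x u) =
      t ^ length F.sTau u * F.evalSym hc 1 (wordSum F.sTau F.weightTau x u) := by
  rw [wordSum, map_subSum, map_subSum, map_weightedWord, map_weightedWord, ← subSum_smul]
  congr 1
  simp only [weightedWord_eq_map_letterWeights, evalSym_weightTau, one_mul, List.map_map]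
  rw [← map_letterWeights F.sTau (t * ·), List.map_map]
  rfl

theorem evalSym_projSym_wordSum [Nonempty ι] (hc : c₂ = -1) (t : ℝ)
    (x : List b.support) (w : F.W) :
    F.evalSym hc t (F.projSym (wordSum F.s F.weightW x w)) =
      t ^ length F.s w * F.evalSym hc 1 (F.projSym (wordSum F.s F.weightW x w)) := by
  rw [← RingHom.comp_apply, ← RingHom.comp_apply, wordSum, map_subSum, map_subSum,
    map_weightedWord, map_weightedWord, ← subSum_smul]
  congr 1
  simp only [weightedWord_eq_map_letterWeights, RingHom.comp_apply, evalSym_projSym_weightW,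
    one_mul, List.map_map]
  rw [← map_letterWeights F.s (t * ·), List.map_map]
  rfl

section Reduced

variable [Finite ι] [D.IsReduced] [Module.Free ℤ X]

theorem evalSym_projSym_wordSum_pos [Nonempty ι] (hc : c₂ = -1) {x : List b.support} {w : F.W}
    (h : BruhatLE F.s w (wordProd F.s x)) :
    0 < F.evalSym hc 1 (F.projSym (wordSum F.s F.weightW x w)) := by
  refine F.map_wordSum_pos ((F.evalSym hc 1).comp F.projSym) (fun g i hp => ?_) h
  rw [RingHom.comp_apply, evalSym_projSym_weightW, one_mul]
  exact hp

/-! ### Products over inversions -/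

/-- The positive roots which become negative under `g⁻¹`. -/
def inversions (g : F.W) : Set ι :=
  {j | 0 < F.heightFun (F.root j) ∧ F.heightFun (g.1.symm (F.root j)) < 0}

omit [Finite ι] [D.IsReduced] [Module.Free ℤ X] in
theorem inversions_one : F.inversions 1 = ∅ :=
  Set.eq_empty_of_forall_notMem fun _ h => h.1.not_gt h.2

/-- Lengthening `g` by `s_i` adds exactly the inversion `g α_i`, because `s_i` changes the sign of
no positive root but `α_i`. Products over the letters of a reduced word thereby become products over
a set depending only on the element. -/
theorem exists_inversions_mul {g : F.W} {i : b.support} (hp : F.posW g i) :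
    ∃ m, g.1 (F.root i) = F.root m ∧ m ∉ F.inversions g ∧
      F.inversions (g * F.s i) = insert m (F.inversions g) := by
  obtain ⟨m, hm⟩ := F.exists_root_of_mem g.2 i
  have hpm : 0 < F.heightFun (F.root m) := hm ▸ hp
  have hsm : g.1.symm (F.root m) = F.root i := by rw [← hm, LinearEquiv.symm_apply_apply]
  have hi := F.heightFun_simple_pos i.2
  refine ⟨m, hm, fun h => ?_, ?_⟩
  · have := h.2
    rw [hsm] at this
    exact this.not_gt hi
  ext j
  obtain ⟨p, hgp⟩ := F.exists_root_of_mem (F.W.inv_mem g.2) j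
  change g.1.symm (F.root j) = F.root p at hgp
  have hgp' : g.1 (F.root p) = F.root j := by rw [← hgp, LinearEquiv.apply_symm_apply]
  have hmem : j ∈ F.inversions (g * F.s i) ↔
      0 < F.heightFun (F.root j) ∧ F.heightFun (F.refl i (F.root p)) < 0 := by
    rw [← hgp]
    rfl
  rw [Set.mem_insert_iff, hmem]
  constructor
  · rintro ⟨h1, h2⟩
    by_cases h3 : 0 < F.heightFun (F.root p)
    · left
      have h4 := F.eq_of_refl_neg i.2 h3 h2.not_gt
      apply F.root_injective
      rw [← hgp', h4, hm]
    · right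
      refine ⟨h1, ?_⟩
      rw [hgp]
      exact F.heightFun_neg_iff.mp h3
  · rintro (rfl | ⟨h1, h2⟩)
    · refine ⟨hpm, ?_⟩
      rw [← hgp, hsm, F.refl_root_self, map_neg]
      exact neg_neg_of_pos hi
    · refine ⟨h1, ?_⟩
      rw [hgp] at h2
      obtain ⟨q, hq⟩ : ∃ q, F.refl i (F.root p) = F.root q := ⟨_, F.refl_root i p⟩
      rw [hq, ← F.heightFun_neg_iff]
      intro h3
      have hrr : F.refl i (F.root q) = F.root p := by
        rw [← hq, ← LinearEquiv.mul_apply, F.refl_refl]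
        rfl
      have h4 := F.eq_of_refl_neg i.2 h3 (by rw [hrr]; exact h2.not_gt)
      rw [h4, F.refl_root_self] at hrr
      rw [← hgp', ← hrr, map_neg, map_neg] at h1
      have : 0 < F.heightFun (g.1 (F.root i)) := hp
      linarith

theorem finprod_inversions_mul {M : Type*} [CommMonoid M] (f : UMod c₁ c₂ n → M) {g : F.W}
    {x : List b.support} (hx : F.exchangeW.Ascending g x) :
    ∏ᶠ j ∈ F.inversions (g * wordProd F.s x), f (F.root j) =
      (∏ᶠ j ∈ F.inversions g, f (F.root j)) *
        ((letterWeights F.s (fun g i => f (g.1 (F.root i))) g x).map Prod.snd).prod := by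
  induction x generalizing g with
  | nil => simp [letterWeights]
  | cons i x ih =>
    obtain ⟨m, hm, hmi, h⟩ := F.exists_inversions_mul hx.1
    rw [wordProd_cons, ← mul_assoc, ih hx.2, h,
      finprod_mem_insert _ hmi (Set.toFinite _), letterWeights, List.map_cons, List.prod_cons, hm]
    ac_rfl

-- The inversions coming from one block are `u` and `Tu`, or a single `T`-fixed vector, with `u` the
-- image of the simple root under `ι(v)`. The two hypotheses on `f` and `f'` match these cases.
omit [Finite ι] [D.IsReduced] in
theorem prod_letterWeights_foldWord {M : Type*} [CommMonoid M] {f f' : UMod c₁ c₂ n → M}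
    (hf : ∀ u, tauOp c₁ c₂ n u = u → f u = f' u)
    (hr : ∀ u, tauOp c₁ c₂ n u ≠ u → tauOp c₁ c₂ n (tauOp c₁ c₂ n u) ≠ tauOp c₁ c₂ n u →
      f u * f (tauOp c₁ c₂ n u) = f' u) (v : F.WTau) (x : List F.FoldedIndex) :
    ((letterWeights F.s (fun g i => f (g.1 (F.root i))) (F.embedding v)
        (F.foldWord x)).map Prod.snd).prod =
      ((letterWeights F.sTau (fun v i => f' ((F.embedding v).1 (F.root i))) v x).map
        Prod.snd).prod := by
  induction x generalizing v with
  | nil => rfl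
  | cons i x ih =>
    have h : F.embedding v * wordProd F.s (F.foldBlock i) = F.embedding (v * F.sTau i) := by
      rw [wordProd_foldBlock, map_mul]
    rw [foldWord_cons, letterWeights_append, List.map_append, List.prod_append, h]
    refine Eq.trans (congrArg₂ (· * ·) ?_ (ih (v * F.sTau i))) List.prod_cons.symm
    change _ = f' ((F.embedding v).1 (F.root i))
    by_cases hi : i.1 ∈ F.rat
    · rw [F.foldBlock_of_rat hi]
      have h2 : (F.embedding v * F.s ⟨i, F.index_mem_support i.2⟩).1 (F.root (F.opp i hi)) =
          tauOp c₁ c₂ n ((F.embedding v).1 (F.root i)) := by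
        change (F.embedding v).1 (F.refl i (F.root (F.opp i hi))) = _
        rw [F.refl_eq_self_of_tauForm (F.tauForm_root_opp hi), F.root_opp, F.embedding_tauOp]
      change f ((F.embedding v).1 (F.root i)) *
        (f ((F.embedding v * F.s ⟨i, F.index_mem_support i.2⟩).1 (F.root (F.opp i hi))) * 1) = _
      rw [h2, mul_one]
      apply hr
      · rw [← F.embedding_tauOp]
        exact (F.embedding v).1.injective.ne (F.disjoint_fixed_rat i hi)
      · rw [← F.embedding_tauOp, ← F.embedding_tauOp]
        exact (F.embedding v).1.injective.ne (F.disjoint_fixed_image i hi)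
    · rw [F.foldBlock_of_not_rat hi]
      refine (mul_one (f ((F.embedding v).1 (F.root i)))).trans (hf _ ?_)
      have h2 : tauOp c₁ c₂ n (F.root i) = F.root i := (i.2.resolve_right hi).2
      exact (F.embedding_tauOp v (F.root i)).symm.trans (congrArg (F.embedding v).1 h2)

/-- The product of the values of `f'` at the inversions of a reduced word of `W_τ` only depends on
the element, if `f'` comes from a function on the inversions in `W`. -/
theorem prod_letterWeights_congr {M : Type*} [CommMonoid M] {f f' : UMod c₁ c₂ n → M}
    (hf : ∀ u, tauOp c₁ c₂ n u = u → f u = f' u)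
    (hr : ∀ u, tauOp c₁ c₂ n u ≠ u → tauOp c₁ c₂ n (tauOp c₁ c₂ n u) ≠ tauOp c₁ c₂ n u →
      f u * f (tauOp c₁ c₂ n u) = f' u) {x y : List F.FoldedIndex}
    (hx : F.exchangeWTau.Ascending 1 x) (hy : F.exchangeWTau.Ascending 1 y)
    (hxy : wordProd F.sTau x = wordProd F.sTau y) :
    ((letterWeights F.sTau (fun v i => f' ((F.embedding v).1 (F.root i))) 1 x).map
        Prod.snd).prod =
      ((letterWeights F.sTau (fun v i => f' ((F.embedding v).1 (F.root i))) 1 y).map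
        Prod.snd).prod := by
  have key : ∀ {x : List F.FoldedIndex}, F.exchangeWTau.Ascending 1 x →
      ((letterWeights F.sTau (fun v i => f' ((F.embedding v).1 (F.root i))) 1 x).map
        Prod.snd).prod =
      ∏ᶠ j ∈ F.inversions (F.embedding (wordProd F.sTau x)), f (F.root j) := by
    intro x hx
    have h := F.finprod_inversions_mul f (F.ascending_foldWord hx)
    rw [F.prod_letterWeights_foldWord hf hr, map_one, one_mul, inversions_one,
      finprod_mem_empty, one_mul, wordProd_foldWord] at h
    exact h.symm
  rw [key hx, key hy, hxy]

theorem prod_heightFun_congr [Nonempty ι] {x y : List F.FoldedIndex}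
    (hx : F.exchangeWTau.Ascending 1 x) (hy : F.exchangeWTau.Ascending 1 y)
    (hxy : wordProd F.sTau x = wordProd F.sTau y) :
    0 < ((letterWeights F.sTau (fun v i => F.heightFun ((F.embedding v).1 (F.root i))) 1 x).map
        Prod.snd).prod ∧
    ((letterWeights F.sTau (fun v i => F.heightFun ((F.embedding v).1 (F.root i))) 1 x).map
        Prod.snd).prod =
      ((letterWeights F.sTau (fun v i => F.heightFun ((F.embedding v).1 (F.root i))) 1 y).map
        Prod.snd).prod := by
  classical
  have hpos : ∀ {x : List F.FoldedIndex}, F.exchangeWTau.Ascending 1 x →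
      0 < ((letterWeights F.sTau (fun v i => F.heightFun ((F.embedding v).1 (F.root i))) 1 x).map
        Prod.snd).prod := by
    intro x hx
    refine List.prod_pos fun r hr => ?_
    obtain ⟨p, hp, rfl⟩ := List.mem_map.mp hr
    exact F.exchangeWTau.forall_mem_letterWeights (q := (0 < ·)) (fun _ _ h => h) hx p hp
  -- The squares are compared first: the two inversions of a block supply two factors `h(u)`, and
  -- positivity allows taking roots at the end.
  have hsq : ∀ x : List F.FoldedIndex,
      ((letterWeights F.sTau (fun v i => F.heightFun ((F.embedding v).1 (F.root i)) ^ 2) 1 x).map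
        Prod.snd).prod =
      ((letterWeights F.sTau (fun v i => F.heightFun ((F.embedding v).1 (F.root i))) 1 x).map
        Prod.snd).prod ^ 2 := by
    intro x
    rw [← map_letterWeights F.sTau (· ^ 2), List.map_map]
    exact ((map_list_prod (powMonoidHom 2) _).trans (by rw [List.map_map]; rfl)).symm
  refine ⟨hpos hx, ?_⟩
  rw [← sq_eq_sq₀ (hpos hx).le (hpos hy).le, ← hsq, ← hsq]
  -- The factor `1/√λ` is chosen so that the values at `u` and `Tu`, of heights `h(u)` and `λ h(u)`,
  -- multiply to `h(u)²`.
  refine F.prod_letterWeights_congr (f := fun u => if tauOp c₁ c₂ n u = u then F.heightFun u ^ 2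
    else F.heightFun u / √(posRoot c₁)) (f' := fun u => F.heightFun u ^ 2)
    (fun u hu => if_pos hu) (fun u hu hu' => ?_) hx hy hxy
  rw [if_neg hu, if_neg hu', F.heightFun_tauOp (Classical.arbitrary ι), div_mul_div_comm,
    Real.mul_self_sqrt (posRoot_pos c₁).le]
  have := (posRoot_pos c₁).ne'
  field_simp

/-- A product of zeros for `T`-fixed inversions and ones for the others depends only on the element,
and it vanishes exactly when a `T`-fixed letter occurs. -/
theorem forall_mem_rat_of_wordProd_eq {x y : List F.FoldedIndex}
    (hx : F.exchangeWTau.Ascending 1 x) (hy : F.exchangeWTau.Ascending 1 y)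
    (hxy : wordProd F.sTau x = wordProd F.sTau y) (h : ∀ i ∈ x, i.1 ∈ F.rat) :
    ∀ i ∈ y, i.1 ∈ F.rat := by
  classical
  let f : UMod c₁ c₂ n → ℕ := fun u => if tauOp c₁ c₂ n u = u then 0 else 1
  have h1 := F.prod_letterWeights_congr (f := f) (f' := f) (fun _ _ => rfl)
    (fun u hu hu' => by simp only [f, if_neg hu, if_neg hu', mul_one]) hx hy hxy
  have hf : ∀ (v : F.WTau) (i : F.FoldedIndex),
      f ((F.embedding v).1 (F.root i)) = if i.1 ∈ F.rat then 1 else 0 := by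
    intro v i
    simp only [f]
    rw [← F.embedding_tauOp, (F.embedding v).1.injective.eq_iff]
    by_cases hi : i.1 ∈ F.rat
    · rw [if_pos hi, if_neg (show ¬ tauOp c₁ c₂ n (F.root i) = F.root i from F.disjoint_fixed_rat i hi)]
    · rw [if_neg hi, if_pos (i.2.resolve_right hi).2]
  have hmap : ∀ x : List F.FoldedIndex,
      (letterWeights F.sTau (fun v i => f ((F.embedding v).1 (F.root i))) 1 x).map Prod.snd =
        x.map fun i => if i.1 ∈ F.rat then 1 else 0 := by
    intro x
    simp only [hf]
    generalize (1 : F.WTau) = v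
    induction x generalizing v with
    | nil => rfl
    | cons i x ih => simp [letterWeights, ih]
  rw [hmap, hmap] at h1
  intro i hi
  by_contra hir
  have h2 : (y.map fun i : F.FoldedIndex => if i.1 ∈ F.rat then 1 else 0).prod = 0 :=
    List.prod_eq_zero (List.mem_map.mpr ⟨i, hi, if_neg hir⟩)
  rw [h2] at h1
  obtain ⟨j, hj, h3⟩ := List.mem_map.mp (List.prod_eq_zero_iff.mp h1)
  rw [if_pos (h j hj)] at h3
  exact one_ne_zero h3

end Reduced

end FoldedRep

end Folding

end

/-! ### From equality of real values back to `L` -/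

noncomputable section

namespace Folding

/-- For `m ≠ 0` a square root of `m² + 4` would lie strictly between `|m|` and `|m| + 2`, and `(|m|
+ 1)² = m² + 4` fails by parity. -/
theorem eq_zero_of_sq_eq_mul_sq_add_four {p q m : ℤ} (hm : m ≠ 0)
    (h : p ^ 2 = q ^ 2 * (m ^ 2 + 4)) : q = 0 := by
  by_contra hq
  obtain ⟨r, rfl⟩ : q ∣ p := (Int.pow_dvd_pow_iff two_ne_zero).mp ⟨_, h⟩
  have h1 : r ^ 2 = m ^ 2 + 4 := by
    rw [mul_pow] at h
    exact mul_left_cancel₀ (pow_ne_zero 2 hq) h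
  rw [← sq_abs r, ← sq_abs m] at h1
  have h2 : 0 < |m| := abs_pos.mpr hm
  have h3 := abs_nonneg r
  have h4 : |m| < |r| := by nlinarith
  have h5 : |r| < |m| + 2 := by nlinarith
  have h6 : |r| = |m| + 1 := by omega
  rw [h6] at h1
  ring_nf at h1
  omega

theorem sum_sublists_eq_of_length {B M : Type*} [AddCommMonoid M] (f : List B → M) {l : List B}
    (h : ∀ y : List B, y.Sublist l → y.length ≠ l.length → f y = 0) :
    (l.sublists'.map f).sum = f l := by
  induction l generalizing f with
  | nil => simp
  | cons p l ih =>
    rw [List.sublists'_cons, List.map_append, List.sum_append, List.map_map,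
      ih (f ∘ List.cons p) fun y hy hl => h _ (hy.cons_cons p) (by simpa using hl),
      List.sum_eq_zero, zero_add, Function.comp_apply]
    intro r hr
    obtain ⟨y, hy, rfl⟩ := List.mem_map.mp hr
    rw [List.mem_sublists'] at hy
    refine h y (hy.cons p) ?_
    have := hy.length_le
    simp only [List.length_cons]
    omega

theorem altWord_succ_eq_cons {B : Type*} (i j : B) (m : ℕ) :
    altWord i j (m + 1) = (if Even m then j else i) :: altWord i j m := by
  induction m generalizing i j with
  | zero => simp [altWord]
  | succ m ih =>
    rw [show altWord i j (m + 1 + 1) = altWord j i (m + 1) ++ [j] from rfl, ih,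
      show altWord i j (m + 1) = altWord j i m ++ [j] from rfl]
    by_cases h : Even m <;> simp [h, Nat.even_add_one]

/-- An odd braid relation says that the two generators are conjugate. -/
theorem mul_eq_mul_of_altWord_eq {B G : Type*} [Group G] {s : B → G} {i j : B} {m : ℕ}
    (hm : Odd m) (h : wordProd s (altWord i j m) = wordProd s (altWord j i m)) :
    s i * wordProd s (altWord j i (m - 1)) = wordProd s (altWord j i (m - 1)) * s j := by
  obtain ⟨r, rfl⟩ := hm
  rw [altWord_succ_eq_cons j i, if_pos (even_two_mul r),
    show altWord i j (2 * r + 1) = altWord j i (2 * r) ++ [j] from rfl, wordProd_append,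
    wordProd_singleton, wordProd_cons] at h
  exact h.symm

namespace FoldedRep

variable {k : Subring ℝ} {c₁ c₂ : k} {n : ℕ} {ι X Y : Type*}
  [AddCommGroup X] [AddCommGroup Y] {D : RootDatum ι X Y} {b : D.Base}
  (F : FoldedRep c₁ c₂ n D b)

theorem c₁_eq_zero_of_mem_fixed {i : ι} (hi : i ∈ F.fixed) : c₁ = 0 := by
  have h := F.tauOp_tauOp_root i
  rw [hi.2, hi.2, right_eq_add] at h
  have h1 := congrArg (tauForm · (F.root i)) h
  rw [tauForm_smul_left, ← zero_smul k (F.root i), tauForm_smul_left, zero_mul] at h1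
  exact (mul_eq_zero.mp h1).resolve_right (F.tauForm_root_ne_zero i)

theorem posRoot_eq_one (hc : c₁ = 0) : posRoot c₁ = 1 := by
  have h1 := posRoot_mul_self c₁
  have h2 := posRoot_pos c₁
  rw [hc] at h1 ⊢
  rw [hc] at h2
  push_cast at h1
  nlinarith

theorem mem_span_int (u : UMod c₁ c₂ n)
    (hu : u ∈ AddSubgroup.closure (Set.range F.root)) :
    u ∈ Submodule.span ℤ (Set.range fun i : b.support => F.root i) := by
  have h1 : ∀ i, F.root i ∈ Submodule.span ℤ (Set.range fun i : b.support => F.root i) := by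
    intro i
    have h2 : D.root i ∈ Submodule.span ℤ (D.root '' b.support) := by
      rw [b.span_int_root_support]
      exact Submodule.subset_span ⟨i, rfl⟩
    have h3 := Submodule.mem_map_of_mem (f := F.latticeVec.toIntLinearMap) h2
    rw [Submodule.map_span, ← Set.image_comp, Set.image_eq_range] at h3
    exact h3
  have h2 : AddSubgroup.closure (Set.range F.root) ≤
      (Submodule.span ℤ (Set.range fun i : b.support => F.root i)).toAddSubgroup := by
    rw [AddSubgroup.closure_le]
    rintro _ ⟨i, rfl⟩
    exact h1 i
  exact h2 hu

variable [Module.Free ℤ X]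

/-- The vector `T²α = c₁ Tα + α` lies in the root lattice, where `Tα` and `α` are distinct members
of the basis of simple roots; `c₁` is its coordinate at `Tα`. -/
theorem exists_int_eq_c₁ {i : ι} (hi : i ∈ F.rat) : ∃ m : ℤ, c₁ = m := by
  have h0 : ∀ u ∈ AddSubgroup.closure (Set.range F.root),
      tauOp c₁ c₂ n u ∈ AddSubgroup.closure (Set.range F.root) := fun u hu =>
    F.tauOp_rootLattice.subset ⟨u, hu, rfl⟩
  have h1 := F.mem_span_int _ (h0 _ (h0 _ (AddSubgroup.subset_closure ⟨i, rfl⟩)))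
  obtain ⟨z, hz⟩ := Submodule.mem_span_range_iff_exists_fun ℤ |>.mp h1
  classical
  let i' : b.support := ⟨i, F.mem_support_of_mem_rat hi⟩
  let o : b.support := ⟨F.opp i hi, F.opp_mem_support hi⟩
  have hio : o ≠ i' := by
    intro h
    apply F.disjoint_fixed_rat i hi
    change tauOp c₁ c₂ n (F.root i) = F.root i
    rw [← F.root_opp i hi]
    exact congrArg F.root (congrArg Subtype.val h)
  have h2 : ∑ j, ((z j : ℤ) : k) • F.root (j : b.support) =
      ∑ j, (Pi.single o c₁ + Pi.single i' (1 : k) : b.support → k) j • F.root (j : b.support) := by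
    simp only [Int.cast_smul_eq_zsmul, hz, Pi.add_apply, add_smul, Finset.sum_add_distrib]
    rw [Finset.sum_eq_single o, Finset.sum_eq_single i', Pi.single_eq_same, Pi.single_eq_same,
      one_smul, tauOp_tauOp_root, F.root_opp]
    · exact fun j _ hj => by rw [Pi.single_eq_of_ne hj, zero_smul]
    · simp
    · exact fun j _ hj => by rw [Pi.single_eq_of_ne hj, zero_smul]
    · simp
  have h3 := congrFun (F.linearIndependent_root.fintypeLinearCombination_injective
    (a₁ := fun j => ((z j : ℤ) : k)) (by simpa only [Fintype.linearCombination_apply] using h2)) o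
  refine ⟨z o, ?_⟩
  rw [h3, Pi.add_apply, Pi.single_eq_same, Pi.single_eq_of_ne hio, add_zero]

theorem foldCoeff_int (hc : c₂ = -1) {m : ℤ} (hm : c₁ = m) (x : List F.FoldedIndex) (w : F.W) :
    ∃ p q : ℤ, QuadAlg.re (F.foldCoeff x w) = p ∧ QuadAlg.im (F.foldCoeff x w) = q := by
  induction x generalizing w with
  | nil =>
    rw [foldCoeff]
    split_ifs
    · exact ⟨1, 0, by push_cast; rfl, by push_cast; rfl⟩
    · exact ⟨0, 0, by simp, by simp⟩
  | cons i x ih =>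
    by_cases hi : i.1 ∈ F.rat
    · obtain ⟨p, q, hp, hq⟩ := ih ((F.refl₁ i)⁻¹ * w)
      obtain ⟨p', q', hp', hq'⟩ := ih ((F.refl₂ hi)⁻¹ * w)
      have h1 : ∀ a : QuadAlg c₁ c₂, QuadAlg.re (tau c₁ c₂ * a) = QuadAlg.im a := by
        intro a
        change 0 * QuadAlg.re a + -c₂ * 1 * QuadAlg.im a = _
        linear_combination (-QuadAlg.im a) * hc
      have h2 : ∀ a : QuadAlg c₁ c₂,
          QuadAlg.im (tau c₁ c₂ * a) = QuadAlg.re a + c₁ * QuadAlg.im a := by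
        intro a
        change 0 * QuadAlg.im a + 1 * QuadAlg.re a + c₁ * 1 * QuadAlg.im a = _
        ring
      refine ⟨p + q', q + (p' + m * q'), ?_, ?_⟩
      · rw [F.foldCoeff_cons_of_rat hi, map_add, h1, hp, hq']
        push_cast
        rfl
      · rw [F.foldCoeff_cons_of_rat hi, map_add, h2, hq, hp', hq', hm]
        push_cast
        rfl
    · rw [F.foldCoeff_cons_of_not_rat hi]
      exact ih _

-- Integral elements with equal values give an integral relation `p + q λ = 0`. Completing the
-- square makes it `(2p + qm)² = q²(m² + 4)`, so `q = 0`.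
omit [AddCommGroup X] [AddCommGroup Y] [Module.Free ℤ X] in
theorem _root_.Folding.quadAlg_eq_of_evalQuad_eq (hc : c₂ = -1) {m : ℤ} (hm : c₁ = m)
    (hm0 : c₁ ≠ 0) {a a' : QuadAlg c₁ c₂}
    (ha : ∃ p q : ℤ, QuadAlg.re a = p ∧ QuadAlg.im a = q)
    (ha' : ∃ p q : ℤ, QuadAlg.re a' = p ∧ QuadAlg.im a' = q)
    (h : evalQuad hc a = evalQuad hc a') : a = a' := by
  obtain ⟨p, q, hp, hq⟩ := ha
  obtain ⟨p', q', hp', hq'⟩ := ha'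
  rw [evalQuad_apply, evalQuad_apply, hp, hq, hp', hq'] at h
  have h1 := posRoot_mul_self c₁
  have hm' : (c₁ : ℝ) = m := by rw [hm]; push_cast; rfl
  rw [hm'] at h1
  push_cast at h
  have h2 : ((2 * (p - p') + (q - q') * m : ℤ) : ℝ) ^ 2 =
      (((q - q') ^ 2 * (m ^ 2 + 4) : ℤ) : ℝ) := by
    have h3 : (p - p' : ℝ) = -(q - q') * posRoot c₁ := by linear_combination h
    push_cast
    rw [h3]
    linear_combination (4 * (q - q' : ℝ) ^ 2) * h1
  have h3 := eq_zero_of_sq_eq_mul_sq_add_four (m := m) (p := 2 * (p - p') + (q - q') * m)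
    (q := q - q') (by rintro rfl; exact hm0 (by simpa using hm)) (by exact_mod_cast h2)
  have h4 : q = q' := by omega
  subst h4
  have h5 : (p : ℝ) = p' := by linear_combination h
  have h6 : p = p' := by exact_mod_cast h5
  subst h6
  exact QuadraticAlgebra.ext (hp.trans hp'.symm) (hq.trans hq'.symm)

/-- For `c₁ = 0` one has `λ = 1`, so the real value of `r + tτ` is `r + t`; on a vector fixed by `τ`
this sum is all that acts. -/
theorem _root_.Folding.smul_eq_smul_of_tau_smul {M : Type*} [AddCommGroup M]
    [Module (QuadAlg c₁ c₂) M] (hc : c₂ = -1) (hc₁ : c₁ = 0) {a a' : QuadAlg c₁ c₂} {x : M}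
    (hx : tau c₁ c₂ • x = x) (h : evalQuad hc a = evalQuad hc a') : a • x = a' • x := by
  have h1 : ∀ a : QuadAlg c₁ c₂, a • x = algebraMap k (QuadAlg c₁ c₂) (QuadAlg.re a + QuadAlg.im a) • x := by
    intro a
    have : a = algebraMap k _ (QuadAlg.re a) + algebraMap k _ (QuadAlg.im a) * tau c₁ c₂ := by
      rw [← Algebra.smul_def]
      apply QuadraticAlgebra.ext
      · change QuadAlg.re a = QuadAlg.re a + QuadAlg.im a * 0
        ring
      · change QuadAlg.im a = 0 + QuadAlg.im a * 1
        ring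
    nth_rw 1 [this]
    rw [add_smul, mul_smul, hx, ← add_smul, ← map_add]
  rw [evalQuad_apply, evalQuad_apply, posRoot_eq_one hc₁, mul_one, mul_one] at h
  rw [h1 a, h1 a']
  congr 2
  exact_mod_cast h

/-! ### Products of simple roots and their images -/

open Classical in
/-- The element `τ` for the simple roots in `T(Δ_rat)`, and `1` for the others. -/
def letterCoeff (j : b.support) : QuadAlg c₁ c₂ :=
  if ∃ i, ∃ hi : i ∈ F.rat, j.1 = F.opp i hi then tau c₁ c₂ else 1

omit [Module.Free ℤ X] in
theorem letterCoeff_of_rat {j : b.support} (hj : j.1 ∈ F.rat) : F.letterCoeff j = 1 := by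
  refine if_neg ?_
  rintro ⟨i, hi, h⟩
  refine F.disjoint_rat_image i hi j hj ?_
  change tauOp c₁ c₂ n (F.root i) = F.root j
  rw [h, F.root_opp]

omit [Module.Free ℤ X] in
theorem letterCoeff_of_opp {j : b.support} {i : ι} {hi : i ∈ F.rat} (hj : j.1 = F.opp i hi) :
    F.letterCoeff j = tau c₁ c₂ := if_pos ⟨i, hi, hj⟩

/-- The coefficient is a sum over choices of one letter per block with product `w`. The factor `ρ`
carries the letters already chosen, so that the induction sees complete words. -/
theorem foldCoeff_eq_nsmul (ε : QuadAlg c₁ c₂) {x : List F.FoldedIndex}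
    (hx : ∀ i ∈ x, i.1 ∈ F.rat) (w : F.W) (ρ : QuadAlg c₁ c₂)
    (h : ∀ y : List b.support, List.Forall₂ (fun i j => j ∈ F.foldBlock i) x y →
      wordProd F.s y = w → ρ * (y.map F.letterCoeff).prod = ε) :
    ∃ N : ℕ, ρ * F.foldCoeff x w = N • ε := by
  induction x generalizing w ρ with
  | nil =>
    by_cases hw : w = 1
    · refine ⟨1, ?_⟩
      rw [← h [] .nil (by simp [hw])]
      simp [foldCoeff, hw]
    · exact ⟨0, by simp [foldCoeff, hw]⟩
  | cons i x ih =>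
    rw [List.forall_mem_cons] at hx
    obtain ⟨N, hN⟩ := ih hx.2 ((F.refl₁ i)⁻¹ * w) ρ fun y hy hp => by
      rw [← h (⟨i, F.index_mem_support i.2⟩ :: y) (.cons (by simp [F.foldBlock_of_rat hx.1]) hy)
        (by rw [wordProd_cons, hp, mul_inv_cancel_left]), List.map_cons, List.prod_cons,
        F.letterCoeff_of_rat hx.1, one_mul]
    obtain ⟨N', hN'⟩ := ih hx.2 ((F.refl₂ hx.1)⁻¹ * w) (ρ * tau c₁ c₂) fun y hy hp => by
      rw [← h (⟨F.opp i hx.1, F.opp_mem_support hx.1⟩ :: y)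
        (.cons (by simp [F.foldBlock_of_rat hx.1]) hy)
        (by rw [wordProd_cons, hp, mul_inv_cancel_left]), List.map_cons, List.prod_cons,
        F.letterCoeff_of_opp (hi := hx.1) rfl, mul_assoc]
    exact ⟨N + N', by rw [F.foldCoeff_cons_of_rat hx.1, mul_add, hN, ← mul_assoc, hN', add_smul]⟩

section Reduced

variable [Finite ι] [D.IsReduced]

/-- The root `q α_j` is negated by `s_i`, so it is `α_i` up to sign, and `W` preserves the form. -/
theorem tauForm_eq_of_conj {i j : b.support} {q : F.W} (h : F.s i * q = q * F.s j) :
    tauForm (F.root i) (F.root i) = tauForm (F.root j) (F.root j) := by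
  obtain ⟨m, hm⟩ := F.exists_root_of_mem q.2 j
  have h1 : F.refl i (F.root m) = -F.root m := by
    have := congrArg (fun g : F.W => g.1 (F.root j)) h
    change F.refl i (q.1 (F.root j)) = q.1 (F.refl j (F.root j)) at this
    rwa [F.refl_root_self, map_neg, hm] at this
  rw [← F.tauForm_apply_apply q.2 (F.root j) (F.root j), hm]
  by_cases hp : 0 < F.heightFun (F.root m)
  · rw [F.eq_of_refl_neg i.2 hp]
    rw [h1, map_neg]
    linarith
  · have h2 := F.refl_root m m
    rw [F.refl_root_self] at h2
    have h3 := F.heightFun_neg_iff.mp hp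
    have h4 := F.eq_of_refl_neg (j := D.reflectionPerm m m) i.2
      (by rw [← h2, map_neg]; linarith) (by rw [← h2, map_neg, h1, neg_neg]; exact hp)
    rw [← h4, ← F.refl_root, F.tauForm_refl]

/-- Commuting conjugate generators, with a conjugating element in the group they generate, would
coincide. -/
theorem ne_of_orthogonal {i j : b.support} {m : ℕ} (hm : Odd m)
    (h0 : tauForm (F.root i) (F.root j) = 0) :
    wordProd F.s (altWord i j m) ≠ wordProd F.s (altWord j i m) := by
  intro h
  have h1 := mul_eq_mul_of_altWord_eq hm h
  have hcomm : Commute (wordProd F.s (altWord j i (m - 1))) (F.s j) := by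
    refine (Commute.list_prod_right _ _ fun g hg => ?_).symm
    obtain ⟨a, ha, rfl⟩ := List.mem_map.mp hg
    rcases ExchangeSystem.mem_altWord ha with rfl | rfl
    · exact Commute.refl _
    · exact Subtype.ext (F.refl_comm_of_tauForm h0).symm
  rw [hcomm.eq] at h1
  have h2 : F.refl i = F.refl j := congrArg Subtype.val (mul_right_cancel h1)
  have h3 := F.refl_eq_self_of_tauForm h0
  rw [h2, F.refl_root_self] at h3
  have h4 := congrArg F.heightFun h3
  rw [map_neg] at h4
  have := F.heightFun_simple_pos j.2
  linarith

/-- The simple roots in `Δ_rat` and their images. -/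
def ratOrOpp : Set b.support := {j | j.1 ∈ F.rat ∨ ∃ i, ∃ hi : i ∈ F.rat, j.1 = F.opp i hi}

/-- An odd braid relation between `Δ_rat` and `T(Δ_rat)` would make the roots equally long, hence
orthogonal by assumption, hence not linked by an odd relation. So the coefficient is an invariant of
reduced words in the sense of `sum_eq_of_reduced`. -/
theorem letterCoeff_eq_of_altWord_eq
    (hgood : ∀ i ∈ F.rat, ∀ j ∈ F.rat, dot (F.root i) (F.root i) = dot (F.root j) (F.root j) →
      dot (F.root i) (tauOp c₁ c₂ n (F.root j)) = 0)
    {i j : b.support} (hi : i ∈ F.ratOrOpp) (hj : j ∈ F.ratOrOpp) {m : ℕ} (hm : Odd m)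
    (h : wordProd F.s (altWord i j m) = wordProd F.s (altWord j i m)) :
    F.letterCoeff i = F.letterCoeff j := by
  have key : ∀ {i j : b.support}, i.1 ∈ F.rat → (∃ l, ∃ hl : l ∈ F.rat, j.1 = F.opp l hl) →
      wordProd F.s (altWord i j m) ≠ wordProd F.s (altWord j i m) := by
    rintro i j hi ⟨l, hl, hjl⟩ h
    refine F.ne_of_orthogonal hm ?_ h
    have h1 := F.tauForm_eq_of_conj (mul_eq_mul_of_altWord_eq hm h)
    rw [hjl, F.tauForm_opp_opp, F.tauForm_eq_dot, F.tauForm_eq_dot] at h1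
    rw [hjl, F.root_opp, F.tauForm_eq_dot]
    exact hgood i hi l hl h1
  rcases hi with hi | hi <;> rcases hj with hj | hj
  · rw [F.letterCoeff_of_rat hi, F.letterCoeff_of_rat hj]
  · exact absurd h (key hi hj)
  · exact absurd h.symm (key hj hi)
  · obtain ⟨l, hl, hil⟩ := hi
    obtain ⟨l', hl', hjl⟩ := hj
    rw [F.letterCoeff_of_opp hil, F.letterCoeff_of_opp hjl]

theorem foldCoeff_eq_of_forall_mem_rat (hc : c₂ = -1) (hc₁ : c₁ = 0)
    (hgood : ∀ i ∈ F.rat, ∀ j ∈ F.rat, dot (F.root i) (F.root i) = dot (F.root j) (F.root j) →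
      dot (F.root i) (tauOp c₁ c₂ n (F.root j)) = 0)
    {x x' : List F.FoldedIndex} {w : F.W} (hx : ∀ i ∈ x, i.1 ∈ F.rat) (hx' : ∀ i ∈ x', i.1 ∈ F.rat)
    (hl : x.length = length F.s w) (hl' : x'.length = length F.s w)
    (h : evalQuad hc (F.foldCoeff x w) = evalQuad hc (F.foldCoeff x' w)) :
    F.foldCoeff x w = F.foldCoeff x' w := by
  have hev : ∀ j, evalQuad hc (F.letterCoeff j) = 1 := by
    intro j
    rw [letterCoeff]
    split_ifs
    · rw [evalQuad_tau, posRoot_eq_one hc₁]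
    · exact map_one _
  have hJ : ∀ {x : List F.FoldedIndex}, (∀ i ∈ x, i.1 ∈ F.rat) → ∀ {y : List b.support},
      List.Forall₂ (fun i j => j ∈ F.foldBlock i) x y → ∀ j ∈ y, j ∈ F.ratOrOpp := by
    intro x hx y hy
    induction hy with
    | nil => simp
    | @cons i j x y hij _ ih =>
      rw [List.forall_mem_cons] at hx ⊢
      refine ⟨?_, ih hx.2⟩
      rw [F.foldBlock_of_rat hx.1, List.mem_pair] at hij
      rcases hij with rfl | rfl
      · exact .inl hx.1
      · exact .inr ⟨i, hx.1, rfl⟩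
  -- All reduced words of `w` in these letters have the same product `ε` of coefficients. Its real
  -- value is `1` because `λ = 1`, so a multiple `N • ε` is determined by its value `N`.
  obtain ⟨ε, hε, hε1⟩ : ∃ ε : QuadAlg c₁ c₂, evalQuad hc ε = 1 ∧
      ∀ y : List b.support, y.length = length F.s w → wordProd F.s y = w →
        (∀ j ∈ y, j ∈ F.ratOrOpp) → (y.map F.letterCoeff).prod = ε := by
    by_cases hy0 : ∃ y : List b.support, y.length = length F.s w ∧ wordProd F.s y = w ∧
        ∀ j ∈ y, j ∈ F.ratOrOpp
    · obtain ⟨y0, hyl, hyp, hyJ⟩ := hy0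
      refine ⟨(y0.map F.letterCoeff).prod, ?_, fun y hl' hp hJ => ?_⟩
      · rw [map_list_prod, List.prod_eq_one]
        intro r hr
        obtain ⟨a, ha, rfl⟩ := List.mem_map.mp hr
        obtain ⟨j, -, rfl⟩ := List.mem_map.mp ha
        exact hev j
      · exact F.exchangeW.sum_eq_of_reduced (M := Additive (QuadAlg c₁ c₂))
          (fun j => Additive.ofMul (F.letterCoeff j)) F.ratOrOpp
          (fun i hi j hj m hm h => F.letterCoeff_eq_of_altWord_eq hgood hi hj hm h) _ y y0 hl' hyl
          (hp.trans hyp.symm) (by rw [hp]) hJ hyJ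
    · exact ⟨1, map_one _, fun y hl' hp hJ => absurd ⟨y, hl', hp, hJ⟩ hy0⟩
  have main : ∀ {x : List F.FoldedIndex}, (∀ i ∈ x, i.1 ∈ F.rat) → x.length = length F.s w →
      ∃ N : ℕ, F.foldCoeff x w = N • ε := by
    intro x hx hl
    obtain ⟨N, hN⟩ := F.foldCoeff_eq_nsmul ε hx w 1 fun y hy hp => by
      rw [one_mul]
      exact hε1 y (hy.length_eq.symm.trans hl) hp (hJ hx hy)
    exact ⟨N, by rw [← hN, one_mul]⟩
  obtain ⟨N, hN⟩ := main hx hl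
  obtain ⟨N', hN'⟩ := main hx' hl'
  rw [hN, hN', map_nsmul, map_nsmul, hε, nsmul_one, nsmul_one] at h
  rw [hN, hN', Nat.cast_injective h]

end Reduced

end FoldedRep

end Folding

end

/-! ### Comparison of the two classes and the main theorem -/

noncomputable section

namespace Folding

namespace FoldedRep

variable {k : Subring ℝ} {c₁ c₂ : k} {n : ℕ} {ι X Y : Type*}
  [AddCommGroup X] [AddCommGroup Y] {D : RootDatum ι X Y} {b : D.Base}
  (F : FoldedRep c₁ c₂ n D b) [Module.Free ℤ X] [Finite ι] [D.IsReduced]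

theorem evalSym_schubert [Nonempty ι] (hc : c₂ = -1) (t : ℝ) (w g : F.W) :
    F.evalSym hc t (F.projSym (F.schubert w g)) =
      t ^ length F.s w * F.evalSym hc 1 (F.projSym (F.schubert w g)) := by
  obtain ⟨x, rfl⟩ := F.exchangeW.exists_word g
  rw [F.schubert_eq, evalSym_projSym_wordSum]

theorem evalSym_schubert_pos [Nonempty ι] (hc : c₂ = -1) {w g : F.W} (h : BruhatLE F.s w g) :
    0 < F.evalSym hc 1 (F.projSym (F.schubert w g)) := by
  obtain ⟨x, rfl⟩ := F.exchangeW.exists_word g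
  rw [F.schubert_eq]
  exact F.evalSym_projSym_wordSum_pos hc h

omit [Module.Free ℤ X] [Finite ι] [D.IsReduced] in
theorem schubert_eq_zero {w g : F.W} (h : ¬ BruhatLE F.s w g) : F.schubert w g = 0 := if_neg h

omit [Module.Free ℤ X] [Finite ι] [D.IsReduced] in
theorem schubertTau_eq_zero {u v : F.WTau} (h : ¬ BruhatLE F.sTau u v) :
    F.schubertTau u v = 0 := if_neg h

theorem exists_schubertTau_eq (v : F.WTau) : ∃ x, wordProd F.sTau x = v ∧
    ∀ u, BruhatLE F.sTau u v → F.schubertTau u v = wordSum F.sTau F.weightTau x u := by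
  refine ⟨Classical.epsilon fun x => wordProd F.sTau x = v,
    Classical.epsilon_spec (F.exchangeWTau.exists_word v), fun u h => ?_⟩
  rw [schubertTau, Folding.schubert, if_pos h, schubertSum_eq_subSum]
  rfl

theorem evalSym_schubertTau [Nonempty ι] (hc : c₂ = -1) (t : ℝ) (u v : F.WTau) :
    F.evalSym hc t (F.schubertTau u v) =
      t ^ length F.sTau u * F.evalSym hc 1 (F.schubertTau u v) := by
  by_cases h : BruhatLE F.sTau u v
  · obtain ⟨x, -, hx⟩ := F.exists_schubertTau_eq v
    rw [hx u h, evalSym_wordSum_weightTau]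
  · rw [F.schubertTau_eq_zero h, map_zero, map_zero, mul_zero]

section Folding

variable {P : Set ι} (hP : P ⊆ b.support)
  (hPT : (Submodule.span k (F.root '' P)).map (tauOp c₁ c₂ n) = Submodule.span k (F.root '' P))
  {u : F.WTau} {w : F.W} (hw : w ∈ F.WP P) (hl : length F.s w = length F.sTau u)
  (hC : ∀ u' ∈ F.WTauP P, ¬ BruhatLE F.sTau u u' → ¬ BruhatLE F.s w (F.embedding u'))
include hP hPT hw hl hC

theorem wordProd_eq_of_foldSum_ne_zero {A : Type*} [CommRing A] [Algebra (QuadAlg c₁ c₂) A]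
    {l : List (F.FoldedIndex × A)} (h : F.foldSum l (length F.s w) w ≠ 0) :
    l.length = length F.sTau u ∧ wordProd F.sTau (l.map Prod.fst) = u := by
  obtain ⟨h1, y, hy, hyw⟩ := F.exists_sublist_of_foldSum_ne_zero h
  rw [hl] at h1
  obtain ⟨h2, h3, -⟩ := F.wordProd_eq_of_sublist_foldWord hP hPT hw hC
    (by rw [List.length_map]; exact_mod_cast h1) hy hyw
  rw [List.length_map] at h2
  exact ⟨h2, h3⟩

theorem projSym_wordSum_foldWord_of_length {x : List F.FoldedIndex}
    (hx : x.length = length F.sTau u) :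
    F.projSym (wordSum F.s F.weightW (F.foldWord x) w) =
      F.foldCoeff x w • ((letterWeights F.sTau F.weightTau 1 x).map Prod.snd).prod := by
  have hlen : (letterWeights F.sTau F.weightTau 1 x).length = length F.sTau u := by
    rw [← hx, ← List.length_map Prod.fst, map_fst_letterWeights]
  rw [projSym_wordSum_foldWord, sum_sublists_eq_of_length]
  · have h := F.foldSum_length (letterWeights F.sTau F.weightTau 1 x) w
    rwa [hlen, ← hl, map_fst_letterWeights] at h
  · intro y _ hyl
    by_contra h
    exact hyl ((F.wordProd_eq_of_foldSum_ne_zero hP hPT hw hl hC h).1.trans hlen.symm)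

theorem evalSym_wordSum_foldWord [Nonempty ι] (hc : c₂ = -1) {x : List F.FoldedIndex}
    (hx : x.length = length F.sTau u) :
    F.evalSym hc 1 (F.projSym (wordSum F.s F.weightW (F.foldWord x) w)) =
      evalQuad hc (F.foldCoeff x w) * ((letterWeights F.sTau
        (fun v i => F.heightFun ((F.embedding v).1 (F.root i))) 1 x).map Prod.snd).prod := by
  rw [F.projSym_wordSum_foldWord_of_length hP hPT hw hl hC hx, evalSym_smul, map_list_prod,
    List.map_map]
  congr 2
  have h := congrArg (List.map Prod.snd)
    (map_letterWeights F.sTau (F.evalSym hc 1) F.weightTau 1 x)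
  simp only [evalSym_weightTau, one_mul, List.map_map] at h
  exact h

/-- The real value of the folded class at `ι(u)` is the value of the coefficient times a positive
product of heights. The class and the product do not depend on the reduced word, so neither does the
remaining factor. -/
theorem evalQuad_foldCoeff_eq [Nonempty ι] (hc : c₂ = -1) {x y : List F.FoldedIndex}
    (hx : x.length = length F.sTau u) (hxu : wordProd F.sTau x = u)
    (hy : y.length = length F.sTau u) (hyu : wordProd F.sTau y = u) :
    evalQuad hc (F.foldCoeff x w) = evalQuad hc (F.foldCoeff y w) := by
  have h1 : F.exchangeWTau.Ascending 1 x :=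
    F.exchangeWTau.ascending_one_iff.mpr (by rw [hxu, hx])
  have h2 : F.exchangeWTau.Ascending 1 y :=
    F.exchangeWTau.ascending_one_iff.mpr (by rw [hyu, hy])
  obtain ⟨h3, h4⟩ := F.prod_heightFun_congr h1 h2 (hxu.trans hyu.symm)
  have h5 : wordSum F.s F.weightW (F.foldWord x) w = wordSum F.s F.weightW (F.foldWord y) w :=
    F.wordSum_congr (by rw [wordProd_foldWord, wordProd_foldWord, hxu, hyu]) w
  have h6 := congrArg (fun a => F.evalSym hc 1 (F.projSym a)) h5
  rw [F.evalSym_wordSum_foldWord hP hPT hw hl hC hc hx,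
    F.evalSym_wordSum_foldWord hP hPT hw hl hC hc hy, ← h4] at h6
  exact mul_right_cancel₀ h3.ne' h6

/-- The coefficient of the product of the weights of a reduced word of `u` does not depend on
the word. -/
theorem foldCoeff_smul_prod_eq [Nonempty ι] (hc : c₂ = -1)
    (hgood : c₁ = 0 → ∀ i ∈ F.rat, ∀ j ∈ F.rat,
      dot (F.root i) (F.root i) = dot (F.root j) (F.root j) →
      dot (F.root i) (tauOp c₁ c₂ n (F.root j)) = 0)
    {x : List F.FoldedIndex} (hx : x.length = length F.sTau u) (hxu : wordProd F.sTau x = u)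
    {l : List (F.FoldedIndex × SymmetricAlgebra (QuadAlg c₁ c₂) F.ULatTau)}
    (hll : l.length = length F.sTau u) (hlu : wordProd F.sTau (l.map Prod.fst) = u)
    (hweight : ∀ p ∈ l, ∃ v, p.2 = F.weightTau v p.1) :
    F.foldCoeff (l.map Prod.fst) w • (l.map Prod.snd).prod =
      F.foldCoeff x w • (l.map Prod.snd).prod := by
  have hll' : (l.map Prod.fst).length = length F.sTau u := by rw [List.length_map, hll]
  have hev := F.evalQuad_foldCoeff_eq hP hPT hw hl hC hc hll' hlu hx hxu
  by_cases hc₁ : c₁ = 0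
  · by_cases hr : ∀ i ∈ l.map Prod.fst, i.1 ∈ F.rat
    · have hr' := F.forall_mem_rat_of_wordProd_eq
        (F.exchangeWTau.ascending_one_iff.mpr (by rw [hlu, hll']))
        (F.exchangeWTau.ascending_one_iff.mpr (by rw [hxu, hx])) (hlu.trans hxu.symm) hr
      rw [F.foldCoeff_eq_of_forall_mem_rat hc hc₁ (hgood hc₁) hr hr' (hll'.trans hl.symm)
        (hx.trans hl.symm) hev]
    -- A `T`-fixed letter makes one factor of the product, and so the whole product, invariant under
    -- `τ`.
    · refine smul_eq_smul_of_tau_smul hc hc₁ ?_ hev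
      push Not at hr
      obtain ⟨i, hi, hir⟩ := hr
      obtain ⟨p, hp, rfl⟩ := List.mem_map.mp hi
      obtain ⟨v, hv⟩ := hweight p hp
      obtain ⟨r, hr⟩ := List.dvd_prod (List.mem_map_of_mem (f := Prod.snd) hp)
      rw [hr, ← smul_mul_assoc, hv, F.tau_smul_weightTau_of_not_rat v hir]
  · congr 1
    -- The empty word is separate because integrality of `c₁` is deduced from a letter in `Δ_rat`;
    -- for `c₁ ≠ 0` every letter is of this kind.
    rcases l with _ | ⟨p, l⟩
    · rw [List.length_nil] at hll
      rw [List.length_eq_zero_iff.mp (hx.trans hll.symm)]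
      rfl
    · have hp : p.1.1 ∈ F.rat :=
        p.1.2.resolve_left fun h => hc₁ (F.c₁_eq_zero_of_mem_fixed h)
      obtain ⟨m, hm⟩ := F.exists_int_eq_c₁ hp
      exact quadAlg_eq_of_evalQuad_eq hc hm hc₁ (F.foldCoeff_int hc hm _ w)
        (F.foldCoeff_int hc hm _ w) hev

/-- Both sides are sums over the same sublists of weighted letters. Those which are not reduced
words of `u` give zero on either side, and the others agree by `foldCoeff_smul_prod_eq`. -/
theorem projSym_wordSum_eq_smul [Nonempty ι] (hc : c₂ = -1)
    (hgood : c₁ = 0 → ∀ i ∈ F.rat, ∀ j ∈ F.rat,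
      dot (F.root i) (F.root i) = dot (F.root j) (F.root j) →
      dot (F.root i) (tauOp c₁ c₂ n (F.root j)) = 0)
    {x : List F.FoldedIndex} (hx : x.length = length F.sTau u) (hxu : wordProd F.sTau x = u)
    (y : List F.FoldedIndex) :
    F.projSym (wordSum F.s F.weightW (F.foldWord y) w) =
      F.foldCoeff x w • wordSum F.sTau F.weightTau y u := by
  rw [projSym_wordSum_foldWord, wordSum, weightedWord_eq_map_letterWeights,
    subSum_eq_sum_sublists, List.smul_sum, List.map_map]
  congr 1
  refine List.map_congr_left fun l hl' => ?_
  rw [List.mem_sublists'] at hl'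
  rw [Function.comp_apply]
  split_ifs with h
  · have h1 : l.length = length F.sTau u := by exact_mod_cast h.1
    rw [← F.foldCoeff_smul_prod_eq hP hPT hw hl hC hc hgood hx hxu h1 h.2
      fun p hp => exists_of_mem_letterWeights F.sTau (hl'.mem hp), ← foldSum_length, hl, h1]
  · rw [smul_zero]
    by_contra h1
    have h2 := F.wordProd_eq_of_foldSum_ne_zero hP hPT hw hl hC h1
    exact h ⟨by exact_mod_cast h2.1, h2.2⟩

end Folding

end FoldedRep

end Folding

end

theorem mainTheorem2 {k : Subring ℝ} {c₁ c₂ : k} {n : ℕ} {ι X Y : Type*}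
    [Finite ι] [Nonempty ι] [AddCommGroup X] [AddCommGroup Y]
    [Module.Finite ℤ X] [Module.Free ℤ X]
    (D : RootDatum ι X Y) [D.IsReduced] (b : D.Base) (F : Folding.FoldedRep c₁ c₂ n D b)
    (hgood : c₁ = 0 → ∀ i ∈ F.rat, ∀ j ∈ F.rat,
      Folding.dot (F.root i) (F.root i) = Folding.dot (F.root j) (F.root j) →
      Folding.dot (F.root i) (Folding.tauOp c₁ c₂ n (F.root j)) = 0)
    (P : Set ι) (hP : P ⊆ b.support)
    (hPT : (Submodule.span k (F.root '' P)).map (Folding.tauOp c₁ c₂ n) =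
      Submodule.span k (F.root '' P))
    (u : F.WTau) (hu : u ∈ F.WTauP P) (w : F.W) (hw : w ∈ F.WP P) :
    (∃ c : Folding.QuadAlg c₁ c₂, c ≠ 0 ∧
        F.foldingMap P (F.schubert w) = fun v => c • F.schubertTau u v.1) ↔
      (Folding.length F.s w = Folding.length F.sTau u ∧
        Folding.BruhatLE F.s w (F.embedding u) ∧
        ∀ u' ∈ F.WTauP P, ¬ Folding.BruhatLE F.sTau u u' →
          ¬ Folding.BruhatLE F.s w (F.embedding u')) := by
  have hc : c₂ = -1 := F.c₂_eq_neg_one (Classical.arbitrary ι)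
  obtain ⟨y, hyl, hyw⟩ := F.exchangeW.exists_reduced w
  obtain ⟨z, hzl, hz⟩ := F.exists_sublist_foldWord y
  constructor
  · rintro ⟨c, -, h⟩
    have h1 : ∀ v ∈ F.WTauP P, F.projSym (F.schubert w (F.embedding v)) = c • F.schubertTau u v :=
      fun v hv => congrFun h ⟨v, hv⟩
    have hC : ∀ u' ∈ F.WTauP P, ¬ Folding.BruhatLE F.sTau u u' →
        ¬ Folding.BruhatLE F.s w (F.embedding u') := by
      -- At such a point the right-hand class vanishes, while the left one has a positive real
      -- value.
      intro u' hu' hle hwu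
      have h2 := F.evalSym_schubert_pos hc hwu
      rw [h1 u' hu', F.schubertTau_eq_zero hle, smul_zero, map_zero] at h2
      exact h2.false
    have hl : Folding.length F.s w = Folding.length F.sTau u := by
      obtain ⟨-, -, v, hv, -, hwv⟩ := F.exists_le_embedding_of_mem_WP hP hPT hw hz hyw
      have h2 := F.evalSym_schubert_pos hc hwv
      -- At a point where the value is nonzero, scaling heights by `2` multiplies the two sides by
      -- `2 ^ ℓ(w)` and `2 ^ ℓ_τ(u)`.
      have h3 := F.evalSym_schubert hc 2 w (F.embedding v)
      rw [h1 v hv, Folding.FoldedRep.evalSym_smul] at h2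
      rw [h1 v hv, Folding.FoldedRep.evalSym_smul, Folding.FoldedRep.evalSym_smul,
        F.evalSym_schubertTau hc 2, mul_left_comm] at h3
      exact (pow_right_injective₀ (by norm_num) (by norm_num)
        (mul_right_cancel₀ h2.ne' h3)).symm
    exact ⟨hl, (F.wordProd_eq_of_sublist_foldWord hP hPT hw hC
      (by rw [hzl, hyl, hl]) hz hyw).2.2, hC⟩
  · rintro ⟨hl, hle, hC⟩
    obtain ⟨x, hx, hxu⟩ := F.exchangeWTau.exists_reduced u
    refine ⟨F.foldCoeff x w, fun h0 => ?_, ?_⟩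
    -- The constant cannot vanish, since by (C2) the folded class has a positive real value at `u`.
    · have h1 := F.evalSym_projSym_wordSum_pos hc (x := F.foldWord x) (w := w)
        (by rwa [Folding.FoldedRep.wordProd_foldWord, hxu])
      rw [F.projSym_wordSum_eq_smul hP hPT hw hl hC hc hgood hx hxu, h0, zero_smul, map_zero] at h1
      exact h1.false
    · funext ⟨v, hv⟩
      change F.projSym (F.schubert w (F.embedding v)) = F.foldCoeff x w • F.schubertTau u v
      by_cases huv : Folding.BruhatLE F.sTau u v
      · obtain ⟨x', hx', he⟩ := F.exists_schubertTau_eq v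
        have h1 : F.schubert w (F.embedding v) =
            Folding.wordSum F.s F.weightW (F.foldWord x') w := by
          rw [← hx', ← Folding.FoldedRep.wordProd_foldWord]
          exact F.schubert_eq w _
        exact (congrArg F.projSym h1).trans
          ((F.projSym_wordSum_eq_smul hP hPT hw hl hC hc hgood hx hxu x').trans
            (congrArg (F.foldCoeff x w • ·) (he u huv).symm))
      · exact (congrArg F.projSym (F.schubert_eq_zero (hC v hv huv))).trans ((map_zero _).trans
          ((smul_zero _).symm.trans
            (congrArg (F.foldCoeff x w • ·) (F.schubertTau_eq_zero huv).symm)))
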